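/- **Setting.** For $L\ge 2$ let $x(n)=\sum_{l=1}^{L}A_l e^{j2\pi f_l n}+w(n)$, $n=0,\dots,N-1$, where $A_l\in\mathbb C\setminus\{0\}$, $f_l\in[-\tfrac12,\tfrac12]$, and $(w(n))_{n\ge 0}$ is white circular complex Gaussian noise with mean $0$ and variance $\sigma^2>0$. Fix $\Delta>0$, not depending on $N$, and assume that for all $l\ne p$ the frequencies are separated by at least $\Delta$ modulo $1$: $\Delta\le|f_l-f_p|\le 1-\Delta$. Let $\hat m_l$ be a true maximum bin of the $l$-th component, i.e. an integer with $\delta_l:=Nf_l-\hat m_l\in[-\tfrac12,\tfrac12]$. Write $\langle\cdot\rangle$ for the nearest integer. **Algorithm.** Start from $\hat\delta_l=0$, $\hat A_l=0$ for all $l$. One iteration treats $p=1,\dots,L$ in this order, always with the latest estimates. With $\hat f_l=(\hat m_l+\hat\delta_l)/N$, $\hat s_l(n)=\hat A_le^{j2\pi\hat f_l n}$ and $\hat S_p(s)=\frac1N\sum_{n=0}^{N-1}\big(x(n)-\sum_{l\ne p}\hat s_l(n)\big)e^{-j\frac{2\pi}{N}(\hat m_p+\hat\delta_p+s)n}$,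 put $h=\frac12\,\frac{\hat S_p(1/2)+\hat S_p(-1/2)}{\hat S_p(1/2)-\hat S_p(-1/2)}$, replace $\hat\delta_p$ by $\hat\delta_p-\frac{N}{2\pi}\,\Im\ln\!\big(\cos\frac{\pi}{N}-2jh\sin\frac{\pi}{N}\big)$, and then replace $\hat A_p$ by $\hat S_p(0)$, computed with the new $\hat\delta_p$. **Convergence rate.** For $\nu\in\mathbb R^L$ let $H(\nu)\in\mathbb R^L$ be the vector whose $p$-th entry is the above update of $\hat\delta_p$ computed with $\hat\delta=\nu$ and with the amplitude estimates $\hat A$ that satisfy the amplitude equations $\hat A_p=\hat S_p(0)$ for all $p$ at $\hat\delta=\nu$. The convergence rate $r_L$ is the least Lipschitz constant, for the Euclidean norm, of $H$ on $[-\tfrac12,\tfrac12]^L$. "The algorithm converges with rate $b$" means: $b<1$, there is a fixed point $\delta^*$ of $H$ with $\|\delta^*-\delta\|\le C\sqrt{\ln N/N}$, and the vector $\hat\delta^{(q)}$ of residual estimates after $q$ iterations satisfies $\|\hat\delta^{(q)}-\delta^*\|\le C\,b^q$ for all $q\ge0$. "It converges in two iterations" means that moreover for every $p$ the frequency estimate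 after two iterations is within $C\,\frac{\ln N}{\sqrt N}\sqrt{\mathrm{ACRLB}_p}$ of its limit $(\hat m_p+\delta^*_p)/N$, where $\mathrm{ACRLB}_p=\frac{6\sigma^2}{4\pi^2|A_p|^2N^3}$. **Theorem 3.** 1. *Asymptotically.* For every fixed $L$, $(A_l)$, $(f_l)$ as above there is a constant $C$ such that almost surely, for all sufficiently large $N$, $r_L\le C\sqrt{\ln N/N}$, and the algorithm converges with rate $C\sqrt{\ln N/N}$ and in two iterations. 2. *For finite $N$.* Let $a>0$. There are constants $C,C'$, depending only on $a$, $\Delta$ and $\sigma$, such that for every $K$, almost surely there is an $N_0$ such that the following holds for all $N\ge N_0$, all $L\ge2$, all $A_1,\dots,A_L$ with $|A_l|\ge a$, all $f_1,\dots,f_L$ separated as above and all true maximum bins. (a) If $\max_{l\ne p}\frac{|A_l|^2}{\langle N(f_l-f_p)\rangle^2}<\frac{\ln N}{N}$, then $r_L\le\sqrt L\,C\sqrt{\ln N/N}$, and the algorithm converges with rate $\sqrt L\,C\sqrt{\ln N/N}$ and in two iterations. (b) If $\max_{l\ne p}\frac{|A_l|^2}{\langle N(f_l-f_p)\rangle^2}\ge\frac{\ln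 N}{N}$, then, provided $\max_l|A_l|\le KN$, $$r_L\le\sqrt L\,C\max_{l\ne p}\frac{|A_l|}{|\langle N(f_l-f_p)\rangle|};$$ furthermore $$\sqrt L\,C\max_{l\ne p}\frac{|A_l|}{|\langle N(f_l-f_p)\rangle|}\le\sqrt L\,\max_l|A_l|\,\frac{C'}{N},$$ and whenever the right-hand side is less than $1$, the bound on $r_L$ holds (whatever $K$ is) and the algorithm converges with rate $\sqrt L\,C\max_{l\ne p}\frac{|A_l|}{|\langle N(f_l-f_p)\rangle|}$. In all cases the bounds on $r_L$ include that the amplitude equations are uniquely solvable for every $\nu\in[-\tfrac12,\tfrac12]^L$. -/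

import Mathlib

open MeasureTheory ProbabilityTheory Filter
open scoped NNReal ENNReal

noncomputable section

namespace MultiTone

/-! ### Signal and noise -/

/-- The samples of the complex exponential with amplitude `c` and normalised frequency `g`. -/
def tone (c : ℂ) (g : ℝ) (n : ℕ) : ℂ :=
  c * Complex.exp (2 * Real.pi * Complex.I * g * n)

/-- The samples of a sum of `L` exponentials in additive noise `w`. -/
def signal {L : ℕ} (A : Fin L → ℂ) (f : Fin L → ℝ) (w : ℕ → ℂ) (n : ℕ) : ℂ :=
  (∑ l, tone (A l) (f l) n) + w n

/-- White circular complex Gaussian noise with mean zero and variance `σ ^ 2`: all real and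
imaginary parts are independent centred Gaussians of variance `σ ^ 2 / 2`. -/
structure IsWhiteGaussianNoise {Ω : Type*} [MeasurableSpace Ω] (μ : Measure Ω)
    (w : ℕ → Ω → ℂ) (σ : ℝ) : Prop where
  measurable : ∀ n, Measurable (w n)
  indep : iIndepFun
    (fun (i : ℕ × Bool) (ω : Ω) => if i.2 then (w i.1 ω).re else (w i.1 ω).im) μ
  law_re : ∀ n, HasLaw (fun ω => (w n ω).re) (gaussianReal 0 (Real.toNNReal (σ ^ 2 / 2))) μ
  law_im : ∀ n, HasLaw (fun ω => (w n ω).im) (gaussianReal 0 (Real.toNNReal (σ ^ 2 / 2))) μ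

/-- Normalised frequencies whose separation, on the circle of frequencies modulo `1`, is at
least `Δ`. -/
def Separated {L : ℕ} (Δ : ℝ) (f : Fin L → ℝ) : Prop :=
  (∀ l, f l ∈ Set.Icc (-(1 / 2) : ℝ) (1 / 2)) ∧
    ∀ l p, l ≠ p → Δ ≤ |f l - f p| ∧ |f l - f p| ≤ 1 - Δ

/-- `m l` is a maximum bin of the `l`-th exponential: `f l = (m l + δ l) / N` with
`δ l ∈ [-1/2, 1/2]`. -/
def IsMaxBin {L : ℕ} (N : ℕ) (f : Fin L → ℝ) (m : Fin L → ℤ) : Prop :=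
  ∀ l, |N * f l - m l| ≤ 1 / 2

/-- The true frequency residuals `δ l = N f l - m l`. -/
def trueRes {L : ℕ} (N : ℕ) (f : Fin L → ℝ) (m : Fin L → ℤ) : EuclideanSpace ℝ (Fin L) :=
  WithLp.toLp 2 fun l => N * f l - m l

/-! ### The estimator -/

/-- The (normalised) Fourier coefficient of `x 0, …, x (N - 1)` at normalised frequency `g`. -/
def coef (N : ℕ) (x : ℕ → ℂ) (g : ℝ) : ℂ :=
  (1 / N : ℂ) * ∑ n ∈ Finset.range N, x n * Complex.exp (-(2 * Real.pi * Complex.I * g * n))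

/-- The frequency estimate `(m p + ν p) / N`. -/
def freq {L : ℕ} (N : ℕ) (m : Fin L → ℤ) (ν : Fin L → ℝ) (p : Fin L) : ℝ :=
  (m p + ν p) / N

/-- The Fourier coefficient of `x` at location `m p + ν p + s`, minus the total leakage at that
location of the other exponentials, as estimated from the residuals `ν` and amplitudes `a`. -/
def leakFree {L : ℕ} (N : ℕ) (x : ℕ → ℂ) (m : Fin L → ℤ) (ν : Fin L → ℝ) (a : Fin L → ℂ)
    (p : Fin L) (s : ℝ) : ℂ :=
  coef N x ((m p + ν p + s) / N) -
    ∑ l ∈ Finset.univ.erase p, coef N (tone (a l) (freq N m ν l)) ((m p + ν p + s) / N)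

/-- The interpolation function of the two coefficients at `+1/2` and `-1/2`. -/
def interp (Sp Sm : ℂ) : ℂ := 1 / 2 * ((Sp + Sm) / (Sp - Sm))

/-- The interpolation estimate of a residual from the two coefficients at `+1/2` and `-1/2`. -/
def interpRes (N : ℕ) (Sp Sm : ℂ) : ℝ :=
  -(N / (2 * Real.pi)) * (Complex.log (Complex.cos (Real.pi / N)
    - 2 * Complex.I * interp Sp Sm * Complex.sin (Real.pi / N))).im

/-- The updated residual estimate of component `p`: the previous one plus the interpolation
estimate of what remains. -/
def newRes {L : ℕ} (N : ℕ) (x : ℕ → ℂ) (m : Fin L → ℤ) (ν : Fin L → ℝ) (a : Fin L → ℂ)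
    (p : Fin L) : ℝ :=
  ν p + interpRes N (leakFree N x m ν a p (1 / 2)) (leakFree N x m ν a p (-(1 / 2)))

/-- The updated amplitude estimate of component `p`: the coefficient at the estimated frequency
minus the estimated leakage there. -/
def newAmp {L : ℕ} (N : ℕ) (x : ℕ → ℂ) (m : Fin L → ℤ) (ν : Fin L → ℝ) (a : Fin L → ℂ)
    (p : Fin L) : ℂ :=
  leakFree N x m ν a p 0

/-- Current residual estimates and amplitude estimates. -/
@[ext] structure Est (L : ℕ) where
  res : Fin L → ℝ
  amp : Fin L → ℂ

/-- Processing of component `p`: first its residual, then its amplitude, is re-estimated, always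
from the most recent estimates. -/
def step {L : ℕ} (N : ℕ) (x : ℕ → ℂ) (m : Fin L → ℤ) (e : Est L) (p : Fin L) : Est L :=
  let ν := Function.update e.res p (newRes N x m e.res e.amp p)
  ⟨ν, Function.update e.amp p (newAmp N x m ν e.amp p)⟩

/-- One iteration of the algorithm: the components are processed in the order `1, …, L`. -/
def sweep {L : ℕ} (N : ℕ) (x : ℕ → ℂ) (m : Fin L → ℤ) (e : Est L) : Est L :=
  (List.finRange L).foldl (step N x m) e

/-- The residual estimates after `q` iterations, all estimates being initialised to `0`. -/
def iterRes {L : ℕ} (N : ℕ) (x : ℕ → ℂ) (m : Fin L → ℤ) (q : ℕ) : EuclideanSpace ℝ (Fin L) :=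
  WithLp.toLp 2 ((sweep N x m)^[q] ⟨0, 0⟩).res

/-! ### The estimation function of the residuals and the convergence rate -/

/-- The matrix of the leakages of unit exponentials at the estimated frequencies. -/
def leakMatrix {L : ℕ} (N : ℕ) (m : Fin L → ℤ) (ν : Fin L → ℝ) : Matrix (Fin L) (Fin L) ℂ :=
  fun p l => coef N (tone 1 (freq N m ν l)) (freq N m ν p)

/-- The amplitude estimates belonging to the residual estimates `ν`: the solution `a` of the
amplitude equations `a p = newAmp N x m ν a p` for all `p` (see `eq_ampOf_iff`). -/
def ampOf {L : ℕ} (N : ℕ) (x : ℕ → ℂ) (m : Fin L → ℤ) (ν : Fin L → ℝ) : Fin L → ℂ :=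
  (leakMatrix N m ν)⁻¹.mulVec fun p => coef N x (freq N m ν p)

/-- The estimation function `(H 1, …, H L)` of the residuals. -/
def estMap {L : ℕ} (N : ℕ) (x : ℕ → ℂ) (m : Fin L → ℤ) (ν : EuclideanSpace ℝ (Fin L)) :
    EuclideanSpace ℝ (Fin L) :=
  WithLp.toLp 2 fun p => newRes N x m ν (ampOf N x m ν) p

/-- The set `[-1/2, 1/2] ^ L` of possible residuals. -/
def resBox (L : ℕ) : Set (EuclideanSpace ℝ (Fin L)) :=
  {ν | ∀ l, ν l ∈ Set.Icc (-(1 / 2) : ℝ) (1 / 2)}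

/-- The convergence rate `r_L`: the contraction factor (the least Lipschitz constant, for the
Euclidean norm) of the estimation function on `[-1/2, 1/2] ^ L`; infinite if there is none. -/
def convRate {L : ℕ} (N : ℕ) (x : ℕ → ℂ) (m : Fin L → ℤ) : ℝ≥0∞ :=
  ⨅ (r : ℝ≥0) (_ : LipschitzOnWith r (estMap N x m) (resBox L)), (r : ℝ≥0∞)

/-- The amplitude equations are uniquely solvable throughout `[-1/2, 1/2] ^ L`, and the
convergence rate is at most `b`. -/
def RateLE {L : ℕ} (N : ℕ) (x : ℕ → ℂ) (m : Fin L → ℤ) (b : ℝ) : Prop :=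
  (∀ ν ∈ resBox L, IsUnit (leakMatrix N m ν).det) ∧ convRate N x m ≤ ENNReal.ofReal b

/-- The iterates of the algorithm converge to `δ'`, which is a fixed point of the estimation
function, at the geometric rate `b < 1` (with prefactor `C`), and `δ'` is within
`C √(ln N / N)` of the true residuals `δ`. -/
def ConvergesTo {L : ℕ} (N : ℕ) (x : ℕ → ℂ) (m : Fin L → ℤ) (C b : ℝ)
    (δ δ' : EuclideanSpace ℝ (Fin L)) : Prop :=
  b < 1 ∧ (∀ q, ‖iterRes N x m q - δ'‖ ≤ C * b ^ q) ∧
    Tendsto (iterRes N x m) atTop (nhds δ') ∧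
    estMap N x m δ' = δ' ∧ ‖δ' - δ‖ ≤ C * √(Real.log N / N)

/-- The asymptotic Cramer-Rao lower bound `6 / (4 π² ρ N³)`, `ρ = |c|² / σ²`, on the variance
of an estimate of the frequency of an exponential with amplitude `c`. -/
def acrlb (σ : ℝ) (N : ℕ) (c : ℂ) : ℝ :=
  6 / (4 * Real.pi ^ 2 * (‖c‖ ^ 2 / σ ^ 2) * N ^ 3)

/-- Two iterations suffice: after them, the distance of each frequency estimate
`(m p + ν p) / N` from its limit `(m p + δ' p) / N` is of lower order, by the factor
`ln N / √N`, than the square root of the asymptotic Cramer-Rao bound. -/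
def TwoIterations {L : ℕ} (σ : ℝ) (A : Fin L → ℂ) (N : ℕ) (x : ℕ → ℂ) (m : Fin L → ℤ) (C : ℝ)
    (δ' : EuclideanSpace ℝ (Fin L)) : Prop :=
  ∀ p, |freq N m (iterRes N x m 2) p - freq N m δ' p|
    ≤ C * (Real.log N / √N) * √(acrlb σ N (A p))

/-! ### Quantities in the bounds -/

/-- The maximum over `l ≠ p` of `|A l|² / ⟨N (f l - f p)⟩²`, `⟨·⟩` the nearest integer. -/
def maxGamma {L : ℕ} (N : ℕ) (A : Fin L → ℂ) (f : Fin L → ℝ) : ℝ :=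
  ⨆ i : {i : Fin L × Fin L // i.1 ≠ i.2},
    ‖A i.1.1‖ ^ 2 / ((round (N * (f i.1.1 - f i.1.2)) : ℤ) : ℝ) ^ 2

/-- The maximum over `l ≠ p` of `|A l| / |⟨N (f l - f p)⟩|`. -/
def maxRatio {L : ℕ} (N : ℕ) (A : Fin L → ℂ) (f : Fin L → ℝ) : ℝ :=
  ⨆ i : {i : Fin L × Fin L // i.1 ≠ i.2},
    ‖A i.1.1‖ / |((round (N * (f i.1.1 - f i.1.2)) : ℤ) : ℝ)|

/-- The maximum of the `|A l|`. -/
def maxAmp {L : ℕ} (A : Fin L → ℂ) : ℝ := ⨆ l, ‖A l‖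

/-! ### The amplitude equations -/

theorem coef_tone_mul (N : ℕ) (c : ℂ) (g g' : ℝ) :
    coef N (tone c g) g' = coef N (tone 1 g) g' * c := by
  simp only [coef, tone, Finset.mul_sum, Finset.sum_mul]
  exact Finset.sum_congr rfl fun n _ => by ring

theorem coef_tone_self {N : ℕ} (hN : N ≠ 0) (c : ℂ) (g : ℝ) : coef N (tone c g) g = c := by
  have h : ∀ n ∈ Finset.range N, tone c g n *
      Complex.exp (-(2 * Real.pi * Complex.I * g * n)) = c := fun n _ => by
    rw [tone, mul_assoc, ← Complex.exp_add, add_neg_cancel, Complex.exp_zero, mul_one]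
  rw [coef, Finset.sum_congr rfl h, Finset.sum_const, Finset.card_range, nsmul_eq_mul,
    ← mul_assoc, one_div, inv_mul_cancel₀ (Nat.cast_ne_zero.mpr hN), one_mul]

theorem eq_ampOf_iff {L N : ℕ} (hN : N ≠ 0) (x : ℕ → ℂ) (m : Fin L → ℤ) (ν : Fin L → ℝ)
    (hdet : IsUnit (leakMatrix N m ν).det) (a : Fin L → ℂ) :
    a = ampOf N x m ν ↔ ∀ p, a p = newAmp N x m ν a p := by
  have key : (∀ p, a p = newAmp N x m ν a p) ↔
      (leakMatrix N m ν).mulVec a = fun p => coef N x (freq N m ν p) := by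
    rw [funext_iff]
    refine forall_congr' fun p => ?_
    have h1 : (leakMatrix N m ν).mulVec a p = a p +
        ∑ l ∈ Finset.univ.erase p, coef N (tone (a l) (freq N m ν l)) (freq N m ν p) := by
      simp only [Matrix.mulVec, dotProduct, leakMatrix, ← coef_tone_mul]
      rw [← Finset.add_sum_erase _ _ (Finset.mem_univ p), coef_tone_self hN]
    rw [h1, newAmp, leakFree, add_zero, ← freq, eq_sub_iff_add_eq]
  rw [key, ampOf]
  constructor
  · rintro rfl
    rw [Matrix.mulVec_mulVec, Matrix.mul_nonsing_inv _ hdet, Matrix.one_mulVec]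
  · intro h
    rw [← h, Matrix.mulVec_mulVec, Matrix.nonsing_inv_mul _ hdet, Matrix.one_mulVec]

end MultiTone

end

/-! The interpolation step is exact for a single noiseless exponential. If ε is the residual still
to be found, the number under the logarithm equals exp(-2πiε/N), because the numerators of the
Dirichlet kernel at the two half-bin offsets coincide (`dirichlet_interp`). Errors e₊, e₋ of the two
coefficients multiply this number by 1 + u, where u is of order max|e±| / (N|A_p|); the denominator
of u is bounded below through `norm_dirichletDiff_near`. The prefactor N/2π then leaves an
estimation error of order max|e±| / |A_p|, and the variation of that error is controlled in the same
way (`interpRes_eq`, `interpRes_perturb`).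

The errors consist of noise, of size β, and of leakage from the other components. For separated
frequencies the kernel and its variation per bin are O(1/N), and there are at most 2/Δ components,
so the errors are O(M/N + β), with M the largest amplitude. The denominator of u contains only e₊ -
e₋, in which the leakage gains a further factor 1/N (`pairBound_dirichletDiff_far`); this is what
allows M to grow like KN. Consequently, if residuals change by at most t and amplitudes by at most
8Mt, the updated residual changes by at most θt, where θ = const · (M/N + β)/a
(`Regime.newRes_pair`).

The amplitude equations are strictly diagonally dominant, and their solution is Lipschitz in the
residuals with constant 8M. Hence H has Lipschitz constant √L θ, the √L coming from the passage
between the maximum and Euclidean norms. At the true residuals the leakage involves only amplitude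
errors, which are O(β), so H moves them by O(√L β/a), and Banach's theorem on a small ball gives the
fixed point (`Regime.exists_fixedPoint`).

The algorithm does not iterate H, since its amplitudes need not solve the amplitude equations. But
`Regime.newRes_pair` compares arbitrary states: each step brings the treated component within θt of
the fixed state, in residual and in scaled amplitude, and leaves the others alone. One sweep thus
contracts t to θt.

All of this is deterministic once the noise coefficients and their variation are bounded. Almost
surely β = 400σ√(ln N/N) is eventually admissible, by Gaussian tails on a grid of N² frequencies,
Borel–Cantelli and interpolation; no signal parameter enters, whence the uniformity. Finally ⟨N(f_l
- f_p)⟩ lies between ΔN/2 and N in modulus, so M/N and the ratios in the theorem are comparable. -/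

namespace MultiTone

/-! ### Pairs of complex numbers that are bounded and close to each other -/

/-- `z` and `z'` are bounded by `B`, and their distance is at most `B * t`. -/
def PairBound (B t : ℝ) (z z' : ℂ) : Prop := ‖z‖ ≤ B ∧ ‖z'‖ ≤ B ∧ ‖z - z'‖ ≤ B * t

namespace PairBound

variable {B B₁ B₂ t : ℝ} {z z' y y' : ℂ}

theorem nonneg (h : PairBound B t z z') : 0 ≤ B := (norm_nonneg _).trans h.1

theorem mono (h : PairBound B₁ t z z') (ht : 0 ≤ t) (hB : B₁ ≤ B₂) : PairBound B₂ t z z' :=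
  ⟨h.1.trans hB, h.2.1.trans hB, h.2.2.trans (mul_le_mul_of_nonneg_right hB ht)⟩

theorem const (ht : 0 ≤ t) (h : ‖z‖ ≤ B) : PairBound B t z z :=
  ⟨h, h, by rw [sub_self, norm_zero]; exact mul_nonneg ((norm_nonneg _).trans h) ht⟩

theorem add (h₁ : PairBound B₁ t z z') (h₂ : PairBound B₂ t y y') :
    PairBound (B₁ + B₂) t (z + y) (z' + y') := by
  refine ⟨(norm_add_le _ _).trans (add_le_add h₁.1 h₂.1),
    (norm_add_le _ _).trans (add_le_add h₁.2.1 h₂.2.1), ?_⟩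
  rw [add_sub_add_comm, add_mul]
  exact (norm_add_le _ _).trans (add_le_add h₁.2.2 h₂.2.2)

theorem neg (h : PairBound B t z z') : PairBound B t (-z) (-z') := by
  refine ⟨by simpa using h.1, by simpa using h.2.1, ?_⟩
  rw [neg_sub_neg, norm_sub_rev]
  exact h.2.2

theorem sub (h₁ : PairBound B₁ t z z') (h₂ : PairBound B₂ t y y') :
    PairBound (B₁ + B₂) t (z - y) (z' - y') := by
  rw [sub_eq_add_neg, sub_eq_add_neg]
  exact h₁.add h₂.neg

/-- The product rule for differences yields two terms of size B₁B₂t, hence the factor 2. -/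
theorem mul (h₁ : PairBound B₁ t z z') (h₂ : PairBound B₂ t y y') :
    PairBound (2 * B₁ * B₂) t (z * y) (z' * y') := by
  have n₁ := h₁.nonneg
  have n₂ := h₂.nonneg
  have hp : 0 ≤ B₁ * B₂ := mul_nonneg n₁ n₂
  refine ⟨?_, ?_, ?_⟩
  · rw [norm_mul]
    nlinarith [mul_le_mul h₁.1 h₂.1 (norm_nonneg _) n₁]
  · rw [norm_mul]
    nlinarith [mul_le_mul h₁.2.1 h₂.2.1 (norm_nonneg _) n₁]
  · have e : z * y - z' * y' = (z - z') * y + z' * (y - y') := by ring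
    rw [e]
    refine (norm_add_le _ _).trans ?_
    rw [norm_mul, norm_mul]
    have i₁ := mul_le_mul h₁.2.2 h₂.1 (norm_nonneg _) ((norm_nonneg _).trans h₁.2.2)
    have i₂ := mul_le_mul h₁.2.1 h₂.2.2 (norm_nonneg _) n₁
    linarith

theorem const_mul (c : ℂ) (h : PairBound B t z z') : PairBound (‖c‖ * B) t (c * z) (c * z') := by
  refine ⟨?_, ?_, ?_⟩
  · rw [norm_mul]; exact mul_le_mul_of_nonneg_left h.1 (norm_nonneg _)
  · rw [norm_mul]; exact mul_le_mul_of_nonneg_left h.2.1 (norm_nonneg _)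
  · rw [← mul_sub, norm_mul, mul_assoc]; exact mul_le_mul_of_nonneg_left h.2.2 (norm_nonneg _)

/-- The difference of the inverses costs Bt/c². The same constant bounds the inverses themselves,
because c ≤ B gives 1/c ≤ B/c². -/
theorem inv {c : ℝ} (h : PairBound B t z z') (hc : 0 < c) (h₁ : c ≤ ‖z‖)
    (h₂ : c ≤ ‖z'‖) : PairBound (B / c ^ 2) t z⁻¹ z'⁻¹ := by
  have hB : c ≤ B := h₁.trans h.1
  have hcB : 1 / c ≤ B / c ^ 2 := by
    rw [div_le_div_iff₀ hc (by positivity)]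
    nlinarith
  have k₁ : ‖z⁻¹‖ ≤ 1 / c := by
    rw [norm_inv, ← one_div]
    exact one_div_le_one_div_of_le hc h₁
  have k₂ : ‖z'⁻¹‖ ≤ 1 / c := by
    rw [norm_inv, ← one_div]
    exact one_div_le_one_div_of_le hc h₂
  refine ⟨k₁.trans hcB, k₂.trans hcB, ?_⟩
  have z0 : z ≠ 0 := norm_pos_iff.mp (hc.trans_le h₁)
  have z0' : z' ≠ 0 := norm_pos_iff.mp (hc.trans_le h₂)
  have e : z⁻¹ - z'⁻¹ = z⁻¹ * z'⁻¹ * (z' - z) := by field_simp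
  rw [e, norm_mul, norm_mul, norm_sub_rev z' z]
  calc ‖z⁻¹‖ * ‖z'⁻¹‖ * ‖z - z'‖ ≤ 1 / c * (1 / c) * (B * t) := by
        gcongr
        exact h.2.2
    _ = B / c ^ 2 * t := by field_simp

theorem sum {ι : Type*} (s : Finset ι) {F F' : ι → ℂ} (ht : 0 ≤ t)
    (h : ∀ i ∈ s, PairBound B t (F i) (F' i)) :
    PairBound (s.card * B) t (∑ i ∈ s, F i) (∑ i ∈ s, F' i) := by
  classical
  induction s using Finset.induction_on with
  | empty => simpa using const (z := 0) (B := 0) ht (by simp)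
  | insert i s hi ih =>
    rw [Finset.sum_insert hi, Finset.sum_insert hi, Finset.card_insert_of_notMem hi]
    have := (h i (Finset.mem_insert_self _ _)).add
      (ih fun j hj => h j (Finset.mem_insert_of_mem hj))
    convert this using 1
    push_cast
    ring

end PairBound

/-! ### Unit vectors -/

/-- The point of the unit circle at normalised angle `g`. -/
noncomputable def unitExp (g : ℝ) : ℂ := Complex.exp (2 * Real.pi * Complex.I * g)

theorem unitExp_add (g g' : ℝ) : unitExp (g + g') = unitExp g * unitExp g' := by
  rw [unitExp, unitExp, unitExp, ← Complex.exp_add]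
  push_cast
  ring_nf

@[simp] theorem unitExp_zero : unitExp 0 = 1 := by simp [unitExp]

theorem unitExp_neg (g : ℝ) : unitExp (-g) = (unitExp g)⁻¹ := by
  rw [unitExp, unitExp, ← Complex.exp_neg]
  push_cast
  ring_nf

theorem unitExp_eq_exp_ofReal_mul_I (g : ℝ) :
    unitExp g = Complex.exp ((2 * Real.pi * g : ℝ) * Complex.I) := by
  rw [unitExp]
  push_cast
  ring_nf

@[simp] theorem norm_unitExp (g : ℝ) : ‖unitExp g‖ = 1 := by
  rw [unitExp_eq_exp_ofReal_mul_I, Complex.norm_exp_ofReal_mul_I]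

theorem unitExp_nat_mul (n : ℕ) (g : ℝ) : unitExp (n * g) = unitExp g ^ n := by
  rw [unitExp, unitExp, ← Complex.exp_nat_mul]
  push_cast
  ring_nf

theorem unitExp_half : unitExp (1 / 2) = -1 := by
  rw [unitExp_eq_exp_ofReal_mul_I, ← Complex.exp_pi_mul_I]
  push_cast
  ring_nf

theorem norm_unitExp_sub_one (g : ℝ) : ‖unitExp g - 1‖ = 2 * |Real.sin (Real.pi * g)| := by
  rw [unitExp_eq_exp_ofReal_mul_I, mul_comm _ Complex.I, Complex.norm_exp_I_mul_ofReal_sub_one,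
    norm_mul, Real.norm_eq_abs, Real.norm_eq_abs, abs_of_pos (two_pos (α := ℝ))]
  ring_nf

theorem norm_unitExp_sub_one_le (g : ℝ) : ‖unitExp g - 1‖ ≤ 2 * Real.pi * |g| := by
  rw [norm_unitExp_sub_one]
  have h : |Real.sin (Real.pi * g)| ≤ |Real.pi * g| := Real.abs_sin_le_abs
  rw [abs_mul, abs_of_pos Real.pi_pos] at h
  linarith

theorem norm_unitExp_sub_le (g g' : ℝ) : ‖unitExp g - unitExp g'‖ ≤ 2 * Real.pi * |g - g'| := by
  have e : unitExp g - unitExp g' = unitExp g' * (unitExp (g - g') - 1) := by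
    rw [mul_sub, ← unitExp_add, mul_one]
    ring_nf
  rw [e, norm_mul, norm_unitExp, one_mul]
  exact norm_unitExp_sub_one_le _

theorem norm_unitExp_sub_le_seven {g g' t : ℝ} (h : |g - g'| ≤ t) :
    ‖unitExp g - unitExp g'‖ ≤ 7 * t := by
  refine (norm_unitExp_sub_le g g').trans ?_
  have := Real.pi_lt_d2
  nlinarith [abs_nonneg (g - g')]

theorem pairBound_unitExp_sub_one {g g' t : ℝ} (h : |g - g'| ≤ t) :
    PairBound 7 t (unitExp g - 1) (unitExp g' - 1) := by
  have b (x : ℝ) : ‖unitExp x - 1‖ ≤ 7 := by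
    refine (norm_sub_le _ _).trans ?_
    rw [norm_unitExp, norm_one]
    norm_num
  refine ⟨b g, b g', ?_⟩
  rw [sub_sub_sub_cancel_right]
  exact norm_unitExp_sub_le_seven h

/-- Jordan's inequality sin x ≥ 2x/π, applied to π|g| or, beyond 1/2, to π(1 - |g|). -/
theorem four_mul_le_norm_unitExp_sub_one {Δ g : ℝ} (h₀ : 0 < Δ) (h₁ : Δ ≤ |g|)
    (h₂ : |g| ≤ 1 - Δ) : 4 * Δ ≤ ‖unitExp g - 1‖ := by
  rw [norm_unitExp_sub_one]
  have key : 2 * Δ ≤ |Real.sin (Real.pi * |g|)| := by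
    refine le_trans ?_ (le_abs_self _)
    rcases le_total |g| (1 / 2) with h | h
    · have := Real.mul_le_sin (x := Real.pi * |g|) (by positivity)
        (by nlinarith [Real.pi_pos])
      have e : 2 / Real.pi * (Real.pi * |g|) = 2 * |g| := by field_simp
      linarith
    · have := Real.mul_le_sin (x := Real.pi * (1 - |g|))
        (mul_nonneg Real.pi_pos.le (by linarith)) (by nlinarith [Real.pi_pos])
      have e : 2 / Real.pi * (Real.pi * (1 - |g|)) = 2 * (1 - |g|) := by field_simp
      rw [e, show Real.pi * (1 - |g|) = Real.pi - Real.pi * |g| by ring, Real.sin_pi_sub] at this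
      linarith
  have e : |Real.sin (Real.pi * |g|)| = |Real.sin (Real.pi * g)| := by
    rcases abs_cases g with h | h <;> simp [h.1]
  linarith

/-! ### The Dirichlet kernel -/

/-- The Fourier coefficient at frequency `0` of a unit exponential of frequency `g`. -/
noncomputable def dirichlet (N : ℕ) (g : ℝ) : ℂ := (1 / N : ℂ) * ∑ n ∈ Finset.range N, unitExp g ^ n

theorem coef_tone (N : ℕ) (c : ℂ) (g g' : ℝ) :
    coef N (tone c g) g' = c * dirichlet N (g - g') := by
  have h : ∀ n ∈ Finset.range N, tone c g n *
      Complex.exp (-(2 * Real.pi * Complex.I * g' * n)) = c * unitExp (g - g') ^ n := fun n _ => by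
    rw [tone, mul_assoc, ← Complex.exp_add, ← unitExp_nat_mul, unitExp]
    push_cast
    ring_nf
  rw [coef, Finset.sum_congr rfl h, ← Finset.mul_sum, dirichlet]
  ring

theorem dirichlet_zero {N : ℕ} (hN : 0 < N) : dirichlet N 0 = 1 := by
  have : (N : ℂ) ≠ 0 := by exact_mod_cast hN.ne'
  simp [dirichlet, this]

theorem norm_dirichlet_le (N : ℕ) (g : ℝ) : ‖dirichlet N g‖ ≤ 1 := by
  rw [dirichlet, norm_mul]
  have h : ‖∑ n ∈ Finset.range N, unitExp g ^ n‖ ≤ N := by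
    refine (norm_sum_le _ _).trans ?_
    simp
  rcases Nat.eq_zero_or_pos N with rfl | hN
  · simp
  · have : (0 : ℝ) < N := by exact_mod_cast hN
    rw [norm_div, norm_one, Complex.norm_natCast, one_div, inv_mul_le_iff₀ this]
    linarith

/-- Distances are measured in bins, N|g - g'|: the n-th power rotates by at most n ≤ N times the
frequency difference, so the Lipschitz constant does not depend on N. -/
theorem norm_dirichlet_sub_le {N : ℕ} (hN : 0 < N) {g g' t : ℝ} (h : N * |g - g'| ≤ t) :
    ‖dirichlet N g - dirichlet N g'‖ ≤ 7 * t := by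
  have hN' : (0 : ℝ) < N := by exact_mod_cast hN
  rw [dirichlet, dirichlet, ← mul_sub, ← Finset.sum_sub_distrib, norm_mul, norm_div, norm_one,
    Complex.norm_natCast, one_div, inv_mul_le_iff₀ hN']
  calc ‖∑ n ∈ Finset.range N, (unitExp g ^ n - unitExp g' ^ n)‖
      ≤ ∑ n ∈ Finset.range N, ‖unitExp g ^ n - unitExp g' ^ n‖ := norm_sum_le _ _
    _ ≤ ∑ n ∈ Finset.range N, 7 * t := by
        refine Finset.sum_le_sum fun n hn => ?_
        rw [← unitExp_nat_mul, ← unitExp_nat_mul]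
        refine norm_unitExp_sub_le_seven ?_
        rw [← mul_sub, abs_mul, Nat.abs_cast]
        have : (n : ℝ) ≤ N := by exact_mod_cast (Finset.mem_range.mp hn).le
        exact (mul_le_mul_of_nonneg_right this (abs_nonneg _)).trans h
    _ = N * (7 * t) := by simp

theorem pairBound_dirichlet {N : ℕ} (hN : 0 < N) {g g' t : ℝ} (h : N * |g - g'| ≤ t) :
    PairBound 7 t (dirichlet N g) (dirichlet N g') :=
  ⟨(norm_dirichlet_le N g).trans (by norm_num), (norm_dirichlet_le N g').trans (by norm_num),
    norm_dirichlet_sub_le hN h⟩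

theorem dirichlet_mul (N : ℕ) (g : ℝ) :
    dirichlet N g * (unitExp g - 1) = (1 / N : ℂ) * (unitExp (N * g) - 1) := by
  rw [dirichlet, mul_assoc, geom_sum_mul, unitExp_nat_mul]

/-- Away from the integers, the Dirichlet kernel is of order `1 / N`. -/
theorem pairBound_dirichlet_far {N : ℕ} (hN : 0 < N) {d g g' t : ℝ} (hd : 0 < d)
    (h₁ : d ≤ ‖unitExp g - 1‖) (h₂ : d ≤ ‖unitExp g' - 1‖) (h : N * |g - g'| ≤ t) :
    PairBound (98 / d ^ 2 / N) t (dirichlet N g) (dirichlet N g') := by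
  have hN1 : (1 : ℝ) ≤ N := by exact_mod_cast hN
  have hgt : |g - g'| ≤ t := by nlinarith [abs_nonneg (g - g')]
  have ht : 0 ≤ t := (abs_nonneg _).trans hgt
  have e (x : ℝ) (hx : d ≤ ‖unitExp x - 1‖) :
      dirichlet N x = (1 / N : ℂ) * ((unitExp (N * x) - 1) * (unitExp x - 1)⁻¹) := by
    have : unitExp x - 1 ≠ 0 := norm_pos_iff.mp (hd.trans_le hx)
    rw [← mul_assoc, ← dirichlet_mul N, mul_inv_cancel_right₀ this]
  rw [e g h₁, e g' h₂]
  have p₁ : PairBound 7 t (unitExp (N * g) - 1) (unitExp (N * g') - 1) :=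
    pairBound_unitExp_sub_one (by rwa [← mul_sub, abs_mul, Nat.abs_cast])
  have p₂ := (pairBound_unitExp_sub_one hgt).inv hd h₁ h₂
  refine ((p₁.mul p₂).const_mul (1 / N : ℂ)).mono ht (le_of_eq ?_)
  rw [norm_div, norm_one, Complex.norm_natCast]
  field_simp
  norm_num

/-- The difference of the Dirichlet kernel at distance `1 / N`. -/
noncomputable def dirichletDiff (N : ℕ) (g : ℝ) : ℂ :=
  dirichlet N (g - 1 / (2 * N)) - dirichlet N (g + 1 / (2 * N))

/-- Half a bin turns exp(2πiNg) into its negative, whichever the direction of the shift. The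
numerators here and in `dirichlet_add_mul` are therefore equal. -/
theorem dirichlet_sub_mul {N : ℕ} (hN : 0 < N) (g : ℝ) :
    dirichlet N (g - 1 / (2 * N)) * (unitExp (g - 1 / (2 * N)) - 1) =
      -((1 / N : ℂ) * (unitExp (N * g) + 1)) := by
  have hN' : (N : ℝ) ≠ 0 := by exact_mod_cast hN.ne'
  rw [dirichlet_mul]
  have : (N : ℝ) * (g - 1 / (2 * N)) = N * g + -(1 / 2) := by field_simp; ring
  rw [this, unitExp_add, unitExp_neg, unitExp_half]
  norm_num
  ring

theorem dirichlet_add_mul {N : ℕ} (hN : 0 < N) (g : ℝ) :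
    dirichlet N (g + 1 / (2 * N)) * (unitExp (g + 1 / (2 * N)) - 1) =
      -((1 / N : ℂ) * (unitExp (N * g) + 1)) := by
  have hN' : (N : ℝ) ≠ 0 := by exact_mod_cast hN.ne'
  rw [dirichlet_mul]
  have : (N : ℝ) * (g + 1 / (2 * N)) = N * g + 1 / 2 := by field_simp
  rw [this, unitExp_add, unitExp_half]
  ring

/-- With equal numerators, only the difference of the two denominators survives. It is of order 1/N,
which is the additional factor gained over a single kernel. -/
theorem dirichletDiff_mul {N : ℕ} (hN : 0 < N) (g : ℝ) :
    dirichletDiff N g * ((unitExp (g - 1 / (2 * N)) - 1) * (unitExp (g + 1 / (2 * N)) - 1)) =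
      -((1 / N : ℂ) * (unitExp (N * g) + 1) *
        (unitExp (g + 1 / (2 * N)) - unitExp (g - 1 / (2 * N)))) := by
  rw [dirichletDiff]
  linear_combination (unitExp (g + 1 / (2 * N)) - 1) * dirichlet_sub_mul hN g -
    (unitExp (g - 1 / (2 * N)) - 1) * dirichlet_add_mul hN g

/-- The two kernels in `dirichletDiff`, with the weights that occur in the estimator. -/
theorem dirichlet_interp {N : ℕ} (hN : 0 < N) (g : ℝ) :
    dirichlet N (g - 1 / (2 * N)) * (unitExp (g - 1 / (2 * N)) - 1) =
      dirichlet N (g + 1 / (2 * N)) * (unitExp (g + 1 / (2 * N)) - 1) := by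
  rw [dirichlet_sub_mul hN, dirichlet_add_mul hN]

theorem norm_unitExp_half_step_le {N : ℕ} (hN : 0 < N) (g : ℝ) :
    ‖unitExp (g + 1 / (2 * N)) - unitExp (g - 1 / (2 * N))‖ ≤ 7 / N := by
  have hN' : (0 : ℝ) < N := by exact_mod_cast hN
  refine (norm_unitExp_sub_le_seven (t := 1 / N) (le_of_eq ?_)).trans (le_of_eq (by ring))
  have : g + 1 / (2 * N) - (g - 1 / (2 * N)) = 1 / (N : ℝ) := by field_simp; ring
  rw [this, abs_of_pos (by positivity)]

/-- Away from the integers, `dirichletDiff` is of order `1 / N ^ 2`. -/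
theorem pairBound_dirichletDiff_far {N : ℕ} (hN : 0 < N) {d g g' t : ℝ} (hd : 0 < d)
    (h₁ : d ≤ ‖unitExp (g - 1 / (2 * N)) - 1‖) (h₁' : d ≤ ‖unitExp (g + 1 / (2 * N)) - 1‖)
    (h₂ : d ≤ ‖unitExp (g' - 1 / (2 * N)) - 1‖) (h₂' : d ≤ ‖unitExp (g' + 1 / (2 * N)) - 1‖)
    (h : N * |g - g'| ≤ t) :
    PairBound (134456 / d ^ 4 / N ^ 2) t (dirichletDiff N g) (dirichletDiff N g') := by
  have hN1 : (1 : ℝ) ≤ N := by exact_mod_cast hN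
  have hgt : |g - g'| ≤ t := by nlinarith [abs_nonneg (g - g')]
  have ht : 0 ≤ t := (abs_nonneg _).trans hgt
  have e (x : ℝ) (hx : d ≤ ‖unitExp (x - 1 / (2 * N)) - 1‖)
      (hx' : d ≤ ‖unitExp (x + 1 / (2 * N)) - 1‖) :
      dirichletDiff N x = (1 / N : ℂ) * ((unitExp (N * x) + 1) *
        (unitExp x * (unitExp (-(1 / (2 * N))) - unitExp (1 / (2 * N)))) *
        ((unitExp (x - 1 / (2 * N)) - 1)⁻¹ * (unitExp (x + 1 / (2 * N)) - 1)⁻¹)) := by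
    have k : unitExp (x - 1 / (2 * N)) - 1 ≠ 0 := norm_pos_iff.mp (hd.trans_le hx)
    have k' : unitExp (x + 1 / (2 * N)) - 1 ≠ 0 := norm_pos_iff.mp (hd.trans_le hx')
    have a : unitExp (x + 1 / (2 * N)) - unitExp (x - 1 / (2 * N)) =
        unitExp x * (unitExp (1 / (2 * N)) - unitExp (-(1 / (2 * N)))) := by
      rw [mul_sub, ← unitExp_add, ← unitExp_add, ← sub_eq_add_neg]
    rw [← mul_inv, ← mul_assoc, eq_mul_inv_iff_mul_eq₀ (mul_ne_zero k k'), dirichletDiff_mul hN, a]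
    ring
  rw [e g h₁ h₁', e g' h₂ h₂']
  have p₁ : PairBound 7 t (unitExp (N * g) + 1) (unitExp (N * g') + 1) := by
    have b (x : ℝ) : ‖unitExp x + 1‖ ≤ 7 := by
      refine (norm_add_le _ _).trans ?_
      rw [norm_unitExp, norm_one]
      norm_num
    refine ⟨b _, b _, ?_⟩
    rw [add_sub_add_right_eq_sub]
    exact norm_unitExp_sub_le_seven (by rwa [← mul_sub, abs_mul, Nat.abs_cast])
  have p₂ : PairBound (49 / N) t
      (unitExp g * (unitExp (-(1 / (2 * N))) - unitExp (1 / (2 * N))))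
      (unitExp g' * (unitExp (-(1 / (2 * N))) - unitExp (1 / (2 * N)))) := by
    have b := norm_unitExp_half_step_le hN 0
    rw [zero_add, zero_sub, norm_sub_rev] at b
    have b₁ : (7 : ℝ) / N ≤ 49 / N := by gcongr; norm_num
    refine ⟨?_, ?_, ?_⟩
    · rw [norm_mul, norm_unitExp, one_mul]; exact b.trans b₁
    · rw [norm_mul, norm_unitExp, one_mul]; exact b.trans b₁
    · rw [← sub_mul, norm_mul]
      have b' : ‖unitExp g - unitExp g'‖ ≤ 7 * |g - g'| := norm_unitExp_sub_le_seven le_rfl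
      calc _ ≤ 7 * |g - g'| * (7 / N) := by gcongr
        _ ≤ 7 * t * (7 / N) := by gcongr
        _ = _ := by ring
  have p₃ := (pairBound_unitExp_sub_one (g := g - 1 / (2 * N)) (g' := g' - 1 / (2 * N)) (t := t)
    (by rwa [sub_sub_sub_cancel_right])).inv hd h₁ h₂
  have p₄ := (pairBound_unitExp_sub_one (g := g + 1 / (2 * N)) (g' := g' + 1 / (2 * N)) (t := t)
    (by rwa [add_sub_add_right_eq_sub])).inv hd h₁' h₂'
  refine (((p₁.mul p₂).mul (p₃.mul p₄)).const_mul (1 / N : ℂ)).mono ht (le_of_eq ?_)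
  rw [norm_div, norm_one, Complex.norm_natCast]
  field_simp
  norm_num

/-- For |y| ≥ 1/2 the bound is 2(1 - |y|), which meets 2|y|/3 exactly at |y| = 3/4. -/
theorem two_thirds_mul_abs_le_abs_sin {y : ℝ} (hy : |y| ≤ 3 / 4) :
    2 / 3 * |y| ≤ |Real.sin (Real.pi * y)| := by
  have e : |Real.sin (Real.pi * |y|)| = |Real.sin (Real.pi * y)| := by
    rcases abs_cases y with h | h <;> simp [h.1]
  rw [← e]
  refine le_trans ?_ (le_abs_self _)
  rcases le_total |y| (1 / 2) with h | h
  · have := Real.mul_le_sin (x := Real.pi * |y|) (by positivity) (by nlinarith [Real.pi_pos])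
    have e : 2 / Real.pi * (Real.pi * |y|) = 2 * |y| := by field_simp
    linarith [abs_nonneg y]
  · have := Real.mul_le_sin (x := Real.pi * (1 - |y|))
      (mul_nonneg Real.pi_pos.le (by linarith)) (by nlinarith [Real.pi_pos])
    have e : 2 / Real.pi * (Real.pi * (1 - |y|)) = 2 * (1 - |y|) := by field_simp
    rw [e, show Real.pi * (1 - |y|) = Real.pi - Real.pi * |y| by ring, Real.sin_pi_sub] at this
    linarith

/-- The zeros ±1/2 are treated by the sign of x: the nearer one contributes 4/3 times its distance,
and the distance to the other is at most 7/4, where 3/4 · 7/4 ≤ 4/3. The product form matches the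
denominators in `dirichletDiff_mul`. -/
theorem mul_abs_le_norm_unitExp_add_one {x : ℝ} (hx : |x| ≤ 5 / 4) :
    3 / 4 * (|x - 1 / 2| * |x + 1 / 2|) ≤ ‖unitExp x + 1‖ := by
  have e (s : ℝ) (hs : s = 1 / 2 ∨ s = -(1 / 2)) :
      ‖unitExp x + 1‖ = 2 * |Real.sin (Real.pi * (x + s))| := by
    rw [← norm_unitExp_sub_one, unitExp_add]
    rcases hs with rfl | rfl
    · rw [unitExp_half, ← norm_neg]; ring_nf
    · rw [unitExp_neg, unitExp_half, ← norm_neg]; norm_num; ring_nf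
  rw [abs_le] at hx
  rcases le_total 0 x with h | h
  · rw [e (-(1 / 2)) (.inr rfl), ← sub_eq_add_neg]
    have k := two_thirds_mul_abs_le_abs_sin (y := x - 1 / 2) (abs_le.mpr ⟨by linarith, by linarith⟩)
    have k' : |x + 1 / 2| ≤ 7 / 4 := abs_le.mpr ⟨by linarith, by linarith⟩
    nlinarith [abs_nonneg (x - 1 / 2)]
  · rw [e (1 / 2) (.inl rfl)]
    have k := two_thirds_mul_abs_le_abs_sin (y := x + 1 / 2) (abs_le.mpr ⟨by linarith, by linarith⟩)
    have k' : |x - 1 / 2| ≤ 7 / 4 := abs_le.mpr ⟨by linarith, by linarith⟩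
    nlinarith [abs_nonneg (x + 1 / 2)]

/-- Near `0`, the difference of the Dirichlet kernel is bounded away from zero. -/
theorem norm_dirichletDiff_near {N : ℕ} (hN : 2 ≤ N) {g : ℝ} (hg : |N * g| ≤ 5 / 4) :
    1 / 20 ≤ ‖dirichletDiff N g‖ := by
  have hN0 : 0 < N := by omega
  have hN2 : (2 : ℝ) ≤ N := by exact_mod_cast hN
  have hN' : (0 : ℝ) < N := by linarith
  have hNc : (N : ℂ) ≠ 0 := by exact_mod_cast hN0.ne'
  have h1N : 4 * (1 / N : ℝ) ≤ ‖unitExp (1 / N) - 1‖ := by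
    have hi : (1 : ℝ) / N ≤ 1 / 2 := one_div_le_one_div_of_le two_pos hN2
    refine four_mul_le_norm_unitExp_sub_one (by positivity) (le_abs_self _) ?_
    rw [abs_of_pos (by positivity)]
    linarith
  -- At Ng = ±1/2 the factored identity degenerates to 0 = 0. There one kernel equals 1 and the
  -- other is evaluated at distance 1/N from the peak, where it vanishes.
  have hv1 : dirichlet N (1 / N) = 0 := by
    have k : unitExp (1 / N) - 1 ≠ 0 := norm_pos_iff.mp (lt_of_lt_of_le (by positivity) h1N)
    have := dirichlet_mul N (1 / N)
    rw [mul_one_div_cancel hN'.ne'] at this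
    have e1 : unitExp 1 = 1 := by
      rw [show (1 : ℝ) = 1 / 2 + 1 / 2 by norm_num, unitExp_add, unitExp_half]; norm_num
    rw [e1, sub_self, mul_zero] at this
    exact (mul_eq_zero.mp this).resolve_right k
  have hv1' : dirichlet N (-(1 / N)) = 0 := by
    have k : unitExp (-(1 / N)) - 1 ≠ 0 := by
      refine norm_pos_iff.mp (lt_of_lt_of_le ?_ (le_of_le_of_eq h1N ?_))
      · positivity
      · rw [norm_unitExp_sub_one, norm_unitExp_sub_one, mul_neg, Real.sin_neg, abs_neg]
    have := dirichlet_mul N (-(1 / N))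
    rw [mul_neg, mul_one_div_cancel hN'.ne'] at this
    have e1 : unitExp (-1) = 1 := by
      rw [show (-1 : ℝ) = -(1 / 2 + 1 / 2) by norm_num, unitExp_neg, unitExp_add, unitExp_half]
      norm_num
    rw [e1, sub_self, mul_zero] at this
    exact (mul_eq_zero.mp this).resolve_right k
  by_cases hp : N * g = 1 / 2
  · have hg' : g = 1 / (2 * N) := by field_simp; linarith
    rw [dirichletDiff, hg', sub_self, show 1 / (2 * N : ℝ) + 1 / (2 * N) = 1 / N by field_simp; ring,
      hv1, dirichlet_zero hN0]
    norm_num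
  by_cases hm : N * g = -(1 / 2)
  · have hg' : g = -(1 / (2 * N)) := by field_simp; linarith
    rw [dirichletDiff, hg', neg_add_cancel,
      show -(1 / (2 * N : ℝ)) - 1 / (2 * N) = -(1 / N) by field_simp; ring,
      hv1', dirichlet_zero hN0]
    norm_num
  have hP : 0 < |N * g - 1 / 2| * |N * g + 1 / 2| := by
    refine mul_pos (abs_pos.mpr (sub_ne_zero.mpr hp)) (abs_pos.mpr fun h => hm (by linarith))
  have key := congrArg norm (dirichletDiff_mul hN0 g)
  rw [norm_neg, norm_mul, norm_mul, norm_mul, norm_mul, norm_div, norm_one,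
    Complex.norm_natCast] at key
  have u₁ : ‖unitExp (g - 1 / (2 * N)) - 1‖ ≤ 2 * Real.pi * (|N * g - 1 / 2| / N) := by
    refine (norm_unitExp_sub_one_le _).trans (le_of_eq ?_)
    rw [← abs_of_pos hN', ← abs_div, abs_of_pos hN']
    congr 2
    field_simp
  have u₂ : ‖unitExp (g + 1 / (2 * N)) - 1‖ ≤ 2 * Real.pi * (|N * g + 1 / 2| / N) := by
    refine (norm_unitExp_sub_one_le _).trans (le_of_eq ?_)
    rw [← abs_of_pos hN', ← abs_div, abs_of_pos hN']
    congr 2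
    field_simp
  have l₁ := mul_abs_le_norm_unitExp_add_one hg
  have l₂ : 4 * (1 / N : ℝ) ≤ ‖unitExp (g + 1 / (2 * N)) - unitExp (g - 1 / (2 * N))‖ := by
    have e : unitExp (g + 1 / (2 * N)) - unitExp (g - 1 / (2 * N)) =
        unitExp (g - 1 / (2 * N)) * (unitExp (1 / N) - 1) := by
      rw [mul_sub, ← unitExp_add, mul_one]
      congr 2
      field_simp
      ring
    rw [e, norm_mul, norm_unitExp, one_mul]
    exact h1N
  have i₁ : ‖unitExp (g - 1 / (2 * N)) - 1‖ * ‖unitExp (g + 1 / (2 * N)) - 1‖ ≤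
      4 * Real.pi ^ 2 * (|N * g - 1 / 2| * |N * g + 1 / 2|) / N ^ 2 := by
    calc _ ≤ 2 * Real.pi * (|N * g - 1 / 2| / N) * (2 * Real.pi * (|N * g + 1 / 2| / N)) := by
          gcongr
      _ = _ := by field_simp; ring
  have i₂ : 3 * (|N * g - 1 / 2| * |N * g + 1 / 2|) / N ^ 2 ≤ 1 / N * ‖unitExp (N * g) + 1‖ *
      ‖unitExp (g + 1 / (2 * N)) - unitExp (g - 1 / (2 * N))‖ := by
    calc _ = 1 / N * (3 / 4 * (|N * g - 1 / 2| * |N * g + 1 / 2|)) * (4 * (1 / N)) := by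
          field_simp
      _ ≤ _ := by gcongr
  have i₃ := mul_le_mul_of_nonneg_left i₁ (norm_nonneg (dirichletDiff N g))
  have i₄ : 3 * (|N * g - 1 / 2| * |N * g + 1 / 2|) / N ^ 2 ≤ ‖dirichletDiff N g‖ *
      (4 * Real.pi ^ 2 * (|N * g - 1 / 2| * |N * g + 1 / 2|) / N ^ 2) := by linarith
  set P := |N * g - 1 / 2| * |N * g + 1 / 2|
  -- The product of the distances to ±1/2 is nonzero and cancels; what remains is the bound 3/(4π²)
  -- ≥ 1/20.
  have i₅ : 3 ≤ ‖dirichletDiff N g‖ * (4 * Real.pi ^ 2) := by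
    have hq : 0 < P / N ^ 2 := by positivity
    refine le_of_mul_le_mul_right ?_ hq
    calc 3 * (P / N ^ 2) = 3 * P / N ^ 2 := by ring
      _ ≤ _ := i₄
      _ = _ := by ring
  have := Real.pi_lt_d2
  have hpi : Real.pi ^ 2 ≤ 10 := by nlinarith [Real.pi_pos]
  nlinarith [norm_nonneg (dirichletDiff N g)]

theorem pairBound_dirichletDiff {N : ℕ} (hN : 0 < N) {g g' t : ℝ} (h : N * |g - g'| ≤ t) :
    PairBound 14 t (dirichletDiff N g) (dirichletDiff N g') := by
  refine ((pairBound_dirichlet hN (t := t) ?_).sub (pairBound_dirichlet hN (t := t) ?_)).mono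
    ((mul_nonneg N.cast_nonneg (abs_nonneg _)).trans h) (by norm_num)
  · rwa [sub_sub_sub_cancel_right]
  · rwa [add_sub_add_right_eq_sub]

/-! ### The interpolation step -/

/-- Mean value inequality on the disc of radius 1/2, where the derivative 1/(1 + z) has modulus at
most 2. -/
theorem norm_log_one_add_sub_le {u u' : ℂ} (h : ‖u‖ ≤ 1 / 2) (h' : ‖u'‖ ≤ 1 / 2) :
    ‖Complex.log (1 + u) - Complex.log (1 + u')‖ ≤ 2 * ‖u - u'‖ := by
  have key := (convex_closedBall (0 : ℂ) (1 / 2)).norm_image_sub_le_of_norm_hasDerivWithin_le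
    (f := fun z => Complex.log (1 + z)) (f' := fun z => (1 + z)⁻¹) (C := 2)
    (x := u') (y := u) ?_ ?_ (by simpa using h') (by simpa using h)
  · exact key
  · intro z hz
    rw [mem_closedBall_zero_iff] at hz
    have hs : 1 + z ∈ Complex.slitPlane :=
      Complex.mem_slitPlane_of_norm_lt_one (by linarith)
    have := ((hasDerivAt_id z).const_add 1).clog hs
    simpa using this.hasDerivWithinAt
  · intro z hz
    rw [mem_closedBall_zero_iff] at hz
    have : 1 / 2 ≤ ‖1 + z‖ := by
      have := norm_sub_norm_le (1 : ℂ) (-z)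
      rw [norm_one, norm_neg, sub_neg_eq_add] at this
      linarith
    rw [norm_inv]
    exact (inv_anti₀ (by norm_num) this).trans (by norm_num)

/-- The relative perturbation, caused by the errors `ep` and `em` of the two coefficients, of the
number whose argument gives the interpolation estimate. -/
noncomputable def perturbation (N : ℕ) (c : ℂ) (ε : ℝ) (ep em : ℂ) : ℂ :=
  (ep * (unitExp ((ε - 1 / 2) / N) - 1) - em * (unitExp ((ε + 1 / 2) / N) - 1)) *
    (c * dirichletDiff N (ε / N) + (ep - em))⁻¹

theorem div_sub_half {N : ℕ} (hN : 0 < N) (ε : ℝ) : (ε - 1 / 2) / N = ε / N - 1 / (2 * N) := by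
  have hN' : (N : ℝ) ≠ 0 := by exact_mod_cast hN.ne'
  field_simp

theorem div_add_half {N : ℕ} (hN : 0 < N) (ε : ℝ) : (ε + 1 / 2) / N = ε / N + 1 / (2 * N) := by
  have hN' : (N : ℝ) ≠ 0 := by exact_mod_cast hN.ne'
  field_simp

/-- Over the common denominator, cosine and sine recombine into exp(∓iπ/N), each multiplying one
coefficient. In this form the half-bin phases can be matched with the kernel denominators. -/
theorem cos_sub_interp_mul_sin {N : ℕ} {Sp Sm : ℂ} (h : Sp - Sm ≠ 0) :
    Complex.cos (Real.pi / N) - 2 * Complex.I * interp Sp Sm * Complex.sin (Real.pi / N) =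
      (Sp * unitExp (-(1 / (2 * N))) - Sm * unitExp (1 / (2 * N))) * (Sp - Sm)⁻¹ := by
  have e₁ : unitExp (1 / (2 * N)) =
      Complex.cos (Real.pi / N) + Complex.sin (Real.pi / N) * Complex.I := by
    rw [← Complex.exp_mul_I, unitExp]
    push_cast
    ring_nf
  have e₂ : unitExp (-(1 / (2 * N))) =
      Complex.cos (Real.pi / N) - Complex.sin (Real.pi / N) * Complex.I := by
    rw [sub_eq_add_neg, ← neg_mul, ← Complex.sin_neg, ← Complex.cos_neg, ← Complex.exp_mul_I,
      unitExp]
    push_cast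
    ring_nf
  rw [e₁, e₂, interp]
  field_simp
  ring

/-- The errorless parts of numerator and denominator cancel up to the phase exp(-2πiε/N), by
`dirichlet_interp`; only the errors enter u. -/
theorem interpRes_eq {N : ℕ} (hN : 8 ≤ N) {c : ℂ} {ε : ℝ} (hε : |ε| ≤ 5 / 4) {ep em : ℂ}
    (hT : c * dirichletDiff N (ε / N) + (ep - em) ≠ 0) (hu : ‖perturbation N c ε ep em‖ ≤ 1 / 2) :
    interpRes N (c * dirichlet N ((ε - 1 / 2) / N) + ep) (c * dirichlet N ((ε + 1 / 2) / N) + em) =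
      ε - N / (2 * Real.pi) * (Complex.log (1 + perturbation N c ε ep em)).im := by
  have hN0 : 0 < N := by omega
  have hN8 : (8 : ℝ) ≤ N := by exact_mod_cast hN
  have hN' : (0 : ℝ) < N := by linarith
  set u := perturbation N c ε ep em with hu_def
  have hd : c * dirichlet N ((ε - 1 / 2) / N) + ep - (c * dirichlet N ((ε + 1 / 2) / N) + em) =
      c * dirichletDiff N (ε / N) + (ep - em) := by
    rw [dirichletDiff, div_sub_half hN0, div_add_half hN0]
    ring
  have hz : (c * dirichlet N ((ε - 1 / 2) / N) + ep) * unitExp (-(1 / (2 * N))) -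
      (c * dirichlet N ((ε + 1 / 2) / N) + em) * unitExp (1 / (2 * N)) =
      unitExp (-(ε / N)) * (c * dirichletDiff N (ε / N) + (ep - em) +
        (ep * (unitExp ((ε - 1 / 2) / N) - 1) - em * (unitExp ((ε + 1 / 2) / N) - 1))) := by
    have k := dirichlet_interp hN0 (ε / N)
    have a₁ : unitExp (-(1 / (2 * N))) = unitExp (-(ε / N)) * unitExp (ε / N - 1 / (2 * N)) := by
      rw [← unitExp_add]; congr 1; ring
    have a₂ : unitExp (1 / (2 * N)) = unitExp (-(ε / N)) * unitExp (ε / N + 1 / (2 * N)) := by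
      rw [← unitExp_add]; congr 1; ring
    rw [a₁, a₂, dirichletDiff, div_sub_half hN0, div_add_half hN0]
    linear_combination unitExp (-(ε / N)) * c * k
  -- Needed for the principal branch: the total phase is at most 2π · 5/32 + 1 < π, using N ≥ 8.
  have hlog : (Complex.log (1 + u)).im ∈ Set.Icc (-1 : ℝ) 1 := by
    have h1 := (Complex.abs_im_le_norm (Complex.log (1 + u))).trans
      (Complex.norm_log_one_add_half_le_self hu)
    exact abs_le.mp (by linarith)
  have h1u : 1 + u ≠ 0 := by
    intro h
    rw [eq_neg_of_add_eq_zero_right h, norm_neg, norm_one] at hu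
    norm_num at hu
  have hexp : Complex.cos (Real.pi / N) - 2 * Complex.I *
      interp (c * dirichlet N ((ε - 1 / 2) / N) + ep) (c * dirichlet N ((ε + 1 / 2) / N) + em) *
      Complex.sin (Real.pi / N) =
      Complex.exp ((2 * Real.pi * (-(ε / N)) : ℝ) * Complex.I + Complex.log (1 + u)) := by
    rw [cos_sub_interp_mul_sin (by rwa [hd]), hd, hz, Complex.exp_add, Complex.exp_log h1u,
      ← unitExp_eq_exp_ofReal_mul_I, mul_assoc, add_mul, mul_inv_cancel₀ hT]
    rfl
  have him : ((2 * Real.pi * (-(ε / N)) : ℝ) * Complex.I + Complex.log (1 + u)).im =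
      2 * Real.pi * (-(ε / N)) + (Complex.log (1 + u)).im := by
    simp
  have hε' : |ε / N| ≤ 5 / 32 := by
    rw [abs_div, abs_of_pos hN', div_le_iff₀ hN']
    linarith
  rw [abs_le] at hε'
  have hpi := Real.pi_gt_three
  rw [interpRes, hexp, Complex.log_exp, him]
  · field_simp
    ring
  · rw [him]; nlinarith [hlog.1]
  · rw [him]; nlinarith [hlog.2]

theorem pairBound_unitExp_sub_one_near {N : ℕ} (hN : 0 < N) {x x' t : ℝ} (hx : |x| ≤ 7 / 4)
    (hx' : |x'| ≤ 7 / 4) (h : |x - x'| ≤ t) :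
    PairBound (13 / N) t (unitExp (x / N) - 1) (unitExp (x' / N) - 1) := by
  have hN' : (0 : ℝ) < N := by exact_mod_cast hN
  have b (y : ℝ) (hy : |y| ≤ 7 / 4) : ‖unitExp (y / N) - 1‖ ≤ 13 / N := by
    have := norm_unitExp_sub_le_seven (g := y / N) (g' := 0) (t := 7 / 4 / N) (by
      rw [sub_zero, abs_div, abs_of_pos hN']; gcongr)
    rw [unitExp_zero] at this
    refine this.trans ?_
    rw [← mul_div_assoc]
    gcongr
    norm_num
  refine ⟨b x hx, b x' hx', ?_⟩
  rw [sub_sub_sub_cancel_right]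
  have ht := (abs_nonneg _).trans h
  refine (norm_unitExp_sub_le_seven (t := t / N) ?_).trans ?_
  · rw [← sub_div, abs_div, abs_of_pos hN']; gcongr
  · rw [← mul_div_assoc, div_mul_eq_mul_div]
    gcongr
    norm_num

/-- The effect of errors of the two coefficients on the interpolation estimate. -/
theorem interpRes_perturb {N : ℕ} (hN : 8 ≤ N) {c : ℂ} (hc : c ≠ 0) {ε ε' t B : ℝ} (ht : 0 ≤ t)
    (hε : |ε| ≤ 5 / 4) (hε' : |ε'| ≤ 5 / 4) (hεt : |ε - ε'| ≤ t) {ep em ep' em' : ℂ}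
    (hp : PairBound B t ep ep') (hm : PairBound B t em em')
    (hd : PairBound (‖c‖ / 40) t (ep - em) (ep' - em'))
    (hB : 10 ^ 7 * B ≤ N * ‖c‖) :
    |interpRes N (c * dirichlet N ((ε - 1 / 2) / N) + ep)
        (c * dirichlet N ((ε + 1 / 2) / N) + em) - ε| ≤ 10 ^ 7 * B / ‖c‖ ∧
    |(interpRes N (c * dirichlet N ((ε - 1 / 2) / N) + ep)
        (c * dirichlet N ((ε + 1 / 2) / N) + em) - ε) -
      (interpRes N (c * dirichlet N ((ε' - 1 / 2) / N) + ep')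
        (c * dirichlet N ((ε' + 1 / 2) / N) + em') - ε')| ≤ 10 ^ 7 * B / ‖c‖ * t := by
  have hN0 : 0 < N := by omega
  have hN' : (0 : ℝ) < N := by exact_mod_cast hN0
  have hc' : 0 < ‖c‖ := norm_pos_iff.mpr hc
  have hB0 := hp.nonneg
  have hT : PairBound (15 * ‖c‖) t (c * dirichletDiff N (ε / N) + (ep - em))
      (c * dirichletDiff N (ε' / N) + (ep' - em')) := by
    refine (((pairBound_dirichletDiff hN0 (t := t) ?_).const_mul c).add hd).mono ht (by linarith)
    rw [← sub_div, abs_div, abs_of_pos hN', mul_div_cancel₀ _ hN'.ne']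
    exact hεt
  -- The kernel difference is at least 1/20, and the error of at most ‖c‖/40 consumes half of it.
  have low (x : ℝ) (hx : |x| ≤ 5 / 4) (e : ℂ) (he : ‖e‖ ≤ ‖c‖ / 40) :
      ‖c‖ / 40 ≤ ‖c * dirichletDiff N (x / N) + e‖ := by
    have h1 := norm_dirichletDiff_near (N := N) (g := x / N) (by omega)
      (by rwa [mul_div_cancel₀ _ hN'.ne'])
    have h2 := norm_sub_norm_le (c * dirichletDiff N (x / N)) (-e)
    rw [norm_neg, sub_neg_eq_add, norm_mul] at h2
    nlinarith
  have l₁ := low ε hε _ hd.1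
  have l₂ := low ε' hε' _ hd.2.1
  have hTi := hT.inv (by positivity) l₁ l₂
  have hn (x : ℝ) (hx : |x| ≤ 5 / 4) : |x - 1 / 2| ≤ 7 / 4 ∧ |x + 1 / 2| ≤ 7 / 4 := by
    rw [abs_le] at hx
    exact ⟨abs_le.mpr ⟨by linarith, by linarith⟩, abs_le.mpr ⟨by linarith, by linarith⟩⟩
  -- Numerator: two products with bound 2 · B · 13/N. Inverse denominator: 15‖c‖/(‖c‖/40)² =
  -- 24000/‖c‖. With the factor 2 of the last product, 2 · 52 · 24000 < 3 · 10⁶.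
  have hu : PairBound (3 * 10 ^ 6 * B / (N * ‖c‖)) t (perturbation N c ε ep em)
      (perturbation N c ε' ep' em') := by
    refine (((hp.mul (pairBound_unitExp_sub_one_near hN0 (hn ε hε).1 (hn ε' hε').1 ?_)).sub
      (hm.mul (pairBound_unitExp_sub_one_near hN0 (hn ε hε).2 (hn ε' hε').2 ?_))).mul hTi).mono
      ht ?_
    · rwa [sub_sub_sub_cancel_right]
    · rwa [add_sub_add_right_eq_sub]
    · rw [le_div_iff₀ (by positivity)]
      field_simp
      nlinarith
  have hs : 3 * 10 ^ 6 * B / (N * ‖c‖) ≤ 1 / 2 := by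
    rw [div_le_iff₀ (by positivity)]
    linarith
  have hc40 : 0 < ‖c‖ / 40 := by positivity
  have hTne := norm_pos_iff.mp (hc40.trans_le l₁)
  have hTne' := norm_pos_iff.mp (hc40.trans_le l₂)
  rw [interpRes_eq hN hε hTne (hu.1.trans hs), interpRes_eq hN hε' hTne' (hu.2.1.trans hs)]
  set u := perturbation N c ε ep em
  set u' := perturbation N c ε' ep' em'
  have hfac : N / (2 * Real.pi) * (2 * (3 * 10 ^ 6 * B / (N * ‖c‖))) ≤ 10 ^ 7 * B / ‖c‖ := by
    have : N / (2 * Real.pi) * (2 * (3 * 10 ^ 6 * B / (N * ‖c‖))) =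
        (3 * 10 ^ 6 / Real.pi) * (B / ‖c‖) := by
      field_simp
    rw [this, mul_div_assoc (10 ^ 7 : ℝ) B]
    refine mul_le_mul_of_nonneg_right ?_ (by positivity)
    rw [div_le_iff₀ Real.pi_pos]
    nlinarith [Real.pi_gt_three]
  have hpos : 0 ≤ N / (2 * Real.pi) := by positivity
  have e₁ : |(Complex.log (1 + u)).im| ≤ 2 * (3 * 10 ^ 6 * B / (N * ‖c‖)) := by
    have := (Complex.abs_im_le_norm _).trans
      (norm_log_one_add_sub_le (hu.1.trans hs) (u' := 0) (by norm_num))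
    rw [sub_zero, add_zero, Complex.log_one, sub_zero] at this
    linarith [hu.1]
  have e₂ : |(Complex.log (1 + u)).im - (Complex.log (1 + u')).im| ≤
      2 * (3 * 10 ^ 6 * B / (N * ‖c‖)) * t := by
    have := (Complex.abs_im_le_norm _).trans
      (norm_log_one_add_sub_le (hu.1.trans hs) (hu.2.1.trans hs))
    rw [Complex.sub_im] at this
    linarith [hu.2.2]
  constructor
  · rw [sub_sub_cancel_left, abs_neg, abs_mul, abs_of_nonneg hpos]
    exact (mul_le_mul_of_nonneg_left e₁ hpos).trans hfac
  · rw [sub_sub_cancel_left, sub_sub_cancel_left, neg_sub_neg, ← mul_sub, abs_mul,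
      abs_of_nonneg hpos, abs_sub_comm]
    refine (mul_le_mul_of_nonneg_left e₂ hpos).trans ?_
    rw [← mul_assoc]
    exact mul_le_mul_of_nonneg_right hfac ht

/-! ### The errors of the leakage-free coefficients -/

/-- Serves the leakage of an estimated component: both its own location and the evaluation point
move by t, so their difference moves by 2t. -/
theorem PairBound.of_mul {B t k : ℝ} {z z' : ℂ} (h : PairBound B (k * t) z z') (hk : 1 ≤ k) :
    PairBound (k * B) t z z' := by
  have hB := h.nonneg
  have hb : B ≤ k * B := by nlinarith
  refine ⟨h.1.trans hb, h.2.1.trans hb, h.2.2.trans (le_of_eq (by ring))⟩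

theorem norm_sum_erase_mul_le {L : ℕ} (p : Fin L) {z y : Fin L → ℂ} {X q : ℝ}
    (hX : ∀ l, ‖z l‖ ≤ X) (hq : 0 ≤ q) (hy : ∀ l, l ≠ p → ‖y l‖ ≤ q) :
    ‖∑ l ∈ Finset.univ.erase p, z l * y l‖ ≤ L * q * X := by
  have hX0 : 0 ≤ X := (norm_nonneg _).trans (hX p)
  refine (norm_sum_le _ _).trans ?_
  have hc : ((Finset.univ.erase p).card : ℝ) ≤ L := by
    exact_mod_cast (Finset.card_le_univ _).trans (Fintype.card_fin L).le
  calc ∑ l ∈ Finset.univ.erase p, ‖z l * y l‖ ≤ ∑ l ∈ Finset.univ.erase p, X * q := by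
        refine Finset.sum_le_sum fun l hl => ?_
        rw [norm_mul]
        exact mul_le_mul (hX l) (hy l (Finset.ne_of_mem_erase hl)) (norm_nonneg _) hX0
    _ = (Finset.univ.erase p).card * (X * q) := by rw [Finset.sum_const, nsmul_eq_mul]
    _ ≤ L * (X * q) := by gcongr
    _ = _ := by ring

/-- The error, caused by noise and residual leakage, of the leakage-free coefficient of component
`p` at offset `s`. -/
noncomputable def leakErr {L : ℕ} (N : ℕ) (A : Fin L → ℂ) (f : Fin L → ℝ) (w : ℕ → ℂ)
    (m : Fin L → ℤ) (ν : Fin L → ℝ) (a : Fin L → ℂ) (p : Fin L) (s : ℝ) : ℂ :=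
  (∑ l ∈ Finset.univ.erase p, (A l * dirichlet N (f l - (m p + ν p + s) / N) -
    a l * dirichlet N (freq N m ν l - (m p + ν p + s) / N))) + coef N w ((m p + ν p + s) / N)

theorem coef_signal {L : ℕ} (N : ℕ) (A : Fin L → ℂ) (f : Fin L → ℝ) (w : ℕ → ℂ) (g : ℝ) :
    coef N (signal A f w) g = (∑ l, A l * dirichlet N (f l - g)) + coef N w g := by
  simp only [← coef_tone, coef, signal, add_mul, Finset.sum_add_distrib, Finset.sum_mul, mul_add]
  rw [Finset.sum_comm, Finset.mul_sum]

theorem leakFree_signal {L : ℕ} {N : ℕ} (hN : 0 < N) (A : Fin L → ℂ) (f : Fin L → ℝ) (w : ℕ → ℂ)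
    (m : Fin L → ℤ) (ν : Fin L → ℝ) (a : Fin L → ℂ) (p : Fin L) (s : ℝ) :
    leakFree N (signal A f w) m ν a p s =
      A p * dirichlet N ((N * f p - m p - ν p - s) / N) + leakErr N A f w m ν a p s := by
  have hN' : (N : ℝ) ≠ 0 := by exact_mod_cast hN.ne'
  have e : (N * f p - m p - ν p - s) / N = f p - (m p + ν p + s) / N := by field_simp; ring
  rw [leakFree, coef_signal, leakErr, e, ← Finset.add_sum_erase _ _ (Finset.mem_univ p),
    Finset.sum_sub_distrib]
  simp only [coef_tone]
  ring

theorem newRes_signal {L : ℕ} {N : ℕ} (hN : 0 < N) (A : Fin L → ℂ) (f : Fin L → ℝ) (w : ℕ → ℂ)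
    (m : Fin L → ℤ) (ν : Fin L → ℝ) (a : Fin L → ℂ) (p : Fin L) :
    newRes N (signal A f w) m ν a p = ν p + interpRes N
      (A p * dirichlet N ((N * f p - m p - ν p - 1 / 2) / N) + leakErr N A f w m ν a p (1 / 2))
      (A p * dirichlet N ((N * f p - m p - ν p + 1 / 2) / N) +
        leakErr N A f w m ν a p (-(1 / 2))) := by
  rw [newRes, leakFree_signal hN, leakFree_signal hN, sub_neg_eq_add]

theorem newAmp_signal {L : ℕ} {N : ℕ} (hN : 0 < N) (A : Fin L → ℂ) (f : Fin L → ℝ) (w : ℕ → ℂ)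
    (m : Fin L → ℤ) (ν : Fin L → ℝ) (a : Fin L → ℂ) (p : Fin L) :
    newAmp N (signal A f w) m ν a p =
      A p * dirichlet N ((N * f p - m p - ν p) / N) + leakErr N A f w m ν a p 0 := by
  rw [newAmp, leakFree_signal hN, sub_zero]

/-- The number of separated frequencies is bounded. -/
theorem Separated.card_mul_le {L : ℕ} {Δ : ℝ} {f : Fin L → ℝ} (h : Separated Δ f) (hΔ : 0 < Δ)
    (hΔ1 : Δ ≤ 1) : L * Δ ≤ 2 := by
  -- Pigeonhole: an interval of length less than Δ contains at most one frequency, so cells of width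
  -- Δ separate them.
  have hinj : Function.Injective fun l => ⌊(f l + 1 / 2) / Δ⌋₊ := by
    intro l p hlp
    by_contra hne
    have h1 := (h.2 l p hne).1
    have pos (l) : 0 ≤ (f l + 1 / 2) / Δ := div_nonneg (by linarith [(h.1 l).1]) hΔ.le
    have a1 := Nat.floor_le (pos l)
    have a2 := Nat.lt_floor_add_one ((f l + 1 / 2) / Δ)
    have b1 := Nat.floor_le (pos p)
    have b2 := Nat.lt_floor_add_one ((f p + 1 / 2) / Δ)
    simp only at hlp
    rw [hlp] at a1 a2
    rw [le_div_iff₀ hΔ] at a1 b1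
    rw [div_lt_iff₀ hΔ] at a2 b2
    have : |f l - f p| < Δ := abs_lt.mpr ⟨by linarith, by linarith⟩
    linarith
  have hmem : ∀ l, ⌊(f l + 1 / 2) / Δ⌋₊ ∈ Finset.range (⌊1 / Δ⌋₊ + 1) := fun l => by
    rw [Finset.mem_range, Nat.lt_add_one_iff]
    refine Nat.floor_le_floor ?_
    gcongr
    linarith [(h.1 l).2]
  have hcard := Finset.card_le_card_of_injOn (s := Finset.univ) (t := Finset.range (⌊1 / Δ⌋₊ + 1)) _
    (fun l _ => hmem l) hinj.injOn
  rw [Finset.card_univ, Fintype.card_fin, Finset.card_range] at hcard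
  have h2 : (L : ℝ) ≤ ⌊1 / Δ⌋₊ + 1 := by exact_mod_cast hcard
  have h3 := Nat.floor_le (show 0 ≤ 1 / Δ by positivity)
  calc L * Δ ≤ (1 / Δ + 1) * Δ := by gcongr; linarith
    _ = 1 + Δ := by field_simp
    _ ≤ 2 := by linarith

/-- The conditions on the signal, the noise and the number of samples under which the estimator is
analysed: amplitudes between `a` and `M`, noise coefficients bounded by `β`. -/
structure Regime {L : ℕ} (N : ℕ) (Δ a M β : ℝ) (A : Fin L → ℂ) (f : Fin L → ℝ) (w : ℕ → ℂ)
    (m : Fin L → ℤ) : Prop where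
  sep_pos : 0 < Δ
  two_le : 2 ≤ L
  sep : Separated Δ f
  bin : IsMaxBin N f m
  large : 10 ^ 5 / Δ ^ 3 ≤ N
  a_pos : 0 < a
  a_le : ∀ l, a ≤ ‖A l‖
  le_max : ∀ l, ‖A l‖ ≤ M
  noise : ∀ g, ‖coef N w g‖ ≤ β
  noise_lip : ∀ g g', ‖coef N w g - coef N w g'‖ ≤ β * (N * |g - g'|)
  -- The power N², not N, suffices here because this condition protects only the difference of the
  -- two coefficients, where leakage is O(M/N²).
  small : 10 ^ 11 / Δ ^ 5 * (M / N ^ 2 + β) ≤ a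

/-- Two pairs of residual and amplitude estimates at distance `t`. -/
structure StatePair {L : ℕ} (M t : ℝ) (ν ν' : Fin L → ℝ) (b b' : Fin L → ℂ) : Prop where
  -- More room than the box of half-width 1/2, since the fixed point and the iterates may leave that
  -- box.
  left : ∀ l, |ν l| ≤ 3 / 4
  right : ∀ l, |ν' l| ≤ 3 / 4
  dist : ∀ l, |ν l - ν' l| ≤ t
  -- The factor 8 is the one for which the solutions of the amplitude equations satisfy this bound
  -- (`norm_ampOf_sub_le`).
  amp : ∀ l, PairBound (8 * M) t (b l) (b' l)

namespace Regime

variable {L N : ℕ} {Δ a M β t : ℝ} {A : Fin L → ℂ} {f : Fin L → ℝ} {w : ℕ → ℂ} {m : Fin L → ℤ}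
  {ν ν' : Fin L → ℝ} {b b' : Fin L → ℂ} {p l : Fin L}

theorem sep_le (h : Regime N Δ a M β A f w m) : Δ ≤ 1 / 2 := by
  have := h.sep.2 ⟨0, by linarith [h.two_le]⟩ ⟨1, h.two_le⟩ (by simp)
  linarith [this.1, this.2]

theorem le_N (h : Regime N Δ a M β A f w m) : 10 ^ 5 ≤ Δ ^ 3 * N := by
  have := h.large
  rwa [div_le_iff₀ (pow_pos h.sep_pos 3), mul_comm] at this

theorem le_mul_N (h : Regime N Δ a M β A f w m) : 10 ^ 5 ≤ Δ * N := by
  refine h.le_N.trans (mul_le_mul_of_nonneg_right ?_ N.cast_nonneg)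
  have h1 := h.sep_le
  have h2 := h.sep_pos
  calc Δ ^ 3 = Δ * Δ ^ 2 := by ring
    _ ≤ Δ * 1 := by gcongr; exact pow_le_one₀ h2.le (by linarith)
    _ = Δ := mul_one _

theorem N_large (h : Regime N Δ a M β A f w m) : 10 ^ 5 ≤ (N : ℝ) := by
  have h1 := h.sep_le
  have h2 := h.le_mul_N
  nlinarith [N.cast_nonneg (α := ℝ)]

theorem N_ge (h : Regime N Δ a M β A f w m) : 8 ≤ N := by
  have := h.N_large
  have : (8 : ℝ) ≤ N := by linarith
  exact_mod_cast this

theorem N_pos (h : Regime N Δ a M β A f w m) : 0 < N := by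
  have := h.N_ge
  omega

theorem N_pos' (h : Regime N Δ a M β A f w m) : (0 : ℝ) < N := by exact_mod_cast h.N_pos

theorem card_le (h : Regime N Δ a M β A f w m) : (L : ℝ) ≤ 2 / Δ := by
  rw [le_div_iff₀ h.sep_pos]
  exact h.sep.card_mul_le h.sep_pos (by linarith [h.sep_le])

theorem a_le_M (h : Regime N Δ a M β A f w m) : a ≤ M :=
  (h.a_le ⟨0, by linarith [h.two_le]⟩).trans (h.le_max _)

theorem M_pos (h : Regime N Δ a M β A f w m) : 0 < M := h.a_pos.trans_le h.a_le_M

theorem noise_nonneg (h : Regime N Δ a M β A f w m) : 0 ≤ β := (norm_nonneg _).trans (h.noise 0)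

theorem ne_zero (h : Regime N Δ a M β A f w m) (p : Fin L) : A p ≠ 0 :=
  norm_pos_iff.mp (h.a_pos.trans_le (h.a_le p))

theorem small_noise (h : Regime N Δ a M β A f w m) : 10 ^ 11 * β ≤ a := by
  have h1 := h.sep_le
  have h2 := h.sep_pos
  have h3 := h.small
  have h5 : Δ ^ 5 ≤ 1 := pow_le_one₀ h2.le (by linarith)
  have hM := h.M_pos
  have hβ := h.noise_nonneg
  refine le_trans ?_ h3
  have h6 : (10 : ℝ) ^ 11 ≤ 10 ^ 11 / Δ ^ 5 := by
    rw [le_div_iff₀ (by positivity)]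
    linarith
  have h7 : β ≤ M / N ^ 2 + β := by
    have : 0 ≤ M / N ^ 2 := by positivity
    linarith
  exact mul_le_mul h6 h7 hβ (by positivity)

theorem small_max (h : Regime N Δ a M β A f w m) : 10 ^ 11 / Δ ^ 5 * (M / N ^ 2) ≤ a := by
  refine le_trans ?_ h.small
  have h2 := h.sep_pos
  have := h.noise_nonneg
  gcongr
  linarith

/-- Four bins cover two residual discrepancies of at most 5/4 each and an offset of at most 1. The
unit vector then moves by at most 28/N ≤ Δ, out of the available 4Δ. -/
theorem far (h : Regime N Δ a M β A f w m) (hlp : l ≠ p) {g : ℝ}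
    (hg : |N * (g - (f l - f p))| ≤ 4) : Δ ≤ ‖unitExp g - 1‖ := by
  have hs := h.sep.2 l p hlp
  have h1 := four_mul_le_norm_unitExp_sub_one h.sep_pos hs.1 hs.2
  have hN := h.N_pos'
  have h2 : ‖unitExp g - unitExp (f l - f p)‖ ≤ 7 * (4 / N) := by
    refine norm_unitExp_sub_le_seven ?_
    rw [le_div_iff₀ hN]
    rwa [abs_mul, Nat.abs_cast, mul_comm] at hg
  have h3 : 7 * (4 / (N : ℝ)) ≤ Δ := by
    rw [← mul_div_assoc, div_le_iff₀ hN]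
    linarith [h.le_mul_N]
  have h4 := norm_sub_norm_le (unitExp (f l - f p) - 1) (unitExp g - 1)
  rw [sub_sub_sub_cancel_right, norm_sub_rev (unitExp (f l - f p)) (unitExp g)] at h4
  linarith [h.sep_pos]

theorem bin_dist (h : Regime N Δ a M β A f w m) (x : ℝ) (p : Fin L) :
    N * (f p - (m p + x) / N) = N * f p - m p - x := by
  have := h.N_pos'
  field_simp
  ring

theorem abs_res_sub_le (h : Regime N Δ a M β A f w m) {x : ℝ} (hx : |x| ≤ 3 / 4) (p : Fin L) :
    |N * f p - m p - x| ≤ 5 / 4 := by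
  have := h.bin p
  rw [abs_le] at *
  constructor <;> linarith

/-- The factor in the leakage of the true component `l` into component `p`. -/
theorem far_true (h : Regime N Δ a M β A f w m) (hlp : l ≠ p) {x s : ℝ} (hx : |x| ≤ 3 / 4)
    (hs : |s| ≤ 1) : Δ ≤ ‖unitExp (f l - (m p + x + s) / N) - 1‖ := by
  refine h.far hlp ?_
  have h1 := h.abs_res_sub_le hx p
  have h2 := h.bin_dist (x + s) p
  have e : (N : ℝ) * (f l - (m p + x + s) / N - (f l - f p)) = N * f p - m p - x - s := by
    rw [← add_assoc] at h2
    linarith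
  rw [e]
  rw [abs_le] at *
  constructor <;> linarith

/-- The factor in the leakage of the estimated component `l` into component `p`. -/
theorem far_est (h : Regime N Δ a M β A f w m) (hlp : l ≠ p) {x y s : ℝ} (hx : |x| ≤ 3 / 4)
    (hy : |y| ≤ 3 / 4) (hs : |s| ≤ 1) :
    Δ ≤ ‖unitExp ((m l + y) / N - (m p + x + s) / N) - 1‖ := by
  refine h.far hlp ?_
  have h1 := h.abs_res_sub_le hx p
  have h3 := h.abs_res_sub_le hy l
  have h2 := h.bin_dist (x + s) p
  have h4 := h.bin_dist y l
  have e : (N : ℝ) * ((m l + y) / N - (m p + x + s) / N - (f l - f p)) =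
      (N * f p - m p - x - s) - (N * f l - m l - y) := by
    rw [← add_assoc] at h2
    linarith
  rw [e]
  rw [abs_le] at *
  constructor <;> linarith

theorem dist_true (h : Regime N Δ a M β A f w m) {x x' s : ℝ} (hx : |x - x'| ≤ t) (p l : Fin L) :
    N * |f l - (m p + x + s) / N - (f l - (m p + x' + s) / N)| ≤ t := by
  have hN := h.N_pos'
  rw [← Nat.abs_cast N, ← abs_mul]
  refine le_of_eq_of_le ?_ hx
  rw [abs_sub_comm x]
  congr 1
  rw [Nat.abs_cast]
  field_simp
  ring

theorem dist_est (h : Regime N Δ a M β A f w m) {x x' y y' s : ℝ} (hx : |x - x'| ≤ t)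
    (hy : |y - y'| ≤ t) (p l : Fin L) :
    N * |(m l + y) / N - (m p + x + s) / N - ((m l + y') / N - (m p + x' + s) / N)| ≤ 2 * t := by
  have hN := h.N_pos'
  have e : (N : ℝ) * ((m l + y) / N - (m p + x + s) / N - ((m l + y') / N - (m p + x' + s) / N)) =
      (y - y') - (x - x') := by
    field_simp
    ring
  calc _ = |(N : ℝ) * ((m l + y) / N - (m p + x + s) / N -
        ((m l + y') / N - (m p + x' + s) / N))| := by rw [abs_mul, Nat.abs_cast]
    _ ≤ 2 * t := by
      rw [e]
      exact (abs_sub _ _).trans (by linarith)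

theorem pairBound_true (h : Regime N Δ a M β A f w m) (hlp : l ≠ p) {x x' s : ℝ}
    (hx : |x| ≤ 3 / 4) (hx' : |x'| ≤ 3 / 4) (hd : |x - x'| ≤ t) (hs : |s| ≤ 1) :
    PairBound (98 / Δ ^ 2 / N) t (dirichlet N (f l - (m p + x + s) / N))
      (dirichlet N (f l - (m p + x' + s) / N)) :=
  pairBound_dirichlet_far h.N_pos h.sep_pos (h.far_true hlp hx hs) (h.far_true hlp hx' hs)
    (h.dist_true hd p l)

theorem pairBound_est (h : Regime N Δ a M β A f w m) (hlp : l ≠ p) {x x' y y' s : ℝ}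
    (hx : |x| ≤ 3 / 4) (hx' : |x'| ≤ 3 / 4) (hy : |y| ≤ 3 / 4) (hy' : |y'| ≤ 3 / 4)
    (hd : |x - x'| ≤ t) (hd' : |y - y'| ≤ t) (hs : |s| ≤ 1) :
    PairBound (2 * (98 / Δ ^ 2 / N)) t (dirichlet N ((m l + y) / N - (m p + x + s) / N))
      (dirichlet N ((m l + y') / N - (m p + x' + s) / N)) :=
  (pairBound_dirichlet_far h.N_pos h.sep_pos (h.far_est hlp hx hy hs) (h.far_est hlp hx' hy' hs)
    (h.dist_est hd hd' p l)).of_mul one_le_two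

theorem shift_sub (h : Regime N Δ a M β A f w m) (x y : ℝ) (p : Fin L) :
    y - (m p + x + 1 / 2) / N = y - (m p + x + 0) / N - 1 / (2 * N) := by
  have hN := h.N_pos'
  field_simp
  ring

theorem shift_add (h : Regime N Δ a M β A f w m) (x y : ℝ) (p : Fin L) :
    y - (m p + x + -(1 / 2)) / N = y - (m p + x + 0) / N + 1 / (2 * N) := by
  have hN := h.N_pos'
  field_simp
  ring

theorem pairBound_diff_true (h : Regime N Δ a M β A f w m) (hlp : l ≠ p) {x x' : ℝ}
    (hx : |x| ≤ 3 / 4) (hx' : |x'| ≤ 3 / 4) (hd : |x - x'| ≤ t) :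
    PairBound (134456 / Δ ^ 4 / N ^ 2) t (dirichletDiff N (f l - (m p + x + 0) / N))
      (dirichletDiff N (f l - (m p + x' + 0) / N)) := by
  have h1 : |(1 / 2 : ℝ)| ≤ 1 := by norm_num
  have h2 : |(-(1 / 2) : ℝ)| ≤ 1 := by norm_num
  refine pairBound_dirichletDiff_far h.N_pos h.sep_pos ?_ ?_ ?_ ?_ (h.dist_true hd p l)
  · rw [← h.shift_sub]; exact h.far_true hlp hx h1
  · rw [← h.shift_add]; exact h.far_true hlp hx h2
  · rw [← h.shift_sub]; exact h.far_true hlp hx' h1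
  · rw [← h.shift_add]; exact h.far_true hlp hx' h2

theorem pairBound_diff_est (h : Regime N Δ a M β A f w m) (hlp : l ≠ p) {x x' y y' : ℝ}
    (hx : |x| ≤ 3 / 4) (hx' : |x'| ≤ 3 / 4) (hy : |y| ≤ 3 / 4) (hy' : |y'| ≤ 3 / 4)
    (hd : |x - x'| ≤ t) (hd' : |y - y'| ≤ t) :
    PairBound (2 * (134456 / Δ ^ 4 / N ^ 2)) t
      (dirichletDiff N ((m l + y) / N - (m p + x + 0) / N))
      (dirichletDiff N ((m l + y') / N - (m p + x' + 0) / N)) := by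
  have h1 : |(1 / 2 : ℝ)| ≤ 1 := by norm_num
  have h2 : |(-(1 / 2) : ℝ)| ≤ 1 := by norm_num
  refine (pairBound_dirichletDiff_far h.N_pos h.sep_pos ?_ ?_ ?_ ?_
    (h.dist_est hd hd' p l)).of_mul one_le_two
  · rw [← h.shift_sub]; exact h.far_est hlp hx hy h1
  · rw [← h.shift_add]; exact h.far_est hlp hx hy h2
  · rw [← h.shift_sub]; exact h.far_est hlp hx' hy' h1
  · rw [← h.shift_add]; exact h.far_est hlp hx' hy' h2

theorem pairBound_noise (h : Regime N Δ a M β A f w m) {x x' : ℝ} (hd : |x - x'| ≤ t) (s : ℝ) :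
    PairBound β t (coef N w ((m p + x + s) / N)) (coef N w ((m p + x' + s) / N)) := by
  refine ⟨h.noise _, h.noise _, (h.noise_lip _ _).trans ?_⟩
  have e := h.dist_true (s := s) hd p p
  rw [sub_sub_sub_cancel_left, abs_sub_comm] at e
  exact mul_le_mul_of_nonneg_left e h.noise_nonneg

theorem card_erase_mul_le (h : Regime N Δ a M β A f w m) {B : ℝ} (hB : 0 ≤ B) (p : Fin L) :
    ((Finset.univ.erase p).card : ℝ) * B ≤ 2 / Δ * B := by
  have hc : ((Finset.univ.erase p).card : ℝ) ≤ L := by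
    exact_mod_cast (Finset.card_le_univ _).trans (Fintype.card_fin L).le
  exact mul_le_mul_of_nonneg_right (hc.trans h.card_le) hB

/-- Each other component leaks at most 98M/(Δ²N) from its true part and 32 times as much from its
estimate; the sum has at most 2/Δ terms, and 2 · 98 · 33 = 6468 < 10⁴. -/
theorem pairBound_leakErr (h : Regime N Δ a M β A f w m) (hs : StatePair M t ν ν' b b')
    (p : Fin L) {s : ℝ} (hs1 : |s| ≤ 1) :
    PairBound (10 ^ 4 / Δ ^ 3 * (M / N + β)) t (leakErr N A f w m ν b p s)
      (leakErr N A f w m ν' b' p s) := by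
  have ht := (abs_nonneg _).trans (hs.dist p)
  have hN := h.N_pos'
  have hM := h.M_pos
  have hΔ := h.sep_pos
  have hβ := h.noise_nonneg
  set B := M * (98 / Δ ^ 2 / N) + 2 * (8 * M) * (2 * (98 / Δ ^ 2 / N)) with hB
  have hB0 : 0 ≤ B := by positivity
  have key : PairBound ((Finset.univ.erase p).card * B + β) t (leakErr N A f w m ν b p s)
      (leakErr N A f w m ν' b' p s) := by
    refine (PairBound.sum _ ht fun l hl => ?_).add (h.pairBound_noise (hs.dist p) s)
    have hlp := Finset.ne_of_mem_erase hl
    refine PairBound.sub ?_ ?_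
    · refine ((h.pairBound_true hlp (hs.left p) (hs.right p) (hs.dist p) hs1).const_mul _).mono ht
        (mul_le_mul_of_nonneg_right (h.le_max l) (by positivity))
    · exact (hs.amp l).mul (h.pairBound_est hlp (hs.left p) (hs.right p) (hs.left l) (hs.right l)
        (hs.dist p) (hs.dist l) hs1)
  refine key.mono ht ?_
  have h1 := h.card_erase_mul_le hB0 p
  have hΔ1 : 1 ≤ 10 ^ 4 / Δ ^ 3 := by
    rw [le_div_iff₀ (by positivity), one_mul]
    exact (pow_le_one₀ hΔ.le (by linarith [h.sep_le])).trans (by norm_num)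
  have h2 : 2 / Δ * B ≤ 10 ^ 4 / Δ ^ 3 * (M / N) := by
    have : 2 / Δ * B = 6468 / Δ ^ 3 * (M / N) := by rw [hB]; field_simp; norm_num
    rw [this]
    gcongr
    norm_num
  nlinarith

/-- Subtracting the two coefficients turns the leakage kernels into kernel differences, so the
leakage is O(M/N²); the noise gains nothing and contributes 2β. This is the only place where the
error has to be small relative to ‖A p‖ itself. -/
theorem pairBound_leakErr_sub (h : Regime N Δ a M β A f w m) (hs : StatePair M t ν ν' b b')
    (p : Fin L) :
    PairBound (‖A p‖ / 40) t (leakErr N A f w m ν b p (1 / 2) - leakErr N A f w m ν b p (-(1 / 2)))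
      (leakErr N A f w m ν' b' p (1 / 2) - leakErr N A f w m ν' b' p (-(1 / 2))) := by
  have ht := (abs_nonneg _).trans (hs.dist p)
  have hN := h.N_pos'
  have hM := h.M_pos
  have hΔ := h.sep_pos
  have hβ := h.noise_nonneg
  have e (ν : Fin L → ℝ) (b : Fin L → ℂ) :
      leakErr N A f w m ν b p (1 / 2) - leakErr N A f w m ν b p (-(1 / 2)) =
      (∑ l ∈ Finset.univ.erase p, (A l * dirichletDiff N (f l - (m p + ν p + 0) / N) -
        b l * dirichletDiff N ((m l + ν l) / N - (m p + ν p + 0) / N))) +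
      (coef N w ((m p + ν p + 1 / 2) / N) - coef N w ((m p + ν p + -(1 / 2)) / N)) := by
    rw [leakErr, leakErr, add_sub_add_comm, ← Finset.sum_sub_distrib]
    congr 1
    refine Finset.sum_congr rfl fun l _ => ?_
    rw [freq, h.shift_sub, h.shift_add, h.shift_sub, h.shift_add, dirichletDiff, dirichletDiff]
    ring
  rw [e, e]
  set B := M * (134456 / Δ ^ 4 / N ^ 2) + 2 * (8 * M) * (2 * (134456 / Δ ^ 4 / N ^ 2)) with hB
  have hB0 : 0 ≤ B := by positivity
  have key := (PairBound.sum (B := B) (Finset.univ.erase p)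
    (F := fun l => A l * dirichletDiff N (f l - (m p + ν p + 0) / N) -
        b l * dirichletDiff N ((m l + ν l) / N - (m p + ν p + 0) / N))
    (F' := fun l => A l * dirichletDiff N (f l - (m p + ν' p + 0) / N) -
        b' l * dirichletDiff N ((m l + ν' l) / N - (m p + ν' p + 0) / N)) ht fun l hl => ?_).add
    ((h.pairBound_noise (p := p) (hs.dist p) (1 / 2)).sub
      (h.pairBound_noise (p := p) (hs.dist p) (-(1 / 2))))
  · refine key.mono ht ?_
    have h1 := h.card_erase_mul_le hB0 p
    have h2 : 2 / Δ * B ≤ 1 / 2 * (10 ^ 11 / Δ ^ 5 * (M / N ^ 2)) / 80 := by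
      have : 2 / Δ * B = 8874096 / Δ ^ 5 * (M / N ^ 2) := by rw [hB]; field_simp; norm_num
      rw [this]
      have : 0 ≤ M / (N : ℝ) ^ 2 / Δ ^ 5 := by positivity
      have e1 : 8874096 / Δ ^ 5 * (M / N ^ 2) = 8874096 * (M / (N : ℝ) ^ 2 / Δ ^ 5) := by ring
      have e2 : 1 / 2 * (10 ^ 11 / Δ ^ 5 * (M / N ^ 2)) / 80 =
          10 ^ 11 / 160 * (M / (N : ℝ) ^ 2 / Δ ^ 5) := by ring
      rw [e1, e2]
      nlinarith
    have h3 := h.small_max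
    have h4 := h.small_noise
    have h5 := h.a_le p
    linarith
  · have hlp := Finset.ne_of_mem_erase hl
    refine PairBound.sub ?_ ?_
    · refine ((h.pairBound_diff_true hlp (hs.left p) (hs.right p) (hs.dist p)).const_mul _).mono ht
        (mul_le_mul_of_nonneg_right (h.le_max l) (by positivity))
    · exact (hs.amp l).mul (h.pairBound_diff_est hlp (hs.left p) (hs.right p) (hs.left l)
        (hs.right l) (hs.dist p) (hs.dist l))

/-- The update of a residual depends little on the current estimates. -/
theorem newRes_pair (h : Regime N Δ a M β A f w m) (hs : StatePair M t ν ν' b b') (p : Fin L) :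
    |newRes N (signal A f w) m ν b p - (N * f p - m p)| ≤
        10 ^ 11 / Δ ^ 3 * (M / N + β) / ‖A p‖ ∧
      |newRes N (signal A f w) m ν b p - newRes N (signal A f w) m ν' b' p| ≤
        10 ^ 11 / Δ ^ 3 * (M / N + β) / ‖A p‖ * t := by
  have ht := (abs_nonneg _).trans (hs.dist p)
  have hN := h.N_pos'
  have hM := h.M_pos
  have hΔ := h.sep_pos
  have hβ := h.noise_nonneg
  have hA := norm_pos_iff.mpr (h.ne_zero p)
  have key := interpRes_perturb (c := A p) (ε := N * f p - m p - ν p) (ε' := N * f p - m p - ν' p)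
    h.N_ge (h.ne_zero p) ht
    (h.abs_res_sub_le (hs.left p) p) (h.abs_res_sub_le (hs.right p) p)
    (by rw [sub_sub_sub_cancel_left, abs_sub_comm]; exact hs.dist p)
    (h.pairBound_leakErr hs p (s := 1 / 2) (by norm_num))
    (h.pairBound_leakErr hs p (s := -(1 / 2)) (by norm_num)) (h.pairBound_leakErr_sub hs p) ?_
  · rw [← mul_assoc, ← mul_div_assoc, ← pow_add] at key
    rw [newRes_signal h.N_pos, newRes_signal h.N_pos]
    constructor
    · convert key.1 using 2
      ring
    · convert key.2 using 2
      ring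
  · have h1 : (10 : ℝ) ^ 7 * (10 ^ 4 / Δ ^ 3 * (M / N + β)) =
        N * (Δ ^ 2 * (10 ^ 11 / Δ ^ 5 * (M / N ^ 2)) + (10 ^ 11 * β) * (1 / (Δ ^ 3 * N))) := by
      field_simp
    rw [h1]
    refine mul_le_mul_of_nonneg_left ?_ hN.le
    have h2 : Δ ^ 2 ≤ 1 / 4 := by nlinarith [h.sep_le]
    have h3 : 1 / (Δ ^ 3 * N) ≤ 1 / 4 :=
      one_div_le_one_div_of_le (by norm_num) (by linarith [h.le_N])
    have h4 := mul_le_mul h2 h.small_max (by positivity) (by norm_num)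
    have h5 := mul_le_mul h.small_noise h3 (by positivity) h.a_pos.le
    linarith [h.a_le p, h.a_pos]

end Regime
/-! ### The amplitude equations and the estimation function -/

/-- Source of the √L in the rates: updates are controlled coordinate by coordinate, while the rate
refers to the Euclidean norm. -/
theorem norm_le_sqrt_mul_of_forall_le {L : ℕ} {v : EuclideanSpace ℝ (Fin L)} {r : ℝ} (hr : 0 ≤ r)
    (h : ∀ l, |v l| ≤ r) : ‖v‖ ≤ √L * r := by
  rw [EuclideanSpace.norm_eq, ← Real.sqrt_sq hr, ← Real.sqrt_mul (Nat.cast_nonneg L)]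
  refine Real.sqrt_le_sqrt ?_
  calc ∑ l, ‖v l‖ ^ 2 ≤ ∑ _l : Fin L, r ^ 2 := by
        refine Finset.sum_le_sum fun l _ => ?_
        rw [Real.norm_eq_abs]
        exact pow_le_pow_left₀ (abs_nonneg _) (h l) 2
    _ = L * r ^ 2 := by simp

theorem abs_apply_le_norm {L : ℕ} (v : EuclideanSpace ℝ (Fin L)) (l : Fin L) : |v l| ≤ ‖v‖ :=
  PiLp.norm_apply_le v l

namespace Regime

variable {L N : ℕ} {Δ a M β t : ℝ} {A : Fin L → ℂ} {f : Fin L → ℝ} {w : ℕ → ℂ} {m : Fin L → ℤ}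
  {ν ν' : Fin L → ℝ} {b b' : Fin L → ℂ} {p l : Fin L}

/-- Bounds the off-diagonal row sums of the leakage matrix; it makes every leakage feedback
absorbable. -/
theorem card_mul_le (h : Regime N Δ a M β A f w m) : L * (2 * (98 / Δ ^ 2 / N)) ≤ 1 / 200 := by
  have hΔ := h.sep_pos
  have hN := h.N_pos'
  calc L * (2 * (98 / Δ ^ 2 / N)) ≤ 2 / Δ * (2 * (98 / Δ ^ 2 / N)) := by
        gcongr
        exact h.card_le
    _ = 392 / (Δ ^ 3 * N) := by field_simp; norm_num
    _ ≤ 1 / 200 := by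
        rw [div_le_div_iff₀ (by positivity) (by norm_num)]
        linarith [h.le_N]

theorem card_mul_le' (h : Regime N Δ a M β A f w m) : L * (98 / Δ ^ 2 / N) ≤ 1 / 200 := by
  refine le_trans ?_ h.card_mul_le
  have hΔ := h.sep_pos
  have hN := h.N_pos'
  have : 0 ≤ L * (98 / Δ ^ 2 / (N : ℝ)) := by positivity
  linarith

/-- Strict diagonal dominance: the diagonal entries are 1 and each row leaks at most 1/200. -/
theorem isUnit_leakMatrix (h : Regime N Δ a M β A f w m) (hν : ∀ l, |ν l| ≤ 3 / 4) :
    IsUnit (leakMatrix N m ν).det := by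
  rw [isUnit_iff_ne_zero]
  have hΔ := h.sep_pos
  have hN := h.N_pos'
  refine det_ne_zero_of_sum_row_lt_diag fun p => ?_
  have e : leakMatrix N m ν p p = 1 := coef_tone_self h.N_pos.ne' _ _
  rw [e, norm_one]
  calc ∑ l ∈ Finset.univ.erase p, ‖leakMatrix N m ν p l‖
      ≤ ∑ l ∈ Finset.univ.erase p, 2 * (98 / Δ ^ 2 / N) := by
        refine Finset.sum_le_sum fun l hl => ?_
        have := (h.pairBound_est (Finset.ne_of_mem_erase hl) (x := ν p) (x' := ν p) (y := ν l)
          (y' := ν l) (s := 0) (t := 0) (hν p) (hν p) (hν l) (hν l) (by simp) (by simp)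
          (by simp)).1
        rwa [leakMatrix, coef_tone, one_mul, freq, freq, ← add_zero ((m p : ℝ) + ν p)]
    _ = (Finset.univ.erase p).card * (2 * (98 / Δ ^ 2 / N)) := by
        rw [Finset.sum_const, nsmul_eq_mul]
    _ ≤ L * (2 * (98 / Δ ^ 2 / N)) := by
        gcongr
        exact_mod_cast (Finset.card_le_univ _).trans (Fintype.card_fin L).le
    _ < 1 := by linarith [h.card_mul_le]

theorem ampOf_eq (h : Regime N Δ a M β A f w m) (hν : ∀ l, |ν l| ≤ 3 / 4) (p : Fin L) :
    ampOf N (signal A f w) m ν p = A p * dirichlet N ((N * f p - m p - ν p) / N) +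
      leakErr N A f w m ν (ampOf N (signal A f w) m ν) p 0 := by
  have := (eq_ampOf_iff h.N_pos.ne' (signal A f w) m ν (h.isUnit_leakMatrix hν) _).mp rfl p
  rwa [newAmp_signal h.N_pos] at this

theorem norm_leakErr_le (h : Regime N Δ a M β A f w m) (hν : ∀ l, |ν l| ≤ 3 / 4) {X : ℝ}
    (hb : ∀ l, ‖b l‖ ≤ X) (p : Fin L) : ‖leakErr N A f w m ν b p 0‖ ≤ (M + X) / 200 + β := by
  have hΔ := h.sep_pos
  have hN := h.N_pos'
  have hX : 0 ≤ X := (norm_nonneg _).trans (hb p)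
  have hM := h.M_pos
  rw [leakErr, Finset.sum_sub_distrib]
  have h1 := norm_sum_erase_mul_le p h.le_max (q := 98 / Δ ^ 2 / N) (by positivity)
    (y := fun l => dirichlet N (f l - (m p + ν p + 0) / N))
    (fun l hl => (h.pairBound_true hl (x := ν p) (x' := ν p) (s := 0) (t := 0) (hν p) (hν p)
      (by simp) (by simp)).1)
  have h2 := norm_sum_erase_mul_le p hb (q := 2 * (98 / Δ ^ 2 / N)) (by positivity)
    (y := fun l => dirichlet N (freq N m ν l - (m p + ν p + 0) / N))
    (fun l hl => (h.pairBound_est hl (x := ν p) (x' := ν p) (y := ν l) (y' := ν l) (s := 0)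
      (t := 0) (hν p) (hν p) (hν l) (hν l) (by simp) (by simp) (by simp)).1)
  have h3 := mul_le_mul_of_nonneg_right h.card_mul_le' hM.le
  have h4 := mul_le_mul_of_nonneg_right h.card_mul_le hX
  refine (norm_add_le _ _).trans (add_le_add ((norm_sub_le _ _).trans ?_) (h.noise _))
  linarith

/-- At a component where the solution has its maximal modulus X, the amplitude equation gives X ≤ M
+ (M + X)/200 + β. -/
theorem norm_ampOf_le (h : Regime N Δ a M β A f w m) (hν : ∀ l, |ν l| ≤ 3 / 4) (p : Fin L) :
    ‖ampOf N (signal A f w) m ν p‖ ≤ 2 * M := by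
  have : Nonempty (Fin L) := ⟨p⟩
  obtain ⟨k, hk⟩ := Finite.exists_max fun l => ‖ampOf N (signal A f w) m ν l‖
  have h1 := h.norm_leakErr_le hν hk k
  have h2 := congrArg norm (h.ampOf_eq hν k)
  have h3 := norm_add_le (A k * dirichlet N ((N * f k - m k - ν k) / N))
    (leakErr N A f w m ν (ampOf N (signal A f w) m ν) k 0)
  rw [← h2, norm_mul] at h3
  have h4 : ‖A k‖ * ‖dirichlet N ((N * f k - m k - ν k) / N)‖ ≤ M * 1 :=
    mul_le_mul (h.le_max k) (norm_dirichlet_le _ _) (norm_nonneg _) h.M_pos.le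
  have h5 := h.small_noise
  have h6 := h.a_le_M
  have h7 := h.noise_nonneg
  linarith [hk p]

/-- In contrast to `pairBound_leakErr`, no closeness of the amplitudes is presupposed: their
distance Y enters with factor 1/200 and can be absorbed. -/
theorem norm_leakErr_sub_le (h : Regime N Δ a M β A f w m) (hν : ∀ l, |ν l| ≤ 3 / 4)
    (hν' : ∀ l, |ν' l| ≤ 3 / 4) (hd : ∀ l, |ν l - ν' l| ≤ t) {X Y : ℝ}
    (hX : ∀ l, ‖b' l‖ ≤ X) (hY : ∀ l, ‖b l - b' l‖ ≤ Y) (p : Fin L) :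
    ‖leakErr N A f w m ν b p 0 - leakErr N A f w m ν' b' p 0‖ ≤ (M * t + Y + X * t) / 200 + β * t := by
  have hΔ := h.sep_pos
  have hN := h.N_pos'
  have ht := (abs_nonneg _).trans (hd p)
  have hX0 : 0 ≤ X := (norm_nonneg _).trans (hX p)
  have hY0 : 0 ≤ Y := (norm_nonneg _).trans (hY p)
  have hM := h.M_pos
  set D₁ := fun l => dirichlet N (f l - (m p + ν p + 0) / N)
  set D₁' := fun l => dirichlet N (f l - (m p + ν' p + 0) / N)
  set D₂ := fun l => dirichlet N ((m l + ν l) / N - (m p + ν p + 0) / N)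
  set D₂' := fun l => dirichlet N ((m l + ν' l) / N - (m p + ν' p + 0) / N)
  have e : leakErr N A f w m ν b p 0 - leakErr N A f w m ν' b' p 0 =
      (∑ l ∈ Finset.univ.erase p, A l * (D₁ l - D₁' l)) -
      (∑ l ∈ Finset.univ.erase p, (b l - b' l) * D₂ l) -
      (∑ l ∈ Finset.univ.erase p, b' l * (D₂ l - D₂' l)) +
      (coef N w ((m p + ν p + 0) / N) - coef N w ((m p + ν' p + 0) / N)) := by
    rw [leakErr, leakErr, add_sub_add_comm, ← Finset.sum_sub_distrib, ← Finset.sum_sub_distrib,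
      ← Finset.sum_sub_distrib]
    congr 1
    refine Finset.sum_congr rfl fun l _ => ?_
    simp only [freq, D₁, D₁', D₂, D₂']
    ring
  have h1 := norm_sum_erase_mul_le p h.le_max (q := 98 / Δ ^ 2 / N * t) (by positivity)
    (y := fun l => D₁ l - D₁' l)
    (fun l hl => (h.pairBound_true hl (s := 0) (hν p) (hν' p) (hd p) (by simp)).2.2)
  have h2 := norm_sum_erase_mul_le p hY (q := 2 * (98 / Δ ^ 2 / N)) (by positivity)
    (y := D₂)
    (fun l hl => (h.pairBound_est hl (s := 0) (hν p) (hν' p) (hν l) (hν' l) (hd p) (hd l)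
      (by simp)).1)
  have h3 := norm_sum_erase_mul_le p hX (q := 2 * (98 / Δ ^ 2 / N) * t) (by positivity)
    (y := fun l => D₂ l - D₂' l)
    (fun l hl => (h.pairBound_est hl (s := 0) (hν p) (hν' p) (hν l) (hν' l) (hd p) (hd l)
      (by simp)).2.2)
  have h4 := mul_le_mul_of_nonneg_right h.card_mul_le' (mul_nonneg ht hM.le)
  have h5 := mul_le_mul_of_nonneg_right h.card_mul_le hY0
  have h6 := mul_le_mul_of_nonneg_right h.card_mul_le (mul_nonneg ht hX0)
  have h7 := (h.pairBound_noise (p := p) (hd p) 0).2.2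
  rw [e]
  refine (norm_add_le _ _).trans ((add_le_add ((norm_sub_le _ _).trans
    (add_le_add ((norm_sub_le _ _).trans (add_le_add h1 h2)) h3)) h7).trans ?_)
  linarith

/-- The difference of two solutions at its maximal component: the kernel of the component itself
contributes 7Mt, and leakage and noise stay within the remaining Mt. -/
theorem norm_ampOf_sub_le (h : Regime N Δ a M β A f w m) (hν : ∀ l, |ν l| ≤ 3 / 4)
    (hν' : ∀ l, |ν' l| ≤ 3 / 4) (hd : ∀ l, |ν l - ν' l| ≤ t) (p : Fin L) :
    ‖ampOf N (signal A f w) m ν p - ampOf N (signal A f w) m ν' p‖ ≤ 8 * M * t := by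
  have : Nonempty (Fin L) := ⟨p⟩
  have ht := (abs_nonneg _).trans (hd p)
  have hN := h.N_pos'
  obtain ⟨k, hk⟩ := Finite.exists_max fun l =>
    ‖ampOf N (signal A f w) m ν l - ampOf N (signal A f w) m ν' l‖
  have h1 := h.norm_leakErr_sub_le hν hν' hd (h.norm_ampOf_le hν') hk k
  have h2 : ‖A k * dirichlet N ((N * f k - m k - ν k) / N) -
      A k * dirichlet N ((N * f k - m k - ν' k) / N)‖ ≤ M * (7 * t) := by
    rw [← mul_sub, norm_mul]
    refine mul_le_mul (h.le_max k) (norm_dirichlet_sub_le h.N_pos ?_) (norm_nonneg _) h.M_pos.le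
    rw [← sub_div, abs_div, Nat.abs_cast, mul_div_cancel₀ _ hN.ne', sub_sub_sub_cancel_left,
      abs_sub_comm]
    exact hd k
  have h3 := congrArg norm (congrArg₂ (· - ·) (h.ampOf_eq hν k) (h.ampOf_eq hν' k))
  simp only [add_sub_add_comm] at h3
  have h4 := h3.trans_le (norm_add_le _ _)
  have h5 := h.small_noise
  have h6 := h.a_le_M
  have h7 := h.noise_nonneg
  have h8 : β * t ≤ M / 100 * t := by
    gcongr
    linarith
  have h9 := mul_nonneg h.M_pos.le ht
  linarith [hk p]

theorem statePair_ampOf (h : Regime N Δ a M β A f w m) (hν : ∀ l, |ν l| ≤ 3 / 4)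
    (hν' : ∀ l, |ν' l| ≤ 3 / 4) (hd : ∀ l, |ν l - ν' l| ≤ t) :
    StatePair M t ν ν' (ampOf N (signal A f w) m ν) (ampOf N (signal A f w) m ν') :=
  ⟨hν, hν', hd, fun l => ⟨(h.norm_ampOf_le hν l).trans (by linarith [h.M_pos]),
    (h.norm_ampOf_le hν' l).trans (by linarith [h.M_pos]), h.norm_ampOf_sub_le hν hν' hd l⟩⟩

/-- The contraction factor, per component, of the estimation function. -/
theorem div_norm_le (h : Regime N Δ a M β A f w m) (p : Fin L) :
    10 ^ 11 / Δ ^ 3 * (M / N + β) / ‖A p‖ ≤ 10 ^ 11 / Δ ^ 3 * (M / N + β) / a := by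
  have := h.M_pos
  have := h.sep_pos
  have := h.noise_nonneg
  exact div_le_div_of_nonneg_left (by positivity) h.a_pos (h.a_le p)

theorem factor_nonneg (h : Regime N Δ a M β A f w m) :
    0 ≤ 10 ^ 11 / Δ ^ 3 * (M / N + β) / a := by
  have := h.M_pos
  have := h.sep_pos
  have := h.noise_nonneg
  have := h.a_pos
  positivity

theorem norm_estMap_sub_le (h : Regime N Δ a M β A f w m) {ν ν' : EuclideanSpace ℝ (Fin L)}
    (hν : ∀ l, |ν l| ≤ 3 / 4) (hν' : ∀ l, |ν' l| ≤ 3 / 4) :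
    ‖estMap N (signal A f w) m ν - estMap N (signal A f w) m ν'‖ ≤
      √L * (10 ^ 11 / Δ ^ 3 * (M / N + β) / a) * ‖ν - ν'‖ := by
  rw [mul_assoc]
  refine norm_le_sqrt_mul_of_forall_le (mul_nonneg h.factor_nonneg (norm_nonneg _)) fun p => ?_
  have := (h.newRes_pair (h.statePair_ampOf hν hν' fun l => abs_apply_le_norm (ν - ν') l) p).2
  exact this.trans (mul_le_mul_of_nonneg_right (h.div_norm_le p) (norm_nonneg _))

theorem rateLE (h : Regime N Δ a M β A f w m) {r : ℝ}
    (hr : √L * (10 ^ 11 / Δ ^ 3 * (M / N + β) / a) ≤ r) : RateLE N (signal A f w) m r := by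
  have box (ν : EuclideanSpace ℝ (Fin L)) (hν : ν ∈ resBox L) (l : Fin L) : |ν l| ≤ 3 / 4 :=
    (abs_le.mpr (hν l)).trans (by norm_num)
  refine ⟨fun ν hν => h.isUnit_leakMatrix (box ν hν), ?_⟩
  refine iInf₂_le r.toNNReal (LipschitzOnWith.of_dist_le_mul fun ν hν ν' hν' => ?_)
  rw [dist_eq_norm, dist_eq_norm]
  refine (h.norm_estMap_sub_le (box ν hν) (box ν' hν')).trans
    (mul_le_mul_of_nonneg_right (hr.trans (Real.le_coe_toNNReal r)) (norm_nonneg _))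

/-! ### The estimation function near the true residuals -/

theorem abs_trueRes_le (h : Regime N Δ a M β A f w m) (l : Fin L) :
    |trueRes N f m l| ≤ 1 / 2 := h.bin l

theorem freq_trueRes (h : Regime N Δ a M β A f w m) (l : Fin L) :
    (m l + trueRes N f m l) / N = f l := by
  have := h.N_pos'
  rw [trueRes]
  field_simp
  simp

/-- At the true residuals the true and estimated components have the same kernel, so leakage is due
to amplitude errors alone. The distance of the fixed point from the truth is therefore governed by
β, without an M/N term. -/
theorem leakErr_trueRes (h : Regime N Δ a M β A f w m) (b : Fin L → ℂ) (p : Fin L) (s : ℝ) :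
    leakErr N A f w m (trueRes N f m) b p s =
      -(∑ l ∈ Finset.univ.erase p, (b l - A l) *
        dirichlet N (f l - (m p + trueRes N f m p + s) / N)) +
      coef N w ((m p + trueRes N f m p + s) / N) := by
  rw [leakErr, ← Finset.sum_neg_distrib]
  congr 1
  refine Finset.sum_congr rfl fun l _ => ?_
  rw [freq, h.freq_trueRes]
  ring

theorem norm_leakErr_trueRes_le (h : Regime N Δ a M β A f w m) {X : ℝ}
    (hb : ∀ l, ‖b l - A l‖ ≤ X) (p : Fin L) {s : ℝ} (hs : |s| ≤ 1) :
    ‖leakErr N A f w m (trueRes N f m) b p s‖ ≤ X / 200 + β := by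
  have hΔ := h.sep_pos
  have hN := h.N_pos'
  have hX : 0 ≤ X := (norm_nonneg _).trans (hb p)
  have hδ : |trueRes N f m p| ≤ 3 / 4 := (h.abs_trueRes_le p).trans (by norm_num)
  have h1 := norm_sum_erase_mul_le p hb (q := 98 / Δ ^ 2 / N) (by positivity)
    (y := fun l => dirichlet N (f l - (m p + trueRes N f m p + s) / N))
    (fun l hl => (h.pairBound_true hl (t := 0) hδ hδ (by simp) hs).1)
  have h2 := mul_le_mul_of_nonneg_right h.card_mul_le' hX
  rw [h.leakErr_trueRes]
  refine (norm_add_le _ _).trans (add_le_add ?_ (h.noise _))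
  rw [norm_neg]
  linarith

theorem norm_ampOf_trueRes_sub_le (h : Regime N Δ a M β A f w m) (p : Fin L) :
    ‖ampOf N (signal A f w) m (trueRes N f m) p - A p‖ ≤ 2 * β := by
  have : Nonempty (Fin L) := ⟨p⟩
  have hN := h.N_pos'
  have hδ (l) : |trueRes N f m l| ≤ 3 / 4 := (h.abs_trueRes_le l).trans (by norm_num)
  obtain ⟨k, hk⟩ := Finite.exists_max fun l =>
    ‖ampOf N (signal A f w) m (trueRes N f m) l - A l‖
  have h1 := h.norm_leakErr_trueRes_le hk k (s := 0) (by simp)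
  have h2 := h.ampOf_eq hδ k
  have e : (N * f k - m k - trueRes N f m k) / N = 0 := by simp [trueRes]
  rw [e, dirichlet_zero h.N_pos, mul_one, ← sub_eq_iff_eq_add'] at h2
  rw [← h2] at h1
  have := h.noise_nonneg
  linarith [hk p]

theorem norm_estMap_trueRes_sub_le (h : Regime N Δ a M β A f w m) :
    ‖estMap N (signal A f w) m (trueRes N f m) - trueRes N f m‖ ≤ √L * (10 ^ 8 * (β / a)) := by
  have hN := h.N_pos'
  have hβ := h.noise_nonneg
  have ha := h.a_pos
  refine norm_le_sqrt_mul_of_forall_le (by positivity) fun p => ?_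
  set b := ampOf N (signal A f w) m (trueRes N f m)
  have hb := h.norm_ampOf_trueRes_sub_le
  -- A pair of equal states with t = 0: only the one-sided half of `interpRes_perturb` is wanted.
  have pb (s : ℝ) (hs : |s| ≤ 1) : PairBound (3 * β) 0 (leakErr N A f w m (trueRes N f m) b p s)
      (leakErr N A f w m (trueRes N f m) b p s) :=
    PairBound.const le_rfl ((h.norm_leakErr_trueRes_le hb p hs).trans (by linarith))
  have p₁ := pb (1 / 2) (by norm_num)
  have p₂ := pb (-(1 / 2)) (by norm_num)
  have hA := h.a_le p
  have e : (N * f p - m p - trueRes N f m p) = 0 := by simp [trueRes]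
  have hsm := h.small_noise
  have key := (interpRes_perturb (c := A p) (ε := 0) (ε' := 0) h.N_ge (h.ne_zero p) le_rfl
    (by norm_num) (by norm_num) (by simp) p₁ p₂ ((p₁.sub p₂).mono le_rfl (by linarith)) ?_).1
  · change |newRes N (signal A f w) m (trueRes N f m) b p - trueRes N f m p| ≤ _
    rw [newRes_signal h.N_pos, e, add_sub_cancel_left]
    rw [sub_zero] at key
    refine key.trans ?_
    rw [← mul_div_assoc]
    refine div_le_div₀ (by positivity) (by linarith) ha hA
  · have h1 : 1 * ‖A p‖ ≤ N * ‖A p‖ := by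
      gcongr
      linarith [h.N_large]
    linarith

theorem sqrt_card_mul_factor_le (h : Regime N Δ a M β A f w m)
    (hc : 10 ^ 13 / Δ ^ 4 * (M / N + β) ≤ a) :
    √L * (10 ^ 11 / Δ ^ 3 * (M / N + β) / a) ≤ 1 / 50 := by
  have hΔ := h.sep_pos
  have ha := h.a_pos
  have hL : √(L : ℝ) ≤ 2 / Δ := by
    refine le_trans ?_ h.card_le
    have : (1 : ℝ) ≤ L := by exact_mod_cast (by linarith [h.two_le] : 1 ≤ L)
    rw [Real.sqrt_le_left (by linarith)]
    nlinarith
  refine (mul_le_mul_of_nonneg_right hL h.factor_nonneg).trans ?_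
  have e : 2 / Δ * (10 ^ 11 / Δ ^ 3 * (M / N + β) / a) =
      (10 ^ 13 / Δ ^ 4 * (M / N + β)) / a * (1 / 50) := by
    field_simp
    ring
  rw [e]
  have := (div_le_one ha).mpr hc
  linarith

theorem factor_le (h : Regime N Δ a M β A f w m) (hc : 10 ^ 13 / Δ ^ 4 * (M / N + β) ≤ a) :
    10 ^ 11 / Δ ^ 3 * (M / N + β) / a ≤ 1 / 50 := by
  refine le_trans ?_ (h.sqrt_card_mul_factor_le hc)
  have : (1 : ℝ) ≤ √L := by
    rw [Real.one_le_sqrt]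
    exact_mod_cast (by linarith [h.two_le] : 1 ≤ L)
  exact le_mul_of_one_le_left h.factor_nonneg this

/-- The estimation function has a fixed point near the true residuals. -/
theorem exists_fixedPoint (h : Regime N Δ a M β A f w m)
    (hc : 10 ^ 13 / Δ ^ 4 * (M / N + β) ≤ a) :
    ∃ δ' : EuclideanSpace ℝ (Fin L), estMap N (signal A f w) m δ' = δ' ∧
      (∀ l, |δ' l| ≤ 5 / 8) ∧ ‖δ' - trueRes N f m‖ ≤ 2 * (√L * (10 ^ 8 * (β / a))) := by
  set H := estMap N (signal A f w) m
  set δ := trueRes N f m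
  -- Radius 1/8 keeps coordinates below 1/2 + 1/8 = 5/8, with another 1/8 to spare below 3/4 for the
  -- iterates. The ball is invariant since 1/50 · 1/8 + 1/50 ≤ 1/8.
  set s := Metric.closedBall δ (1 / 8)
  have hs (ν : EuclideanSpace ℝ (Fin L)) (hν : ν ∈ s) (l : Fin L) : |ν l| ≤ 5 / 8 := by
    rw [mem_closedBall_iff_norm] at hν
    have h1 := (abs_apply_le_norm (ν - δ) l).trans hν
    have h2 := h.abs_trueRes_le l
    have h3 := abs_add_le (ν l - δ l) (δ l)
    rw [sub_add_cancel] at h3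
    change |ν l - δ l| ≤ _ at h1
    change |δ l| ≤ _ at h2
    linarith
  have hlip (ν ν' : EuclideanSpace ℝ (Fin L)) (hν : ν ∈ s) (hν' : ν' ∈ s) :
      ‖H ν - H ν'‖ ≤ 1 / 50 * ‖ν - ν'‖ :=
    (h.norm_estMap_sub_le (fun l => (hs ν hν l).trans (by norm_num))
      (fun l => (hs ν' hν' l).trans (by norm_num))).trans
      (mul_le_mul_of_nonneg_right (h.sqrt_card_mul_factor_le hc) (norm_nonneg _))
  have hδ : δ ∈ s := Metric.mem_closedBall_self (by norm_num)
  have hδs : ‖H δ - δ‖ ≤ √L * (10 ^ 8 * (β / a)) := h.norm_estMap_trueRes_sub_le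
  have hsmall : √L * (10 ^ 8 * (β / a)) ≤ 1 / 50 := by
    refine le_trans ?_ (h.sqrt_card_mul_factor_le hc)
    refine mul_le_mul_of_nonneg_left ?_ (Real.sqrt_nonneg _)
    rw [← mul_div_assoc]
    refine div_le_div_of_nonneg_right ?_ h.a_pos.le
    have h1 := h.sep_le
    have h2 := h.sep_pos
    have h3 : (1 : ℝ) ≤ 1 / Δ ^ 3 := by
      rw [le_div_iff₀ (by positivity), one_mul]
      exact pow_le_one₀ h2.le (by linarith)
    have h4 : β ≤ M / N + β := by
      have := h.M_pos
      have : 0 ≤ M / N := by positivity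
      linarith
    have h5 : (10 : ℝ) ^ 8 ≤ 10 ^ 11 / Δ ^ 3 := by
      rw [← mul_one_div]
      linarith
    exact mul_le_mul h5 h4 h.noise_nonneg (by positivity)
  have hmaps : Set.MapsTo H s s := fun ν hν => by
    have h1 := hlip ν δ hν hδ
    have h2 : ‖ν - δ‖ ≤ 1 / 8 := mem_closedBall_iff_norm.mp hν
    have h3 := norm_add_le (H ν - H δ) (H δ - δ)
    rw [sub_add_sub_cancel] at h3
    exact mem_closedBall_iff_norm.mpr (by linarith)
  have hcontr : ContractingWith (1 / 50) (hmaps.restrict H s s) := by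
    refine ⟨by rw [← NNReal.coe_lt_coe]; norm_num, LipschitzWith.of_dist_le_mul fun x y => ?_⟩
    have := hlip x y x.2 y.2
    rw [← dist_eq_norm, ← dist_eq_norm] at this
    rw [Subtype.dist_eq, Subtype.dist_eq]
    simpa using this
  obtain ⟨δ', hδ's, hfix, -⟩ := hcontr.exists_fixedPoint' Metric.isClosed_closedBall.isComplete
    hmaps hδ (edist_ne_top _ _)
  refine ⟨δ', hfix, hs δ' hδ's, ?_⟩
  have h1 := hlip δ' δ hδ's hδ
  have h3 := norm_add_le (H δ' - H δ) (H δ - δ)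
  rw [sub_add_sub_cancel] at h3
  rw [hfix.eq] at h1 h3
  -- With d the distance to the truth, d ≤ d/50 + ‖H δ - δ‖, which gives the factor 2.
  linarith [norm_nonneg (δ' - δ)]

end Regime
/-! ### Convergence of the iteration -/

namespace Regime

variable {L N : ℕ} {Δ a M β t : ℝ} {A : Fin L → ℂ} {f : Fin L → ℝ} {w : ℕ → ℂ} {m : Fin L → ℤ}
  {δ' : EuclideanSpace ℝ (Fin L)} {e : Est L}

/-- The state consisting of δ' and its amplitudes is itself fixed by the updates, so the step is a
comparison of two states. The treated residual becomes θt-close first; the amplitude, computed from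
it, then inherits this closeness. -/
theorem statePair_step (h : Regime N Δ a M β A f w m)
    (hc : 10 ^ 13 / Δ ^ 4 * (M / N + β) ≤ a) (hδ : ∀ l, |δ' l| ≤ 5 / 8)
    (hfix : estMap N (signal A f w) m δ' = δ') (ht : t ≤ 1)
    (hs : StatePair M t e.res δ' e.amp (ampOf N (signal A f w) m δ')) (p : Fin L) :
    StatePair M t (step N (signal A f w) m e p).res δ' (step N (signal A f w) m e p).amp
        (ampOf N (signal A f w) m δ') ∧
      |(step N (signal A f w) m e p).res p - δ' p| ≤
        10 ^ 11 / Δ ^ 3 * (M / N + β) / ‖A p‖ * t ∧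
      ‖(step N (signal A f w) m e p).amp p - ampOf N (signal A f w) m δ' p‖ ≤
        8 * M * (10 ^ 11 / Δ ^ 3 * (M / N + β) / a * t) := by
  have ht0 := (abs_nonneg _).trans (hs.dist p)
  have hN := h.N_pos'
  have hM := h.M_pos
  have hΔ := h.sep_pos
  have hβ := h.noise_nonneg
  have ha := h.a_pos
  have hA := norm_pos_iff.mpr (h.ne_zero p)
  have hθ := h.factor_le hc
  have hθ0 := h.factor_nonneg
  set θ := 10 ^ 11 / Δ ^ 3 * (M / N + β) / a with hθ_def
  set x := signal A f w
  set b' := ampOf N x m δ'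
  set r := newRes N x m e.res e.amp p
  set ν := Function.update e.res p r
  have hr : |r - δ' p| ≤ 10 ^ 11 / Δ ^ 3 * (M / N + β) / ‖A p‖ * t := by
    have h1 := (h.newRes_pair hs p).2
    have h2 : newRes N x m δ' b' p = δ' p := congrArg (fun v : EuclideanSpace ℝ (Fin L) => v p) hfix
    rwa [h2] at h1
  have hrθ : |r - δ' p| ≤ θ * t := hr.trans (mul_le_mul_of_nonneg_right (h.div_norm_le p) ht0)
  have hθt : θ * t ≤ 1 / 50 * t := mul_le_mul_of_nonneg_right hθ ht0
  have hr34 : |r| ≤ 3 / 4 := by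
    have h3 := abs_add_le (r - δ' p) (δ' p)
    rw [sub_add_cancel] at h3
    linarith [hδ p]
  have hν : StatePair M t ν δ' e.amp b' := by
    refine ⟨fun l => ?_, hs.right, fun l => ?_, hs.amp⟩
    · by_cases hl : l = p
      · subst hl; simpa [ν] using hr34
      · simpa [ν, hl] using hs.left l
    · by_cases hl : l = p
      · subst hl
        have : |r - δ' l| ≤ t := by linarith
        simpa [ν] using this
      · simpa [ν, hl] using hs.dist l
  set z := newAmp N x m ν e.amp p
  -- The kernel costs 7‖A p‖ |r - δ' p|, where ‖A p‖ cancels against the denominator in the residual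
  -- bound; the leakage adds only a 10⁻⁷ fraction, so 8M suffices.
  have hz : ‖z - b' p‖ ≤ 8 * M * (θ * t) := by
    have h1 := (h.pairBound_leakErr hν p (s := 0) (by simp)).2.2
    have h2 : z = A p * dirichlet N ((N * f p - m p - r) / N) + leakErr N A f w m ν e.amp p 0 := by
      have := newAmp_signal h.N_pos A f w m ν e.amp p
      simpa [ν] using this
    have h3 : b' p = A p * dirichlet N ((N * f p - m p - δ' p) / N) +
        leakErr N A f w m δ' b' p 0 := h.ampOf_eq (fun l => (hδ l).trans (by norm_num)) p
    have h4 : ‖A p * dirichlet N ((N * f p - m p - r) / N) -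
        A p * dirichlet N ((N * f p - m p - δ' p) / N)‖ ≤
        7 * (10 ^ 11 / Δ ^ 3 * (M / N + β) * t) := by
      rw [← mul_sub, norm_mul]
      have h5 := norm_dirichlet_sub_le h.N_pos (g := (N * f p - m p - r) / N)
        (g' := (N * f p - m p - δ' p) / N) (t := |r - δ' p|) (by
          rw [← sub_div, abs_div, Nat.abs_cast, mul_div_cancel₀ _ hN.ne', sub_sub_sub_cancel_left,
            abs_sub_comm])
      calc _ ≤ ‖A p‖ * (7 * (10 ^ 11 / Δ ^ 3 * (M / N + β) / ‖A p‖ * t)) := by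
            refine mul_le_mul_of_nonneg_left (h5.trans ?_) hA.le
            linarith
        _ = _ := by field_simp
    rw [h2, h3, add_sub_add_comm]
    refine (norm_add_le _ _).trans ((add_le_add h4 h1).trans ?_)
    have h6 : 10 ^ 11 / Δ ^ 3 * (M / N + β) * t = a * (θ * t) := by
      rw [hθ_def]; field_simp
    have h7 : 10 ^ 4 / Δ ^ 3 * (M / N + β) * t = a * (θ * t) / 10 ^ 7 := by
      rw [hθ_def]; field_simp
    have h8 : a * (θ * t) ≤ M * (θ * t) :=
      mul_le_mul_of_nonneg_right h.a_le_M (mul_nonneg hθ0 ht0)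
    have h9 : 0 ≤ M * (θ * t) := mul_nonneg hM.le (mul_nonneg hθ0 ht0)
    linarith
  have hstep : step N x m e p = ⟨ν, Function.update e.amp p z⟩ := rfl
  have hb' := h.norm_ampOf_le (fun l => (hδ l).trans (by norm_num : (5 / 8 : ℝ) ≤ 3 / 4)) p
  rw [hstep]
  refine ⟨⟨hν.left, hν.right, hν.dist, fun l => ?_⟩, ?_, ?_⟩
  · by_cases hl : l = p
    · subst hl
      have h9 := mul_le_mul_of_nonneg_left hθt hM.le
      have h10 := mul_le_mul_of_nonneg_left ht hM.le
      have h11 := mul_nonneg hM.le ht0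
      have : PairBound (8 * M) t z (b' l) := by
        refine ⟨?_, hb'.trans (by linarith), by linarith⟩
        have h3 := norm_add_le (z - b' l) (b' l)
        rw [sub_add_cancel] at h3
        linarith
      simpa using this
    · simpa [hl] using hs.amp l
  · simpa [ν] using hr
  · simpa using hz

/-- Within a sweep only the treated components have improved, so t itself is the invariant. The
disjunction carries along those already improved: a step changes no component but its own. -/
theorem statePair_foldl (h : Regime N Δ a M β A f w m)
    (hc : 10 ^ 13 / Δ ^ 4 * (M / N + β) ≤ a) (hδ : ∀ l, |δ' l| ≤ 5 / 8)
    (hfix : estMap N (signal A f w) m δ' = δ') (ht : t ≤ 1) (ps : List (Fin L)) (e : Est L)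
    (hs : StatePair M t e.res δ' e.amp (ampOf N (signal A f w) m δ')) :
    StatePair M t (ps.foldl (step N (signal A f w) m) e).res δ'
        (ps.foldl (step N (signal A f w) m) e).amp (ampOf N (signal A f w) m δ') ∧
      ∀ l, (l ∈ ps ∨
        |e.res l - δ' l| ≤ 10 ^ 11 / Δ ^ 3 * (M / N + β) / ‖A l‖ * t ∧
        ‖e.amp l - ampOf N (signal A f w) m δ' l‖ ≤
          8 * M * (10 ^ 11 / Δ ^ 3 * (M / N + β) / a * t)) →
        |(ps.foldl (step N (signal A f w) m) e).res l - δ' l| ≤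
          10 ^ 11 / Δ ^ 3 * (M / N + β) / ‖A l‖ * t ∧
        ‖(ps.foldl (step N (signal A f w) m) e).amp l - ampOf N (signal A f w) m δ' l‖ ≤
          8 * M * (10 ^ 11 / Δ ^ 3 * (M / N + β) / a * t) := by
  induction ps generalizing e with
  | nil => exact ⟨hs, fun l hl => hl.resolve_left (by simp)⟩
  | cons p ps ih =>
    have h1 := h.statePair_step hc hδ hfix ht hs p
    have h2 := ih (step N (signal A f w) m e p) h1.1
    refine ⟨h2.1, fun l hl => h2.2 l ?_⟩
    by_cases hlp : l = p
    · subst hlp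
      exact .inr h1.2
    · rcases hl with hl | hl
      · exact .inl ((List.mem_cons.mp hl).resolve_left hlp)
      · refine .inr ?_
        simpa [step, hlp] using hl

/-- One iteration reduces the distance to the fixed point. -/
theorem statePair_sweep (h : Regime N Δ a M β A f w m)
    (hc : 10 ^ 13 / Δ ^ 4 * (M / N + β) ≤ a) (hδ : ∀ l, |δ' l| ≤ 5 / 8)
    (hfix : estMap N (signal A f w) m δ' = δ') (ht : t ≤ 1)
    (hs : StatePair M t e.res δ' e.amp (ampOf N (signal A f w) m δ')) :
    StatePair M (10 ^ 11 / Δ ^ 3 * (M / N + β) / a * t) (sweep N (signal A f w) m e).res δ'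
        (sweep N (signal A f w) m e).amp (ampOf N (signal A f w) m δ') ∧
      ∀ l, |(sweep N (signal A f w) m e).res l - δ' l| ≤
          10 ^ 11 / Δ ^ 3 * (M / N + β) / ‖A l‖ * t := by
  have h1 := h.statePair_foldl hc hδ hfix ht (List.finRange L) e hs
  have h2 (l) := h1.2 l (.inl (List.mem_finRange l))
  have ht0 : 0 ≤ t := (abs_nonneg _).trans (hs.dist ⟨0, by linarith [h.two_le]⟩)
  refine ⟨⟨h1.1.left, h1.1.right, fun l => ?_, fun l => ?_⟩, fun l => (h2 l).1⟩
  · exact (h2 l).1.trans (mul_le_mul_of_nonneg_right (h.div_norm_le l) ht0)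
  · exact ⟨(h1.1.amp l).1, (h1.1.amp l).2.1, (h2 l).2⟩

theorem statePair_iterate (h : Regime N Δ a M β A f w m)
    (hc : 10 ^ 13 / Δ ^ 4 * (M / N + β) ≤ a) (hδ : ∀ l, |δ' l| ≤ 5 / 8)
    (hfix : estMap N (signal A f w) m δ' = δ') (q : ℕ) :
    StatePair M ((10 ^ 11 / Δ ^ 3 * (M / N + β) / a) ^ q)
      ((sweep N (signal A f w) m)^[q] ⟨0, 0⟩).res δ'
      ((sweep N (signal A f w) m)^[q] ⟨0, 0⟩).amp (ampOf N (signal A f w) m δ') := by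
  induction q with
  | zero =>
    -- The zero initial state is at distance t = 1: |δ'| ≤ 5/8 ≤ 1, and the fixed amplitudes are at
    -- most 2M ≤ 8M.
    have hM := h.M_pos
    refine ⟨fun l => by norm_num, fun l => (hδ l).trans (by norm_num), fun l => ?_, fun l => ?_⟩
    · simpa using (hδ l).trans (by norm_num : (5 / 8 : ℝ) ≤ 1)
    · have := h.norm_ampOf_le (fun l => (hδ l).trans (by norm_num : (5 / 8 : ℝ) ≤ 3 / 4)) l
      refine ⟨?_, this.trans (by linarith), ?_⟩
      · simpa using hM.le
      · simpa using this.trans (by linarith : 2 * M ≤ 8 * M)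
  | succ q ih =>
    rw [Function.iterate_succ_apply', pow_succ']
    exact (h.statePair_sweep hc hδ hfix
      (pow_le_one₀ h.factor_nonneg ((h.factor_le hc).trans (by norm_num))) ih).1

theorem norm_iterRes_sub_le (h : Regime N Δ a M β A f w m)
    (hc : 10 ^ 13 / Δ ^ 4 * (M / N + β) ≤ a) (hδ : ∀ l, |δ' l| ≤ 5 / 8)
    (hfix : estMap N (signal A f w) m δ' = δ') (q : ℕ) :
    ‖iterRes N (signal A f w) m q - δ'‖ ≤
      √L * (10 ^ 11 / Δ ^ 3 * (M / N + β) / a) ^ q :=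
  norm_le_sqrt_mul_of_forall_le (pow_nonneg h.factor_nonneg q)
    fun l => (h.statePair_iterate hc hδ hfix q).dist l

/-- The last sweep keeps ‖A p‖ in place of a, because the square root of the Cramér-Rao bound scales
like 1/‖A p‖. -/
theorem abs_iterRes_two_sub_le (h : Regime N Δ a M β A f w m)
    (hc : 10 ^ 13 / Δ ^ 4 * (M / N + β) ≤ a) (hδ : ∀ l, |δ' l| ≤ 5 / 8)
    (hfix : estMap N (signal A f w) m δ' = δ') (p : Fin L) :
    |iterRes N (signal A f w) m 2 p - δ' p| ≤
      10 ^ 11 / Δ ^ 3 * (M / N + β) / ‖A p‖ * (10 ^ 11 / Δ ^ 3 * (M / N + β) / a) := by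
  have h1 := h.statePair_iterate hc hδ hfix 1
  rw [pow_one] at h1
  exact (h.statePair_sweep hc hδ hfix ((h.factor_le hc).trans (by norm_num)) h1).2 p

end Regime
/-! ### Uniform bounds of the noise coefficients -/

variable {Ω : Type*} [MeasurableSpace Ω] {μ : Measure Ω}

theorem hasSubgaussianMGF_of_hasLaw {X : Ω → ℝ} {v : ℝ≥0} (h : HasLaw X (gaussianReal 0 v) μ) :
    HasSubgaussianMGF X v μ where
  integrable_exp_mul t := by
    have := integrable_exp_mul_gaussianReal (μ := 0) (v := v) t
    rw [← h.map_eq] at this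
    exact this.comp_aemeasurable h.aemeasurable
  mgf_le t := by
    rw [mgf_gaussianReal h.map_eq, zero_mul, zero_add]

theorem hasSubgaussianMGF_const_mul {X : Ω → ℝ} {v : ℝ≥0} (h : HasSubgaussianMGF X v μ) {r : ℝ}
    (hr : |r| ≤ 1) : HasSubgaussianMGF (fun ω => r * X ω) v μ where
  integrable_exp_mul := (h.const_mul r).integrable_exp_mul
  mgf_le t := by
    refine ((h.const_mul r).mgf_le t).trans (Real.exp_le_exp.mpr ?_)
    have h1 : r ^ 2 ≤ 1 := (sq_le_one_iff_abs_le_one r).mpr hr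
    have h2 : 0 ≤ (v : ℝ) * t ^ 2 := by positivity
    have e : ((⟨r ^ 2, sq_nonneg r⟩ * v : ℝ≥0) : ℝ) = r ^ 2 * v := rfl
    rw [e]
    nlinarith

namespace IsWhiteGaussianNoise

variable {w : ℕ → Ω → ℂ} {σ : ℝ}

/-- The real part is a sum of 2N independent real Gaussians with weights of modulus at most 1, so
its sub-Gaussian parameter is at most 2N · σ²/2 = Nσ². -/
theorem measure_re_sum_ge_le [IsProbabilityMeasure μ] (hw : IsWhiteGaussianNoise μ w σ)
    {α : ℕ → ℂ} (hα : ∀ n, ‖α n‖ ≤ 1) (N : ℕ) {t : ℝ} (ht : 0 ≤ t) :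
    μ.real {ω | t ≤ (∑ n ∈ Finset.range N, α n * w n ω).re} ≤
      Real.exp (-t ^ 2 / (2 * N * σ ^ 2)) := by
  set Y : ℕ × Bool → Ω → ℝ := fun i ω => if i.2 then (w i.1 ω).re else (w i.1 ω).im
  set r : ℕ × Bool → ℝ := fun i => if i.2 then (α i.1).re else -(α i.1).im
  set v := Real.toNNReal (σ ^ 2 / 2)
  have hY (i) : HasSubgaussianMGF (fun ω => r i * Y i ω) v μ := by
    obtain ⟨n, c⟩ := i
    cases c
    · exact hasSubgaussianMGF_const_mul (hasSubgaussianMGF_of_hasLaw (hw.law_im n))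
        (by simpa [r] using (Complex.abs_im_le_norm _).trans (hα n))
    · exact hasSubgaussianMGF_const_mul (hasSubgaussianMGF_of_hasLaw (hw.law_re n))
        (by simpa [r] using (Complex.abs_re_le_norm _).trans (hα n))
  have hind : iIndepFun (fun i ω => r i * Y i ω) μ :=
    hw.indep.comp (fun i y => r i * y) fun i => measurable_const_mul _
  have key := HasSubgaussianMGF.measure_sum_ge_le_of_iIndepFun hind (c := fun _ => v)
    (s := Finset.range N ×ˢ Finset.univ) (fun i _ => hY i) ht
  have e1 (ω : Ω) : ∑ i ∈ Finset.range N ×ˢ (Finset.univ : Finset Bool), r i * Y i ω =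
      (∑ n ∈ Finset.range N, α n * w n ω).re := by
    rw [Finset.sum_product, Complex.re_sum]
    refine Finset.sum_congr rfl fun n _ => ?_
    rw [Fintype.sum_bool, Complex.mul_re]
    simp only [r, Y, if_true, Bool.false_eq_true, if_false]
    ring
  simp only [e1] at key
  refine key.trans_eq ?_
  congr 2
  have hv : (v : ℝ) = σ ^ 2 / 2 := Real.coe_toNNReal _ (by positivity)
  simp only [Finset.sum_const, Finset.card_product, Finset.card_range, Finset.card_univ,
    Fintype.card_bool, nsmul_eq_mul]
  push_cast
  rw [hv]
  ring

theorem measure_norm_sum_ge_le [IsProbabilityMeasure μ] (hw : IsWhiteGaussianNoise μ w σ)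
    {α : ℕ → ℂ} (hα : ∀ n, ‖α n‖ ≤ 1) (N : ℕ) {t : ℝ} (ht : 0 ≤ t) :
    μ {ω | t ≤ ‖∑ n ∈ Finset.range N, α n * w n ω‖} ≤
      ENNReal.ofReal (4 * Real.exp (-t ^ 2 / (8 * N * σ ^ 2))) := by
  set S : Ω → ℂ := fun ω => ∑ n ∈ Finset.range N, α n * w n ω
  have tail (u : ℂ) (hu : ‖u‖ = 1) : μ.real {ω | t / 2 ≤ (u * S ω).re} ≤
      Real.exp (-t ^ 2 / (8 * N * σ ^ 2)) := by
    have := hw.measure_re_sum_ge_le (α := fun n => u * α n) (fun n => by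
      rw [norm_mul, hu, one_mul]; exact hα n) N (t := t / 2) (by positivity)
    simp only [S, Finset.mul_sum, ← mul_assoc]
    refine this.trans_eq ?_
    congr 1
    rw [div_pow, ← neg_div, div_div]
    congr 1
    ring
  -- A complex number of modulus at least t has real part at least t/2 after multiplication by one
  -- of 1, -1, i, -i.
  have hsub : {ω | t ≤ ‖S ω‖} ⊆ ({ω | t / 2 ≤ (1 * S ω).re} ∪ {ω | t / 2 ≤ ((-1) * S ω).re}) ∪
      ({ω | t / 2 ≤ (Complex.I * S ω).re} ∪ {ω | t / 2 ≤ (-Complex.I * S ω).re}) := by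
    intro ω hω
    have h1 := (show t ≤ ‖S ω‖ from hω).trans (Complex.norm_le_abs_re_add_abs_im _)
    by_contra hcon
    simp only [Set.mem_union, Set.mem_ofPred_eq, not_or, not_le, one_mul, neg_mul, Complex.neg_re,
      Complex.I_mul_re, neg_neg] at hcon
    have h2 : |(S ω).re| < t / 2 := abs_lt.mpr ⟨by linarith [hcon.1.2], hcon.1.1⟩
    have h3 : |(S ω).im| < t / 2 := abs_lt.mpr ⟨by linarith [hcon.2.1], hcon.2.2⟩
    linarith
  rw [← ofReal_measureReal]
  refine ENNReal.ofReal_le_ofReal ((measureReal_mono hsub).trans ?_)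
  have a₁ := tail 1 (by simp)
  have a₂ := tail (-1) (by simp)
  have a₃ := tail Complex.I (by simp)
  have a₄ := tail (-Complex.I) (by simp)
  have u₁ := measureReal_union_le (μ := μ)
    ({ω | t / 2 ≤ (1 * S ω).re} ∪ {ω | t / 2 ≤ ((-1) * S ω).re})
    ({ω | t / 2 ≤ (Complex.I * S ω).re} ∪ {ω | t / 2 ≤ (-Complex.I * S ω).re})
  have u₂ := measureReal_union_le (μ := μ)
    {ω | t / 2 ≤ (1 * S ω).re} {ω | t / 2 ≤ ((-1) * S ω).re}
  have u₃ := measureReal_union_le (μ := μ)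
    {ω | t / 2 ≤ (Complex.I * S ω).re} {ω | t / 2 ≤ (-Complex.I * S ω).re}
  linarith

/-- The constant 7 makes the tail exponent 49/8 > 4: N² events of probability at most 4N⁻⁴ are
summable over N, and Borel–Cantelli applies. The array α is free so that plain sums, weighted sums
and single samples are all covered. -/
theorem ae_eventually_norm_sum_lt [IsProbabilityMeasure μ] (hw : IsWhiteGaussianNoise μ w σ)
    (hσ : 0 < σ) {α : ℕ → ℕ → ℕ → ℂ} (hα : ∀ N j n, ‖α N j n‖ ≤ 1) :
    ∀ᵐ ω ∂μ, ∀ᶠ N : ℕ in atTop, ∀ j < N ^ 2,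
      ‖∑ n ∈ Finset.range N, α N j n * w n ω‖ < 7 * σ * √(N * Real.log N) := by
  set s : ℕ → Set Ω := fun N => ⋃ j ∈ Finset.range (N ^ 2),
    {ω | 7 * σ * √(N * Real.log N) ≤ ‖∑ n ∈ Finset.range N, α N j n * w n ω‖}
  have hs (N : ℕ) : μ (s N) ≤ ENNReal.ofReal (4 * (1 / (N : ℝ) ^ 2)) := by
    rcases Nat.eq_zero_or_pos N with rfl | hN
    · simp [s]
    have hN1 : (1 : ℝ) ≤ N := by exact_mod_cast hN
    have hN' : (0 : ℝ) < N := by linarith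
    have hlog : 0 ≤ Real.log N := Real.log_nonneg hN1
    have hexp : Real.exp (-(7 * σ * √(N * Real.log N)) ^ 2 / (8 * N * σ ^ 2)) ≤
        1 / (N : ℝ) ^ 4 := by
      rw [mul_pow, Real.sq_sqrt (by positivity)]
      have e : -((7 * σ) ^ 2 * (N * Real.log N)) / (8 * N * σ ^ 2) = -(49 / 8 * Real.log N) := by
        field_simp
        ring
      rw [e, Real.exp_neg, ← one_div]
      refine one_div_le_one_div_of_le (by positivity) ?_
      calc (N : ℝ) ^ 4 = Real.exp (4 * Real.log N) := by
            rw [← Real.exp_log hN', ← Real.exp_nat_mul, Real.log_exp]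
            norm_num
        _ ≤ _ := Real.exp_le_exp.mpr (by linarith)
    calc μ (s N) ≤ ∑ j ∈ Finset.range (N ^ 2), μ {ω | 7 * σ * √(N * Real.log N) ≤
          ‖∑ n ∈ Finset.range N, α N j n * w n ω‖} := measure_biUnion_finset_le _ _
      _ ≤ ∑ j ∈ Finset.range (N ^ 2), ENNReal.ofReal (4 * (1 / (N : ℝ) ^ 4)) := by
          refine Finset.sum_le_sum fun j _ => ?_
          refine (hw.measure_norm_sum_ge_le (hα N j) N (by positivity)).trans
            (ENNReal.ofReal_le_ofReal ?_)
          linarith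
      _ = ENNReal.ofReal (N ^ 2 * (4 * (1 / (N : ℝ) ^ 4))) := by
          rw [Finset.sum_const, Finset.card_range, nsmul_eq_mul,
            ENNReal.ofReal_mul (p := (N : ℝ) ^ 2) (by positivity)]
          congr 1
          rw [ENNReal.ofReal_pow (by positivity), ENNReal.ofReal_natCast]
          push_cast
          rfl
      _ = _ := by
          congr 1
          field_simp
  have hsum : (∑' N, μ (s N)) ≠ ∞ := by
    refine ne_top_of_le_ne_top (Summable.tsum_ofReal_ne_top ?_) (ENNReal.tsum_le_tsum hs)
    exact (Real.summable_one_div_nat_pow.mpr one_lt_two).mul_left 4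
  filter_upwards [ae_eventually_notMem hsum] with ω hω
  filter_upwards [hω] with N hN j hj
  by_contra hcon
  exact hN (Set.mem_biUnion (Finset.mem_coe.mpr (Finset.mem_range.mpr hj)) (not_lt.mp hcon))

end IsWhiteGaussianNoise

/-- A trigonometric sum that is small on a fine grid, with small coefficients, is small. -/
theorem norm_trigSum_le {N : ℕ} (hN : 0 < N) {y c : ℕ → ℂ} {T : ℝ}
    (hc : ∀ n < N, ‖c n‖ ≤ 1) (hy : ∀ n < N, ‖y n‖ ≤ T)
    (hgrid : ∀ j < N ^ 2,
      ‖∑ n ∈ Finset.range N, c n * unitExp (-(n * (j / (N : ℝ) ^ 2))) * y n‖ ≤ T) (g : ℝ) :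
    ‖∑ n ∈ Finset.range N, c n * unitExp (-(n * g)) * y n‖ ≤ 8 * T := by
  have hN' : (0 : ℝ) < N := by exact_mod_cast hN
  have hT : 0 ≤ T := (norm_nonneg _).trans (hy 0 hN)
  -- Integer frequencies have period 1, so a grid of [0, 1) suffices.
  have hper (n : ℕ) : unitExp (-(n * g)) = unitExp (-(n * Int.fract g)) := by
    have e : -((n : ℝ) * g) = -(n * Int.fract g) + (-(n * ⌊g⌋ : ℤ) : ℤ) := by
      push_cast
      linear_combination (-(n : ℝ)) * (Int.fract_add_floor g).symm
    have k (z : ℤ) : unitExp z = 1 := by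
      rw [unitExp, Complex.exp_eq_one_iff]
      exact ⟨z, by push_cast; ring⟩
    rw [e, unitExp_add, k, mul_one]
  simp only [hper]
  set x := Int.fract g
  have hx0 : 0 ≤ x := Int.fract_nonneg g
  have hx1 : x < 1 := Int.fract_lt_one g
  set j := ⌊(N : ℝ) ^ 2 * x⌋₊
  have hj1 : (j : ℝ) ≤ N ^ 2 * x := Nat.floor_le (by positivity)
  have hj2 : (N : ℝ) ^ 2 * x < j + 1 := Nat.lt_floor_add_one _
  have hj : j < N ^ 2 := by
    have : (j : ℝ) < (N : ℝ) ^ 2 := by nlinarith [pow_pos hN' 2]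
    exact_mod_cast this
  have hxj : |x - j / (N : ℝ) ^ 2| ≤ 1 / (N : ℝ) ^ 2 := by
    have e : x - j / (N : ℝ) ^ 2 = (N ^ 2 * x - j) / (N : ℝ) ^ 2 := by field_simp
    rw [e, abs_of_nonneg (div_nonneg (by linarith) (by positivity))]
    gcongr
    linarith
  -- Grid spacing 1/N² rotates each of the N terms by at most 7/N, and each sample is at most T.
  have hdiff : ‖∑ n ∈ Finset.range N, c n * unitExp (-(n * x)) * y n -
      ∑ n ∈ Finset.range N, c n * unitExp (-(n * (j / (N : ℝ) ^ 2))) * y n‖ ≤ 7 * T := by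
    rw [← Finset.sum_sub_distrib]
    calc _ ≤ ∑ n ∈ Finset.range N, ‖c n * unitExp (-(n * x)) * y n -
          c n * unitExp (-(n * (j / (N : ℝ) ^ 2))) * y n‖ := norm_sum_le _ _
      _ ≤ ∑ n ∈ Finset.range N, 7 * (1 / (N : ℝ)) * T := by
          refine Finset.sum_le_sum fun n hn => ?_
          rw [Finset.mem_range] at hn
          have hnN : (n : ℝ) ≤ N := by exact_mod_cast hn.le
          have h1 : ‖unitExp (-(n * x)) - unitExp (-(n * (j / (N : ℝ) ^ 2)))‖ ≤
              7 * (1 / (N : ℝ)) := by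
            refine norm_unitExp_sub_le_seven ?_
            rw [neg_sub_neg, ← mul_sub, abs_mul, Nat.abs_cast, abs_sub_comm]
            calc (n : ℝ) * |x - j / (N : ℝ) ^ 2| ≤ N * (1 / (N : ℝ) ^ 2) := by gcongr
              _ = 1 / N := by field_simp
          rw [← sub_mul, ← mul_sub, norm_mul, norm_mul]
          have h2 := mul_le_mul (hc n hn) h1 (norm_nonneg _) zero_le_one
          rw [one_mul] at h2
          exact mul_le_mul h2 (hy n hn) (norm_nonneg _) (by positivity)
      _ = 7 * T := by
          rw [Finset.sum_const, Finset.card_range, nsmul_eq_mul]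
          field_simp
  have h := norm_add_le (∑ n ∈ Finset.range N, c n * unitExp (-(n * x)) * y n -
      ∑ n ∈ Finset.range N, c n * unitExp (-(n * (j / (N : ℝ) ^ 2))) * y n)
    (∑ n ∈ Finset.range N, c n * unitExp (-(n * (j / (N : ℝ) ^ 2))) * y n)
  rw [sub_add_cancel] at h
  linarith [hgrid j hj]

theorem coef_eq_sum_unitExp (N : ℕ) (y : ℕ → ℂ) (g : ℝ) :
    coef N y g = (1 / N : ℂ) * ∑ n ∈ Finset.range N, 1 * unitExp (-(n * g)) * y n := by
  rw [coef]
  congr 1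
  refine Finset.sum_congr rfl fun n _ => ?_
  rw [unitExp]
  push_cast
  ring_nf

theorem hasDerivAt_coef {N : ℕ} (hN : 0 < N) (y : ℕ → ℂ) (g : ℝ) :
    HasDerivAt (coef N y) (-(2 * Real.pi * Complex.I) *
      ∑ n ∈ Finset.range N, (n / N : ℂ) * unitExp (-(n * g)) * y n) g := by
  have hN' : (N : ℂ) ≠ 0 := by exact_mod_cast hN.ne'
  have h1 (n : ℕ) : HasDerivAt (fun g : ℝ => unitExp (-(n * g)))
      (unitExp (-(n * g)) * (2 * Real.pi * Complex.I * -n)) g := by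
    have h2 : HasDerivAt (fun g : ℝ => 2 * Real.pi * Complex.I * ((-(n * g) : ℝ) : ℂ))
        (2 * Real.pi * Complex.I * -n) g := by
      have h3 : HasDerivAt (fun g : ℝ => -((n : ℝ) * g)) (-n) g := by
        simpa using ((hasDerivAt_id' g).const_mul (n : ℝ)).fun_neg
      simpa using h3.ofReal_comp.const_mul (2 * Real.pi * Complex.I)
    exact h2.cexp
  have h4 := (HasDerivAt.fun_sum (u := Finset.range N)
    fun n _ => ((h1 n).const_mul (1 : ℂ)).mul_const (y n)).const_mul (1 / N : ℂ)
  have e : coef N y = fun g : ℝ =>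
      (1 / N : ℂ) * ∑ n ∈ Finset.range N, 1 * unitExp (-(n * g)) * y n :=
    funext (coef_eq_sum_unitExp N y)
  rw [e]
  refine h4.congr_deriv ?_
  rw [Finset.mul_sum, Finset.mul_sum]
  refine Finset.sum_congr rfl fun n _ => ?_
  field_simp

/-- Almost surely, the noise coefficients are eventually of order `√(ln N / N)`, uniformly in the
frequency, as are their derivatives with respect to the position in bins. -/
theorem IsWhiteGaussianNoise.ae_eventually_coef_le [IsProbabilityMeasure μ] {w : ℕ → Ω → ℂ}
    {σ : ℝ} (hw : IsWhiteGaussianNoise μ w σ) (hσ : 0 < σ) :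
    ∀ᵐ ω ∂μ, ∀ᶠ N : ℕ in atTop,
      (∀ g, ‖coef N (fun n => w n ω) g‖ ≤ 400 * σ * √(Real.log N / N)) ∧
      ∀ g g', ‖coef N (fun n => w n ω) g - coef N (fun n => w n ω) g'‖ ≤
        400 * σ * √(Real.log N / N) * (N * |g - g'|) := by
  -- The derivative has weights n/N. Truncation at 1 gives the bound for all n that the tail
  -- estimate demands, without changing the terms n < N.
  have hr (N n : ℕ) : ‖(min (n / N : ℝ) 1 : ℝ)‖ ≤ 1 := by
    rw [Real.norm_of_nonneg (le_min (by positivity) zero_le_one)]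
    exact min_le_right _ _
  have E₁ := hw.ae_eventually_norm_sum_lt hσ
    (α := fun N j n => 1 * unitExp (-(n * (j / (N : ℝ) ^ 2)))) (fun N j n => by simp)
  have E₂ := hw.ae_eventually_norm_sum_lt hσ
    (α := fun N j n => ((min (n / N : ℝ) 1 : ℝ) : ℂ) * unitExp (-(n * (j / (N : ℝ) ^ 2))))
    (fun N j n => by
      rw [norm_mul, norm_unitExp, mul_one, Complex.norm_real]
      exact hr N n)
  -- Indicator weights bound the individual samples, as the passage from the grid to all frequencies
  -- requires.
  have E₃ := hw.ae_eventually_norm_sum_lt hσ (α := fun N j n => if n = j then 1 else 0)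
    (fun N j n => by split_ifs <;> simp)
  filter_upwards [E₁, E₂, E₃] with ω h₁ h₂ h₃
  filter_upwards [h₁, h₂, h₃, eventually_ge_atTop 1] with N g₁ g₂ g₃ hN
  have hN' : (0 : ℝ) < N := by exact_mod_cast hN
  have hN1 : (1 : ℝ) ≤ N := by exact_mod_cast hN
  set T := 7 * σ * √(N * Real.log N) with hT
  have hy : ∀ n < N, ‖w n ω‖ ≤ T := fun n hn => by
    have := g₃ n (hn.trans_le (Nat.le_self_pow two_ne_zero N))
    simp only [ite_mul, one_mul, zero_mul, Finset.sum_ite_eq', Finset.mem_range, hn, if_true] at this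
    exact this.le
  have hT0 : 0 ≤ T := (norm_nonneg _).trans (hy 0 hN)
  have b₁ := norm_trigSum_le hN (c := fun _ => 1) (y := fun n => w n ω) (by simp) hy
    fun j hj => (g₁ j hj).le
  have b₂ := norm_trigSum_le hN (c := fun n => ((min (n / N : ℝ) 1 : ℝ) : ℂ))
    (y := fun n => w n ω) (fun n _ => by rw [Complex.norm_real]; exact hr N n) hy
    fun j hj => (g₂ j hj).le
  have hs : √(N * Real.log N) = N * √(Real.log N / N) := by
    rw [← Real.sqrt_sq hN'.le, ← Real.sqrt_mul (by positivity), Real.sqrt_sq hN'.le]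
    congr 1
    field_simp
  have hlip : ∀ g, ‖-(2 * Real.pi * Complex.I) * ∑ n ∈ Finset.range N,
      (n / N : ℂ) * unitExp (-(n * g)) * w n ω‖ ≤ 400 * σ * √(Real.log N / N) * N := fun g => by
    have e : ∑ n ∈ Finset.range N, (n / N : ℂ) * unitExp (-(n * g)) * w n ω =
        ∑ n ∈ Finset.range N, ((min (n / N : ℝ) 1 : ℝ) : ℂ) * unitExp (-(n * g)) * w n ω := by
      refine Finset.sum_congr rfl fun n hn => ?_
      have : (n : ℝ) / N ≤ 1 := by
        rw [div_le_one hN']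
        exact_mod_cast (Finset.mem_range.mp hn).le
      rw [min_eq_left this]
      push_cast
      rfl
    rw [e, norm_mul, norm_neg]
    have e2 : ‖(2 * Real.pi * Complex.I : ℂ)‖ = 2 * Real.pi := by
      simp [abs_of_pos Real.pi_pos]
    rw [e2]
    have h7 : 2 * Real.pi ≤ 7 := by linarith [Real.pi_lt_d2]
    refine (mul_le_mul h7 (b₂ g) (norm_nonneg _) (by norm_num)).trans ?_
    rw [hT, hs]
    have : 0 ≤ σ * (N * √(Real.log N / N)) := by positivity
    linarith
  constructor
  · intro g
    rw [coef_eq_sum_unitExp, norm_mul, norm_div, norm_one, Complex.norm_natCast, one_div,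
      inv_mul_le_iff₀ hN']
    refine (b₁ g).trans ?_
    rw [hT, hs]
    have : 0 ≤ σ * (N * √(Real.log N / N)) := by positivity
    linarith
  · intro g g'
    have := convex_univ.norm_image_sub_le_of_norm_hasDerivWithin_le
      (fun x _ => (hasDerivAt_coef hN (fun n => w n ω) x).hasDerivWithinAt) (fun x _ => hlip x)
      (Set.mem_univ g') (Set.mem_univ g)
    rw [Real.norm_eq_abs] at this
    exact this.trans_eq (by ring)

/-! ### The quantities in the bounds -/

section Maxima

variable {L N : ℕ} {Δ : ℝ} {A : Fin L → ℂ} {f : Fin L → ℝ}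

theorem Separated.abs_round_le (h : Separated Δ f) (hN : 1 ≤ Δ * N) {l p : Fin L}
    (hlp : l ≠ p) : |((round (N * (f l - f p)) : ℤ) : ℝ)| ≤ N := by
  have h1 := abs_sub_round (N * (f l - f p))
  have h2 : |N * (f l - f p)| ≤ N * (1 - Δ) := by
    rw [abs_mul, Nat.abs_cast]
    exact mul_le_mul_of_nonneg_left (h.2 l p hlp).2 N.cast_nonneg
  rw [abs_le] at *
  constructor <;> nlinarith

/-- Rounding costs at most 1/2, which is at most half of ΔN. -/
theorem Separated.le_abs_round (h : Separated Δ f) (hN : 1 ≤ Δ * N) {l p : Fin L}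
    (hlp : l ≠ p) : Δ / 2 * N ≤ |((round (N * (f l - f p)) : ℤ) : ℝ)| := by
  have h1 := abs_sub_round (N * (f l - f p))
  have h2 : N * Δ ≤ |N * (f l - f p)| := by
    rw [abs_mul, Nat.abs_cast]
    exact mul_le_mul_of_nonneg_left (h.2 l p hlp).1 N.cast_nonneg
  have h3 := abs_sub_abs_le_abs_sub (N * (f l - f p)) (round (N * (f l - f p)) : ℤ)
  linarith

theorem le_maxAmp (A : Fin L → ℂ) (l : Fin L) : ‖A l‖ ≤ maxAmp A :=
  le_ciSup (f := fun l => ‖A l‖) (Set.finite_range _).bddAbove l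

theorem le_maxRatio (N : ℕ) (A : Fin L → ℂ) (f : Fin L → ℝ) {l p : Fin L} (hlp : l ≠ p) :
    ‖A l‖ / |((round (N * (f l - f p)) : ℤ) : ℝ)| ≤ maxRatio N A f :=
  le_ciSup (f := fun i : {i : Fin L × Fin L // i.1 ≠ i.2} =>
    ‖A i.1.1‖ / |((round (N * (f i.1.1 - f i.1.2)) : ℤ) : ℝ)|)
    (Set.finite_range _).bddAbove ⟨(l, p), hlp⟩

theorem le_maxGamma (N : ℕ) (A : Fin L → ℂ) (f : Fin L → ℝ) {l p : Fin L} (hlp : l ≠ p) :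
    ‖A l‖ ^ 2 / ((round (N * (f l - f p)) : ℤ) : ℝ) ^ 2 ≤ maxGamma N A f :=
  le_ciSup (f := fun i : {i : Fin L × Fin L // i.1 ≠ i.2} =>
    ‖A i.1.1‖ ^ 2 / ((round (N * (f i.1.1 - f i.1.2)) : ℤ) : ℝ) ^ 2)
    (Set.finite_range _).bddAbove ⟨(l, p), hlp⟩

theorem exists_ne_of_two_le (hL : 2 ≤ L) (l : Fin L) : ∃ p, l ≠ p := by
  have : Nontrivial (Fin L) := Fin.nontrivial_iff_two_le.mpr hL
  obtain ⟨p, hp⟩ := exists_ne l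
  exact ⟨p, hp.symm⟩

theorem nonempty_pairs (hL : 2 ≤ L) : Nonempty {i : Fin L × Fin L // i.1 ≠ i.2} := by
  obtain ⟨p, hp⟩ := exists_ne_of_two_le hL ⟨0, by linarith⟩
  exact ⟨⟨(_, p), hp⟩⟩

theorem maxAmp_div_le_maxRatio (h : Separated Δ f) (hΔ : 0 < Δ) (hN : 1 ≤ Δ * N) (hL : 2 ≤ L) :
    maxAmp A / N ≤ maxRatio N A f := by
  have hN' : (0 : ℝ) < N := by
    by_contra hcon
    nlinarith
  have : Nonempty (Fin L) := ⟨⟨0, by linarith⟩⟩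
  rw [div_le_iff₀ hN']
  refine ciSup_le fun l => ?_
  obtain ⟨p, hp⟩ := exists_ne_of_two_le hL l
  rw [← div_le_iff₀ hN']
  refine le_trans ?_ (le_maxRatio N A f hp)
  refine div_le_div_of_nonneg_left (norm_nonneg _) ?_ (h.abs_round_le hN hp)
  exact lt_of_lt_of_le (by positivity) (h.le_abs_round hN hp)

theorem maxRatio_le (h : Separated Δ f) (hΔ : 0 < Δ) (hN : 1 ≤ Δ * N) (hL : 2 ≤ L) :
    maxRatio N A f ≤ maxAmp A * (2 / Δ / N) := by
  have hN' : (0 : ℝ) < N := by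
    by_contra hcon
    nlinarith
  have := nonempty_pairs hL
  refine ciSup_le fun i => ?_
  have h1 := h.le_abs_round hN i.2
  have h0 : 0 ≤ maxAmp A := (norm_nonneg _).trans (le_maxAmp A i.1.1)
  calc _ ≤ maxAmp A / (Δ / 2 * N) := div_le_div₀ h0 (le_maxAmp A _) (by positivity) h1
    _ = _ := by field_simp

theorem sq_maxAmp_div_le_maxGamma (h : Separated Δ f) (hΔ : 0 < Δ) (hN : 1 ≤ Δ * N) (hL : 2 ≤ L) :
    (maxAmp A / N) ^ 2 ≤ maxGamma N A f := by
  have hN' : (0 : ℝ) < N := by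
    by_contra hcon
    nlinarith
  have : Nonempty (Fin L) := ⟨⟨0, by linarith⟩⟩
  obtain ⟨l, hl⟩ := exists_eq_ciSup_of_finite (f := fun l => ‖A l‖)
  obtain ⟨p, hp⟩ := exists_ne_of_two_le hL l
  rw [maxAmp, ← hl, div_pow]
  refine le_trans ?_ (le_maxGamma N A f hp)
  rw [← sq_abs ((round (N * (f l - f p)) : ℤ) : ℝ)]
  have h1 := h.le_abs_round hN hp
  have h2 : 0 < |((round (N * (f l - f p)) : ℤ) : ℝ)| := lt_of_lt_of_le (by positivity) h1
  have h3 := h.abs_round_le hN hp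
  exact div_le_div_of_nonneg_left (by positivity) (by positivity)
    (pow_le_pow_left₀ h2.le h3 2)

theorem maxGamma_le_sq (N : ℕ) (A : Fin L → ℂ) (f : Fin L → ℝ) (hL : 2 ≤ L) :
    maxGamma N A f ≤ maxRatio N A f ^ 2 := by
  have := nonempty_pairs hL
  refine ciSup_le fun i => ?_
  rw [← sq_abs ((round (N * (f i.1.1 - f i.1.2)) : ℤ) : ℝ), ← div_pow]
  exact pow_le_pow_left₀ (by positivity) (le_maxRatio N A f i.2) 2

end Maxima

/-! ### The Cramér-Rao bound and the assembly of the convergence statements -/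

theorem le_sqrt_acrlb {σ : ℝ} (hσ : 0 < σ) {N : ℕ} (hN : 0 < N) {c : ℂ} (hc : c ≠ 0) :
    σ / (4 * ‖c‖ * N * √N) ≤ √(acrlb σ N c) := by
  have hN' : (0 : ℝ) < N := by exact_mod_cast hN
  have hc' := norm_pos_iff.mpr hc
  refine Real.le_sqrt_of_sq_le ?_
  have e1 : (σ / (4 * ‖c‖ * N * √N)) ^ 2 = 1 / 16 * (σ ^ 2 / (‖c‖ ^ 2 * N ^ 3)) := by
    rw [div_pow, mul_pow, mul_pow, mul_pow, Real.sq_sqrt hN'.le]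
    field_simp
    norm_num
  have e2 : acrlb σ N c = 6 / (4 * Real.pi ^ 2) * (σ ^ 2 / (‖c‖ ^ 2 * N ^ 3)) := by
    rw [acrlb]
    field_simp
  rw [e1, e2]
  refine mul_le_mul_of_nonneg_right ?_ (by positivity)
  rw [div_le_div_iff₀ (by norm_num) (by positivity)]
  nlinarith [Real.pi_lt_d2, Real.pi_pos]

theorem ConvergesTo.mono {L N : ℕ} {x : ℕ → ℂ} {m : Fin L → ℤ} {C₁ C₂ b : ℝ}
    {δ δ' : EuclideanSpace ℝ (Fin L)} (h : ConvergesTo N x m C₁ b δ δ') (hC : C₁ ≤ C₂)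
    (hb : 0 ≤ b) : ConvergesTo N x m C₂ b δ δ' :=
  ⟨h.1, fun q => (h.2.1 q).trans (mul_le_mul_of_nonneg_right hC (pow_nonneg hb q)), h.2.2.1,
    h.2.2.2.1, h.2.2.2.2.trans (mul_le_mul_of_nonneg_right hC (Real.sqrt_nonneg _))⟩

theorem TwoIterations.mono {L N : ℕ} {σ : ℝ} {A : Fin L → ℂ} {x : ℕ → ℂ} {m : Fin L → ℤ}
    {C₁ C₂ : ℝ} {δ' : EuclideanSpace ℝ (Fin L)} (h : TwoIterations σ A N x m C₁ δ')
    (hC : C₁ ≤ C₂) : TwoIterations σ A N x m C₂ δ' := fun p => by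
  have h0 : 0 ≤ Real.log N := Real.log_natCast_nonneg N
  exact (h p).trans (mul_le_mul_of_nonneg_right (mul_le_mul_of_nonneg_right hC (by positivity))
    (Real.sqrt_nonneg _))

namespace Regime

variable {L N : ℕ} {Δ a M β : ℝ} {A : Fin L → ℂ} {f : Fin L → ℝ} {w : ℕ → ℂ} {m : Fin L → ℤ}

theorem one_le_sqrt_card (h : Regime N Δ a M β A f w m) : 1 ≤ √(L : ℝ) := by
  rw [Real.one_le_sqrt]
  exact_mod_cast (by linarith [h.two_le] : 1 ≤ L)

theorem sqrt_card_le (h : Regime N Δ a M β A f w m) : √(L : ℝ) ≤ 2 / Δ := by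
  refine le_trans ?_ h.card_le
  have : (1 : ℝ) ≤ L := by exact_mod_cast (by linarith [h.two_le] : 1 ≤ L)
  rw [Real.sqrt_le_left (by linarith)]
  nlinarith

theorem exists_convergesTo (h : Regime N Δ a M β A f w m)
    (hc : 10 ^ 13 / Δ ^ 4 * (M / N + β) ≤ a) {C b : ℝ} (hC : 2 / Δ ≤ C)
    (hb : √L * (10 ^ 11 / Δ ^ 3 * (M / N + β) / a) ≤ b) (hb1 : b < 1)
    (hβ : 2 * (2 / Δ * (10 ^ 8 * (β / a))) ≤ C * √(Real.log N / N)) :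
    ∃ δ', ConvergesTo N (signal A f w) m C b (trueRes N f m) δ' ∧
      ∀ p, |iterRes N (signal A f w) m 2 p - δ' p| ≤
        10 ^ 11 / Δ ^ 3 * (M / N + β) / ‖A p‖ * (10 ^ 11 / Δ ^ 3 * (M / N + β) / a) := by
  obtain ⟨δ', hfix, hδ, hd⟩ := h.exists_fixedPoint hc
  have hθ0 := h.factor_nonneg
  have hβ0 := h.noise_nonneg
  have ha := h.a_pos
  have hΔ := h.sep_pos
  have hb' : 10 ^ 11 / Δ ^ 3 * (M / N + β) / a ≤ b :=
    (le_mul_of_one_le_left hθ0 h.one_le_sqrt_card).trans hb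
  have hb0 : 0 ≤ b := hθ0.trans hb'
  have hq (q : ℕ) : ‖iterRes N (signal A f w) m q - δ'‖ ≤ C * b ^ q :=
    (h.norm_iterRes_sub_le hc hδ hfix q).trans (mul_le_mul (h.sqrt_card_le.trans hC)
      (pow_le_pow_left₀ hθ0 hb' q) (pow_nonneg hθ0 q) (le_trans (by positivity) hC))
  refine ⟨δ', ⟨hb1, hq, ?_, hfix, hd.trans (le_trans ?_ hβ)⟩, h.abs_iterRes_two_sub_le hc hδ hfix⟩
  · rw [tendsto_iff_norm_sub_tendsto_zero]
    refine squeeze_zero (fun _ => norm_nonneg _) hq ?_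
    simpa using (tendsto_pow_atTop_nhds_zero_of_lt_one hb0 hb1).const_mul C
  · have := h.sqrt_card_le
    gcongr

end Regime

theorem tendsto_sqrt_log_div : Tendsto (fun N : ℕ => √(Real.log N / N)) atTop (nhds 0) := by
  have h1 : Tendsto (fun x : ℝ => Real.log x / x) atTop (nhds 0) :=
    Real.isLittleO_log_id_atTop.tendsto_div_nhds_zero
  have h2 := (h1.comp tendsto_natCast_atTop_atTop).sqrt
  rw [Real.sqrt_zero] at h2
  exact h2

theorem eventually_mul_sqrt_log_div_lt (c : ℝ) {r : ℝ} (hr : 0 < r) :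
    ∀ᶠ N : ℕ in atTop, c * √(Real.log N / N) < r := by
  have := tendsto_sqrt_log_div.const_mul c
  rw [mul_zero] at this
  exact this.eventually_lt_const hr

theorem eventually_div_natCast_lt (c : ℝ) {r : ℝ} (hr : 0 < r) : ∀ᶠ N : ℕ in atTop, c / N < r :=
  (tendsto_const_div_atTop_nhds_zero_nat c).eventually_lt_const hr

section FiniteSamples

variable {L N : ℕ} {Δ a s C : ℝ} {A : Fin L → ℂ} {f : Fin L → ℝ} {w : ℕ → ℂ} {m : Fin L → ℤ}

theorem Regime.one_le_mul_N {M β : ℝ} (h : Regime N Δ a M β A f w m) : 1 ≤ Δ * N := by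
  linarith [h.le_mul_N]

/-- Leakage M/N and noise √(ln N/N) are dominated by one quantity y: √(ln N/N) in case (a), the
maximal ratio in case (b). -/
theorem Regime.factor_le_mul (h : Regime N Δ a (maxAmp A) (s * √(Real.log N / N)) A f w m)
    (hs : 0 ≤ s) (hC : 10 ^ 11 / Δ ^ 3 * (1 + s) / a ≤ C) {y : ℝ} (hy : maxAmp A / N ≤ y)
    (hry : √(Real.log N / N) ≤ y) :
    √L * (10 ^ 11 / Δ ^ 3 * (maxAmp A / N + s * √(Real.log N / N)) / a) ≤ √L * (C * y) := by
  have hy0 := (Real.sqrt_nonneg _).trans hry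
  have hΔ := h.sep_pos
  have ha := h.a_pos
  refine mul_le_mul_of_nonneg_left ?_ (Real.sqrt_nonneg _)
  calc _ ≤ 10 ^ 11 / Δ ^ 3 * (y + s * y) / a := by gcongr
    _ = 10 ^ 11 / Δ ^ 3 * (1 + s) / a * y := by ring
    _ ≤ C * y := mul_le_mul_of_nonneg_right hC hy0

theorem Regime.noise_le_mul (h : Regime N Δ a (maxAmp A) (s * √(Real.log N / N)) A f w m)
    (hC : 2 * (2 / Δ * (10 ^ 8 * (s / a))) ≤ C) :
    2 * (2 / Δ * (10 ^ 8 * (s * √(Real.log N / N) / a))) ≤ C * √(Real.log N / N) := by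
  have ha := h.a_pos
  calc _ = 2 * (2 / Δ * (10 ^ 8 * (s / a))) * √(Real.log N / N) := by ring
    _ ≤ _ := mul_le_mul_of_nonneg_right hC (Real.sqrt_nonneg _)

/-- Two contractions give η² of order ln N/N, and division by N passes from bins to frequency; the
result is (ln N/√N) times 1/(‖A p‖N√N), the order of the root of the Cramér-Rao bound. -/
theorem twoIterations_of_le {σ κ : ℝ} (hσ : 0 < σ) (hN : 0 < N) (ha : 0 < a) (hs : 0 ≤ s)
    (hκ : 0 ≤ κ) (hA : ∀ p, A p ≠ 0) (hC : 4 * κ ^ 2 * (1 + s) ^ 2 / (a * σ) ≤ C) {η : ℝ}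
    (hη0 : 0 ≤ η) (hη : η ≤ (1 + s) * √(Real.log N / N)) {x : ℕ → ℂ}
    {δ' : EuclideanSpace ℝ (Fin L)}
    (h : ∀ p, |iterRes N x m 2 p - δ' p| ≤ κ * η / ‖A p‖ * (κ * η / a)) :
    TwoIterations σ A N x m C δ' := fun p => by
  have hN' : (0 : ℝ) < N := by exact_mod_cast hN
  have hAp := norm_pos_iff.mpr (hA p)
  have e : freq N m (iterRes N x m 2) p - freq N m δ' p = (iterRes N x m 2 p - δ' p) / N := by
    rw [freq, freq]
    ring
  rw [e, abs_div, Nat.abs_cast]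
  have hlogN : 0 ≤ Real.log N := Real.log_natCast_nonneg N
  have hr2 : √(Real.log N / N) ^ 2 = Real.log N / N := Real.sq_sqrt (by positivity)
  have hsq : √(N : ℝ) * √(N : ℝ) = N := Real.mul_self_sqrt hN'.le
  have hsN : 0 < √(N : ℝ) := Real.sqrt_pos.mpr hN'
  set r := √(Real.log N / N)
  have hr0 : 0 ≤ r := Real.sqrt_nonneg _
  have hC0 : 0 ≤ C := le_trans (by positivity) hC
  calc _ ≤ κ * η / ‖A p‖ * (κ * η / a) / N := by
        gcongr
        exact h p
    _ ≤ κ * ((1 + s) * r) / ‖A p‖ * (κ * ((1 + s) * r) / a) / N := by gcongr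
    _ = κ ^ 2 * (1 + s) ^ 2 / (‖A p‖ * a) / N * r ^ 2 := by ring
    _ = 4 * κ ^ 2 * (1 + s) ^ 2 / (a * σ) * (Real.log N / √N) * (σ / (4 * ‖A p‖ * N * √N)) := by
        have : Real.log N / √N * (1 / √N) = Real.log N / N := by
          rw [div_mul_div_comm, mul_one, hsq]
        rw [hr2, ← this]
        field_simp
    _ ≤ C * (Real.log N / √N) * √(acrlb σ N (A p)) := by
        gcongr
        exact le_sqrt_acrlb hσ hN (hA p)

theorem Regime.small_ratio_bounds {σ : ℝ} (hσ : 0 < σ)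
    (h : Regime N Δ a (maxAmp A) (s * √(Real.log N / N)) A f w m)
    (hs : 0 ≤ s) (hC₀ : 2 / Δ ≤ C) (hC₁ : 10 ^ 11 / Δ ^ 3 * (1 + s) / a ≤ C)
    (hC₂ : 2 * (2 / Δ * (10 ^ 8 * (s / a))) ≤ C)
    (hC₃ : 4 * (10 ^ 11 / Δ ^ 3) ^ 2 * (1 + s) ^ 2 / (a * σ) ≤ C)
    (hlarge : 10 ^ 13 / Δ ^ 4 * (1 + s) * √(Real.log N / N) ≤ a)
    (hlt : 2 / Δ * C * √(Real.log N / N) < 1) (hM : maxAmp A / N ≤ √(Real.log N / N)) :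
    RateLE N (signal A f w) m (√L * (C * √(Real.log N / N))) ∧
      ∃ δ' : EuclideanSpace ℝ (Fin L),
        ConvergesTo N (signal A f w) m C (√L * (C * √(Real.log N / N))) (trueRes N f m) δ' ∧
        TwoIterations σ A N (signal A f w) m C δ' := by
  have hΔ := h.sep_pos
  have hN := h.N_pos'
  have hM0 := h.M_pos
  have hf := h.factor_le_mul hs hC₁ hM le_rfl
  have hη : maxAmp A / N + s * √(Real.log N / N) ≤ (1 + s) * √(Real.log N / N) := by linarith
  have hc : 10 ^ 13 / Δ ^ 4 * (maxAmp A / N + s * √(Real.log N / N)) ≤ a := by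
    refine le_trans ?_ hlarge
    rw [mul_assoc]
    exact mul_le_mul_of_nonneg_left hη (by positivity)
  have hC0 : 0 ≤ C := le_trans (by positivity) hC₀
  have hb1 : √L * (C * √(Real.log N / N)) < 1 := by
    refine lt_of_le_of_lt ?_ hlt
    rw [mul_assoc]
    exact mul_le_mul_of_nonneg_right h.sqrt_card_le (mul_nonneg hC0 (Real.sqrt_nonneg _))
  obtain ⟨δ', hδ', htwo⟩ := h.exists_convergesTo hc hC₀ hf hb1 (h.noise_le_mul hC₂)
  exact ⟨h.rateLE hf, δ', hδ', twoIterations_of_le hσ h.N_pos h.a_pos hs (by positivity) h.ne_zero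
    hC₃ (by positivity) hη htwo⟩

theorem Regime.large_ratio_bounds
    (h : Regime N Δ a (maxAmp A) (s * √(Real.log N / N)) A f w m)
    (hs : 0 ≤ s) (hC₀ : 2 / Δ ≤ C) (hC₁ : 10 ^ 11 / Δ ^ 3 * (1 + s) / a ≤ C)
    (hC₂ : 2 * (2 / Δ * (10 ^ 8 * (s / a))) ≤ C)
    (hr : √(Real.log N / N) ≤ maxRatio N A f)
    (hlarge : 10 ^ 13 / Δ ^ 4 * (1 + s) * √(Real.log N / N) ≤ a / 2) {C' : ℝ}
    (hC' : 2 * 10 ^ 13 / (Δ ^ 4 * a) ≤ C') (hM : maxAmp A / N * C' ≤ 1)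
    (hlt : √L * (C * maxRatio N A f) < 1) :
    ∃ δ' : EuclideanSpace ℝ (Fin L),
      ConvergesTo N (signal A f w) m C (√L * (C * maxRatio N A f)) (trueRes N f m) δ' := by
  have hΔ := h.sep_pos
  have ha := h.a_pos
  have hN := h.N_pos'
  have hM0 := h.M_pos
  have hf := h.factor_le_mul hs hC₁
    (maxAmp_div_le_maxRatio h.sep hΔ h.one_le_mul_N h.two_le) hr
  have hc : 10 ^ 13 / Δ ^ 4 * (maxAmp A / N + s * √(Real.log N / N)) ≤ a := by
    have h1 : 10 ^ 13 / Δ ^ 4 * (maxAmp A / N) ≤ a / 2 := by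
      calc 10 ^ 13 / Δ ^ 4 * (maxAmp A / N) =
            a / 2 * (maxAmp A / N * (2 * 10 ^ 13 / (Δ ^ 4 * a))) := by field_simp
        _ ≤ a / 2 * (maxAmp A / N * C') := by gcongr
        _ ≤ a / 2 := mul_le_of_le_one_right (by positivity) hM
    have h2 : 10 ^ 13 / Δ ^ 4 * (s * √(Real.log N / N)) ≤
        10 ^ 13 / Δ ^ 4 * (1 + s) * √(Real.log N / N) := by
      rw [mul_assoc]
      gcongr
      linarith
    rw [mul_add]
    linarith
  obtain ⟨δ', hδ', -⟩ := h.exists_convergesTo hc hC₀ hf hlt (h.noise_le_mul hC₂)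
  exact ⟨δ', hδ'⟩

end FiniteSamples

/-- The bounds for finite `N`, uniformly over the number of components, the amplitudes and the
frequencies. -/
theorem uniform_convergence [IsProbabilityMeasure μ] {w : ℕ → Ω → ℂ} {σ : ℝ} (hσ : 0 < σ)
    (hw : IsWhiteGaussianNoise μ w σ) {Δ : ℝ} (hΔ : 0 < Δ) {a : ℝ} (ha : 0 < a) :
    ∃ C C' : ℝ, 0 < C ∧ 0 < C' ∧ ∀ K : ℝ, ∀ᵐ ω ∂μ, ∃ N₀ : ℕ, ∀ N ≥ N₀,
      ∀ (L : ℕ) (A : Fin L → ℂ) (f : Fin L → ℝ) (m : Fin L → ℤ), 2 ≤ L → (∀ l, a ≤ ‖A l‖) →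
        Separated Δ f → IsMaxBin N f m →
        ∀ x : ℕ → ℂ, x = signal A f (fun n => w n ω) →
        (maxGamma N A f < Real.log N / N →
          RateLE N x m (√L * (C * √(Real.log N / N))) ∧
          ∃ δ' : EuclideanSpace ℝ (Fin L),
            ConvergesTo N x m C (√L * (C * √(Real.log N / N))) (trueRes N f m) δ' ∧
            TwoIterations σ A N x m C δ') ∧
        (Real.log N / N ≤ maxGamma N A f →
          (maxAmp A ≤ K * N → RateLE N x m (√L * (C * maxRatio N A f))) ∧
          √L * (C * maxRatio N A f) ≤ √L * maxAmp A * (C' / N) ∧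
          (√L * maxAmp A * (C' / N) < 1 →
            RateLE N x m (√L * (C * maxRatio N A f)) ∧
            ∃ δ' : EuclideanSpace ℝ (Fin L),
              ConvergesTo N x m C (√L * (C * maxRatio N A f)) (trueRes N f m) δ')) := by
  set s := 400 * σ with hs
  set κ := 10 ^ 11 / Δ ^ 3 with hκ
  have hs0 : 0 < s := by positivity
  have hκ0 : 0 < κ := by positivity
  set c₁ := κ * (1 + s) / a with hc₁
  set c₂ := 2 * (2 / Δ * (10 ^ 8 * (s / a))) with hc₂
  set c₃ := 4 * κ ^ 2 * (1 + s) ^ 2 / (a * σ) with hc₃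
  have p₁ : 0 < c₁ := by positivity
  have p₂ : 0 < c₂ := by positivity
  have p₃ : 0 < c₃ := by positivity
  have p₄ : 0 < 2 / Δ := by positivity
  set C := 2 / Δ + c₁ + c₂ + c₃ with hC
  have hC0 : 0 < C := by positivity
  -- The first summand converts the maximal ratio into 2M/(ΔN). The second makes a right-hand side
  -- below 1 force the contraction condition on M/N.
  set C' := 2 * C / Δ + 2 * 10 ^ 13 / (Δ ^ 4 * a) with hC'
  have hC'0 : 0 < C' := by positivity
  refine ⟨C, C', hC0, hC'0, fun K => ?_⟩
  -- One multiple of N that covers every use: M ≤ KN by hypothesis, M ≤ N in case (a), and M ≤ N/C'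
  -- when the right-hand side in (b) is below 1.
  set K' := |K| + 1 + 1 / C' with hK'
  have hKK' : K ≤ K' := by
    have := le_abs_self K
    have : 0 < 1 / C' := by positivity
    linarith
  have h1K' : 1 ≤ K' := by
    have : 0 < 1 / C' := by positivity
    linarith [abs_nonneg K]
  have hCK' : 1 / C' ≤ K' := by linarith [abs_nonneg K]
  have hΔ5 : 0 < 10 ^ 11 / Δ ^ 5 := by positivity
  have hΔ4 : 0 < 10 ^ 13 / Δ ^ 4 := by positivity
  filter_upwards [hw.ae_eventually_coef_le hσ] with ω hω
  refine eventually_atTop.mp ?_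
  filter_upwards [hω, eventually_ge_atTop 1, eventually_ge_atTop ⌈10 ^ 5 / Δ ^ 3⌉₊,
    eventually_ge_atTop ⌈1 / Δ⌉₊,
    eventually_div_natCast_lt (10 ^ 11 / Δ ^ 5 * K') (half_pos ha),
    eventually_mul_sqrt_log_div_lt (10 ^ 11 / Δ ^ 5 * s) (half_pos ha),
    eventually_mul_sqrt_log_div_lt (10 ^ 13 / Δ ^ 4 * (1 + s)) (half_pos ha),
    eventually_mul_sqrt_log_div_lt (2 / Δ * C) one_pos] with N hnoise hN hlarge hN1 e₁ e₂ e₃ e₄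
  intro L A f m hL hA hsep hbin x hx
  subst hx
  have hN' : (0 : ℝ) < N := by exact_mod_cast hN
  have hΔN : 1 ≤ Δ * N := by
    have := Nat.ceil_le.mp hN1
    rwa [div_le_iff₀ hΔ, mul_comm] at this
  set r := √(Real.log N / N) with hr
  have hr0 : 0 ≤ r := Real.sqrt_nonneg _
  have hlog : 0 ≤ Real.log N / N := div_nonneg (Real.log_natCast_nonneg N) hN'.le
  have hr2 : r ^ 2 = Real.log N / N := Real.sq_sqrt hlog
  have hM0 : 0 ≤ maxAmp A := (norm_nonneg _).trans (le_maxAmp A ⟨0, by linarith⟩)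
  have regime (hM : maxAmp A ≤ K' * N) :
      Regime N Δ a (maxAmp A) (s * r) A f (fun n => w n ω) m := by
    refine ⟨hΔ, hL, hsep, hbin, Nat.ceil_le.mp hlarge, ha, hA, le_maxAmp A, hnoise.1, hnoise.2, ?_⟩
    have h1 : maxAmp A / (N : ℝ) ^ 2 ≤ K' / N := by
      rw [div_le_div_iff₀ (by positivity) hN']
      nlinarith
    have h2 := mul_le_mul_of_nonneg_left h1 hΔ5.le
    rw [mul_div_assoc (10 ^ 11 / Δ ^ 5) K'] at e₁
    rw [mul_add, ← mul_assoc]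
    linarith
  have hratio := maxAmp_div_le_maxRatio (A := A) hsep hΔ hΔN hL
  have hratio' := maxRatio_le (A := A) hsep hΔ hΔN hL
  have hratio0 : 0 ≤ maxRatio N A f := le_trans (by positivity) hratio
  have q₀ : 2 / Δ ≤ C := by linarith
  have q₁ : c₁ ≤ C := by linarith
  have q₂ : c₂ ≤ C := by linarith
  have q₃ : c₃ ≤ C := by linarith
  constructor
  · intro hγ
    have hMr : maxAmp A / N ≤ r := by
      refine le_of_sq_le_sq ?_ hr0
      rw [hr2]
      exact (sq_maxAmp_div_le_maxGamma hsep hΔ hΔN hL).trans hγ.le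
    have hr1 : r ≤ 1 := by
      have hlog1 := Real.log_le_sub_one_of_pos hN'
      refine Real.sqrt_le_iff.mpr ⟨zero_le_one, ?_⟩
      rw [one_pow, div_le_one hN']
      linarith
    have hMN : maxAmp A ≤ K' * N := by
      rw [div_le_iff₀ hN'] at hMr
      exact hMr.trans (mul_le_mul_of_nonneg_right (hr1.trans h1K') hN'.le)
    exact (regime hMN).small_ratio_bounds hσ hs0.le q₀ q₁ q₂ q₃ (by linarith) e₄ hMr
  · intro hγ
    have hrr : r ≤ maxRatio N A f := by
      refine le_of_sq_le_sq ?_ hratio0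
      rw [hr2]
      exact hγ.trans (maxGamma_le_sq N A f hL)
    have hbound : √L * (C * maxRatio N A f) ≤ √L * maxAmp A * (C' / N) := by
      rw [mul_assoc]
      refine mul_le_mul_of_nonneg_left ?_ (Real.sqrt_nonneg _)
      have h1 := mul_le_mul_of_nonneg_left hratio' hC0.le
      have h2 : C * (maxAmp A * (2 / Δ / N)) = maxAmp A * (2 * C / Δ / N) := by ring
      rw [h2] at h1
      refine h1.trans (mul_le_mul_of_nonneg_left ?_ hM0)
      gcongr
      have : 0 < 2 * 10 ^ 13 / (Δ ^ 4 * a) := by positivity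
      linarith
    refine ⟨fun hM => (regime (hM.trans (by gcongr))).rateLE ((regime (hM.trans (by gcongr))).factor_le_mul
      hs0.le q₁ hratio hrr), hbound,
      fun hlt => ?_⟩
    have hsL : 1 ≤ √(L : ℝ) := by
      rw [Real.one_le_sqrt]
      exact_mod_cast (by linarith : 1 ≤ L)
    have hMC : maxAmp A / N * C' < 1 := by
      refine lt_of_le_of_lt ?_ hlt
      calc maxAmp A / N * C' = 1 * (maxAmp A * (C' / N)) := by ring
        _ ≤ √L * (maxAmp A * (C' / N)) := by gcongr
        _ = _ := by ring
    have hMC' : maxAmp A / N ≤ 1 / C' := by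
      rw [le_div_iff₀ hC'0]
      exact hMC.le
    have R := regime (by
      rw [div_le_iff₀ hN'] at hMC'
      exact hMC'.trans (mul_le_mul_of_nonneg_right hCK' hN'.le))
    have hC'2 : 2 * 10 ^ 13 / (Δ ^ 4 * a) ≤ C' := by
      have : 0 < 2 * C / Δ := by positivity
      linarith
    exact ⟨R.rateLE (R.factor_le_mul hs0.le q₁ hratio hrr), R.large_ratio_bounds hs0.le q₀ q₁ q₂ hrr
      e₃.le hC'2 hMC.le (hbound.trans_lt hlt)⟩

/-- For a fixed signal, the maximum of the `|A l|² / ⟨N (f l - f p)⟩²` is eventually small. -/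
theorem eventually_maxGamma_lt {L : ℕ} (A : Fin L → ℂ) {f : Fin L → ℝ} {Δ : ℝ} (hΔ : 0 < Δ)
    (hL : 2 ≤ L) (hsep : Separated Δ f) :
    ∀ᶠ N : ℕ in atTop, maxGamma N A f < Real.log N / N := by
  filter_upwards [eventually_ge_atTop 3, eventually_ge_atTop ⌈1 / Δ⌉₊,
    eventually_div_natCast_lt ((maxAmp A * (2 / Δ)) ^ 2) one_pos] with N hN hN1 h1
  have hN3 : (3 : ℝ) ≤ N := by exact_mod_cast hN
  have hN' : (0 : ℝ) < N := by linarith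
  have hΔN : 1 ≤ Δ * N := by
    have := Nat.ceil_le.mp hN1
    rwa [div_le_iff₀ hΔ, mul_comm] at this
  have hratio := maxAmp_div_le_maxRatio (A := A) hsep hΔ hΔN hL
  have hM0 : 0 ≤ maxAmp A := (norm_nonneg _).trans (le_maxAmp A ⟨0, by linarith⟩)
  have hlog : 1 ≤ Real.log N := by
    rw [Real.le_log_iff_exp_le hN']
    linarith [Real.exp_one_lt_d9]
  calc maxGamma N A f ≤ maxRatio N A f ^ 2 := maxGamma_le_sq N A f hL
    _ ≤ (maxAmp A * (2 / Δ / N)) ^ 2 :=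
        pow_le_pow_left₀ (le_trans (by positivity) hratio) (maxRatio_le hsep hΔ hΔN hL) 2
    _ = (maxAmp A * (2 / Δ)) ^ 2 / N * (1 / N) := by field_simp
    _ < 1 * (1 / N) := by gcongr
    _ ≤ Real.log N / N := by rw [one_mul]; gcongr

end MultiTone

theorem theorem3 {Ω : Type*} [MeasurableSpace Ω] (μ : Measure Ω) [IsProbabilityMeasure μ]
    (w : ℕ → Ω → ℂ) (σ : ℝ) (hσ : 0 < σ) (hw : MultiTone.IsWhiteGaussianNoise μ w σ)
    (Δ : ℝ) (hΔ : 0 < Δ) :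
    -- asymptotically, for a fixed signal
    (∀ (L : ℕ) (A : Fin L → ℂ) (f : Fin L → ℝ), 2 ≤ L → (∀ l, A l ≠ 0) →
      MultiTone.Separated Δ f →
      ∃ C : ℝ, 0 < C ∧ ∀ᵐ ω ∂μ, ∀ᶠ N : ℕ in atTop, ∀ m : Fin L → ℤ, MultiTone.IsMaxBin N f m →
        ∀ x : ℕ → ℂ, x = MultiTone.signal A f (fun n => w n ω) →
        MultiTone.RateLE N x m (C * √(Real.log N / N)) ∧
        ∃ δ' : EuclideanSpace ℝ (Fin L),
          MultiTone.ConvergesTo N x m C (C * √(Real.log N / N)) (MultiTone.trueRes N f m) δ' ∧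
          MultiTone.TwoIterations σ A N x m C δ') ∧
    -- finite `N`, uniformly over the number of components, the amplitudes and the frequencies
    (∀ a : ℝ, 0 < a → ∃ C C' : ℝ, 0 < C ∧ 0 < C' ∧ ∀ K : ℝ, ∀ᵐ ω ∂μ, ∃ N₀ : ℕ, ∀ N ≥ N₀,
      ∀ (L : ℕ) (A : Fin L → ℂ) (f : Fin L → ℝ) (m : Fin L → ℤ), 2 ≤ L → (∀ l, a ≤ ‖A l‖) →
        MultiTone.Separated Δ f → MultiTone.IsMaxBin N f m →
        ∀ x : ℕ → ℂ, x = MultiTone.signal A f (fun n => w n ω) →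
        (MultiTone.maxGamma N A f < Real.log N / N →
          MultiTone.RateLE N x m (√L * (C * √(Real.log N / N))) ∧
          ∃ δ' : EuclideanSpace ℝ (Fin L),
            MultiTone.ConvergesTo N x m C (√L * (C * √(Real.log N / N)))
              (MultiTone.trueRes N f m) δ' ∧
            MultiTone.TwoIterations σ A N x m C δ') ∧
        (Real.log N / N ≤ MultiTone.maxGamma N A f →
          (MultiTone.maxAmp A ≤ K * N →
            MultiTone.RateLE N x m (√L * (C * MultiTone.maxRatio N A f))) ∧
          √L * (C * MultiTone.maxRatio N A f) ≤ √L * MultiTone.maxAmp A * (C' / N) ∧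
          (√L * MultiTone.maxAmp A * (C' / N) < 1 →
            MultiTone.RateLE N x m (√L * (C * MultiTone.maxRatio N A f)) ∧
            ∃ δ' : EuclideanSpace ℝ (Fin L),
              MultiTone.ConvergesTo N x m C (√L * (C * MultiTone.maxRatio N A f))
                (MultiTone.trueRes N f m) δ'))) := by
  refine ⟨fun L A f hL hA hsep => ?_, fun a ha => MultiTone.uniform_convergence hσ hw hΔ ha⟩
  have : Nonempty (Fin L) := ⟨⟨0, by linarith⟩⟩
  -- For a fixed signal the smallest amplitude serves as a, and the condition of case (a) holds for
  -- all large N.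
  obtain ⟨k, hk⟩ := Finite.exists_min fun l => ‖A l‖
  obtain ⟨C, C', hC, -, h⟩ :=
    MultiTone.uniform_convergence hσ hw hΔ (norm_pos_iff.mpr (hA k))
  have hsL : 1 ≤ √(L : ℝ) := by
    rw [Real.one_le_sqrt]
    exact_mod_cast (by linarith : 1 ≤ L)
  have hCC : C ≤ √L * C := le_mul_of_one_le_left hC.le hsL
  refine ⟨√L * C, by positivity, ?_⟩
  -- The value of K is immaterial, as only case (a) is used.
  filter_upwards [h 0] with ω hω
  obtain ⟨N₀, hN₀⟩ := hω
  filter_upwards [eventually_ge_atTop N₀, MultiTone.eventually_maxGamma_lt A hΔ hL hsep]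
    with N hN hγ m hm x hx
  obtain ⟨hrate, δ', hconv, htwo⟩ := (hN₀ N hN L A f m hL hk hsep hm x hx).1 hγ
  rw [← mul_assoc] at hrate hconv
  exact ⟨hrate, δ', hconv.mono hCC (by positivity), htwo.mono hCC⟩
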